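/- Let $a\in\mathbb R$ and $0<\gamma<\infty$. Let $(n_k)_{k\ge 0}$ be a strictly increasing sequence of positive integers and $(p_k)_{k\ge0}$ a sequence of natural numbers with $p_k/n_k\to\gamma$ (so $p_k\ge1$ for large $k$; the case that $p_k/n_k=\gamma$ for all $k$ is included). For each $k$ let $X^{(k)}_1,\dots,X^{(k)}_{n_k}$ be i.i.d. random vectors with law $\mathcal N(0,p_k^{-1}I_{p_k})$ in $\mathbb R^{p_k}$, all defined on one probability space, with arbitrary dependence between different $k$. Let $A^{(k)}$ be the $n_k\times n_k$ random kernel matrix with linear kernel $f(\xi)=a\xi$ and zero diagonal: $$A^{(k)}_{ij}=a\,(X^{(k)}_i)^TX^{(k)}_j\ (i\ne j),\qquad A^{(k)}_{ii}=0,$$ and let $\mathrm{ESD}_{A^{(k)}}=\frac1{n_k}\sum_{i=1}^{n_k}\delta_{\lambda_i(A^{(k)})}$ be its empirical spectral distribution (eigenvalues counted with multiplicity). For $y>0$ let $\rho_{M.P.}(\cdot\,;y)$ be the Marchenko–Pastur law $$\rho_{M.P.}(t;y)=\Big(1-\frac1y\Big)^{+}\delta_0(t)+\frac{\sqrt{(b(y)-t)^+(t-a(y))^+}}{2\pi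 y t},\qquad b(y)=(1+\sqrt y)^2,\quad a(y)=(1-\sqrt y)^2,$$ where $(x)^+=\max\{x,0\}$, and let $\rho_I$ be the image of the measure $\rho_{M.P.}(t;1/\gamma)\,dt$ under $x\mapsto ax-a$. Then: 1. $\rho_I$ is a probability measure, and for $a\neq0$ it is the measure with (generalized) density $\rho_I(t)=\frac1{|a|}\rho_{M.P.}\big(\frac{t+a}{a};\frac1\gamma\big)$, that is, an atom at $-a$ of mass $(1-\gamma)^+$ plus the rescaled and shifted absolutely continuous part. 2. Almost surely, $\mathrm{ESD}_{A^{(k)}}$ converges weakly to $\rho_I$ as $k\to\infty$. 3. For every $z\in\mathbb C$ with $\Im z>0$ the equation $$-\frac1m=z+a\left(1-\frac1{1+\frac a\gamma m}\right)$$ has exactly one solution $m$ with $\Im m>0$. Moreover $\rho_I$ is characterized by this equation: a probability measure $\nu$ on $\mathbb R$ equals $\rho_I$ if and only if its Stieltjes transform $m(z)=\int_{\mathbb R}\frac{1}{t-z}\,d\nu(t)$ satisfies the equation for every $z$ with $\Im z>0$. -/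

import Mathlib

open Filter Topology MeasureTheory ProbabilityTheory

noncomputable section

/-- The inner-product kernel matrix of the points `X i` with kernel function `f`: off the diagonal
its entries are `f (⟪X i, X j⟫)`, and its diagonal is zero. -/
def kernelMatrix {n p : ℕ} (f : ℝ → ℝ) (X : Fin n → EuclideanSpace ℝ (Fin p)) :
    Matrix (Fin n) (Fin n) ℝ :=
  Matrix.of fun i j => if i = j then 0 else f (inner ℝ (X i) (X j))

theorem kernelMatrix_isHermitian {n p : ℕ} (f : ℝ → ℝ) (X : Fin n → EuclideanSpace ℝ (Fin p)) :
    (kernelMatrix f X).IsHermitian := by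
  ext i j
  simp only [kernelMatrix, Matrix.conjTranspose_apply, Matrix.of_apply, star_trivial]
  rw [real_inner_comm]
  simp only [eq_comm]

/-- The empirical spectral distribution `(1/n) ∑ᵢ δ_{λᵢ(A)}` of a real symmetric `n × n` matrix;
eigenvalues are counted with multiplicity. -/
def esd {n : ℕ} [NeZero n] (A : Matrix (Fin n) (Fin n) ℝ) (hA : A.IsHermitian) :
    ProbabilityMeasure ℝ :=
  ⟨(n : ENNReal)⁻¹ • ∑ i, Measure.dirac (hA.eigenvalues i), ⟨by
    simp [ENNReal.inv_mul_cancel (Nat.cast_ne_zero.mpr (NeZero.ne n)) (ENNReal.natCast_ne_top n)]⟩⟩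

/-- The density of the absolutely continuous part of the Marchenko–Pastur law, with edges
`(1 ± √y)²`. -/
def mpDensity (y t : ℝ) : ℝ :=
  √(max ((1 + √y) ^ 2 - t) 0 * max (t - (1 - √y) ^ 2) 0) / (2 * Real.pi * y * t)

/-- The Marchenko–Pastur law with parameter `y > 0`, with its atom at zero. -/
def mpLaw (y : ℝ) : Measure ℝ :=
  ENNReal.ofReal (max (1 - 1 / y) 0) • Measure.dirac 0
    + volume.withDensity fun t => ENNReal.ofReal (mpDensity y t)

/-- The Stieltjes transform `∫ 1 / (t - z) dμ(t)` of a measure on the line, used for `z` in the upper half-plane. -/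
def stieltjesTransform (μ : Measure ℝ) (z : ℂ) : ℂ :=
  resolventTransform μ z

theorem stieltjesTransform_eq (μ : Measure ℝ) (z : ℂ) :
    stieltjesTransform μ z = ∫ t : ℝ, 1 / ((t : ℂ) - z) ∂μ := by
  simp [stieltjesTransform, resolventTransform, resolvent]

/-- The Marchenko–Pastur equation at the point `z`, for the unknown `m`. It is used only for `m`
with positive imaginary part, where no denominator vanishes. -/
def MPEquation (a γ : ℝ) (z m : ℂ) : Prop :=
  -1 / m = z + a * (1 - 1 / (1 + (a / γ) * m))

end

/-!
The proof goes through Stieltjes transforms `m(z) = ∫ 1 / (t - z) dν(t)` on the upper half-plane.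
Clearing denominators, and writing `c = a / γ`, the Marchenko–Pastur equation is the quadratic
equation `mpPoly a c z m = c (z + a) m² + (z + c) m + 1 = 0`. Everything rests on the fact that it
has at most one root in the upper half-plane (`mpPoly_unique`): taking imaginary parts of
`-1 / m = z + a - a / (1 + c m)` shows that `a c |m|² < |1 + c m|²`, whereas subtracting the
equations of two different roots gives `a c m m' = (1 + c m)(1 + c m')`. This is also a stability
statement: bounded approximate solutions with nonnegative imaginary part converge to the solution
(`tendsto_of_mpPoly_tendsto_zero`).

*The random matrix.* Restoring the diagonal of the kernel matrix gives the Wishart matrix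
`a (X Xᵀ - 1)`, and changes the normalized trace of the resolvent by a quantity of mean
`O(p ^ (-1/2))`, since the squared lengths of the points concentrate around `1`
(`integral_norm_sub_kernelStieltjes_le`). For the Wishart matrix, Gaussian integration by parts in
the entries of `X` turns the resolvent identity into the quadratic equation for the first two
moments of the normalized trace, up to an error `O(1 / p)` (`norm_approx_mpEquation_le`). Changing
one point changes the kernel matrix in one row and one column only, hence the normalized trace of
the resolvent by `O(1 / n)`; McDiarmid's inequality (`HasBoundedDifferences.measureReal_le`) and the
Borel–Cantelli lemma show that the trace is almost surely close to its mean. Together these facts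
say that almost surely the Stieltjes transform of the spectral distribution solves the equation
asymptotically (`ae_tendsto_mpPoly_kernelStieltjes`).

*The limit.* This holds almost surely at all points of a countable dense set at once. There, the
asymptotic equation near `i ∞` gives tightness, and Prokhorov's theorem with uniqueness of the root
gives weak convergence (`exists_tendsto_of_mpPoly_tendsto_zero`). The limit is deterministic,
because a measure is determined by its Stieltjes transform (`eq_of_mpEquation`). No separate
computation of the Stieltjes transform of the Marchenko–Pastur law is needed: for `a ≠ 0` the limit,
which exists by the probabilistic part, is identified by solving the quadratic equation and inverting the
transform, the boundary values giving the density and the residue at `-a` the atom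
(`eq_of_mpEquation_of_ne_zero`). That the Marchenko–Pastur law has total mass one follows. For
`a = 0` all matrices vanish and the limit is the Dirac mass at `0`.
-/

noncomputable section

/-! ### The Marchenko–Pastur equation -/

/-- The Marchenko–Pastur equation with its denominators cleared: for `Im m > 0` the equation says
that this quadratic polynomial in `m`, with `c = a / γ`, vanishes. -/
def mpPoly (a c : ℝ) (z m : ℂ) : ℂ :=
  c * (z + a) * m ^ 2 + (z + c) * m + 1

theorem one_add_ofReal_mul_ne_zero (c : ℝ) {m : ℂ} (hm : 0 < m.im) : 1 + (c : ℂ) * m ≠ 0 := by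
  intro h
  have h1 := congrArg Complex.im h
  have h2 := congrArg Complex.re h
  simp at h1 h2
  rcases h1 with h1 | h1
  · simp [h1] at h2
  · exact hm.ne' h1

theorem mpEquation_iff_mpPoly {a γ : ℝ} {z m : ℂ} (hm : 0 < m.im) :
    MPEquation a γ z m ↔ mpPoly a (a / γ) z m = 0 := by
  have h0 : m ≠ 0 := by rintro rfl; simp at hm
  have h1 := one_add_ofReal_mul_ne_zero (a / γ) hm
  rw [MPEquation, mpPoly]
  push_cast at h1 ⊢
  generalize (a : ℂ) / γ = c at *
  obtain ⟨w, hw⟩ : ∃ w, w = 1 + c * m := ⟨_, rfl⟩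
  rw [← hw] at h1 ⊢
  constructor
  · intro h
    field_simp at h
    linear_combination -h - (m * (z + a) + 1) * hw
  · intro h
    field_simp
    linear_combination -h - (m * (z + a) + 1) * hw

/-- Taking imaginary parts in the equation: a solution in the upper half-plane satisfies the strict
inequality that excludes a second solution. -/
theorem mpPoly_norm_lt {a γ : ℝ} {z m : ℂ} (hz : 0 < z.im) (hm : 0 < m.im)
    (h : mpPoly a (a / γ) z m = 0) :
    a ^ 2 / γ * Complex.normSq m < Complex.normSq (1 + ((a / γ : ℝ) : ℂ) * m) := by
  have h0 : m ≠ 0 := by rintro rfl; simp at hm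
  have h1 := one_add_ofReal_mul_ne_zero (a / γ) hm
  set c : ℝ := a / γ with hc
  have e : -m⁻¹ = z + a - a * (1 + (c : ℂ) * m)⁻¹ := by
    rw [mpPoly] at h
    obtain ⟨w, hw⟩ : ∃ w, w = 1 + (c : ℂ) * m := ⟨_, rfl⟩
    rw [← hw] at h1 ⊢
    field_simp
    linear_combination -h - (m * (z + a) + 1) * hw
  have e2 := congrArg Complex.im e
  have p0 : 0 < Complex.normSq m := Complex.normSq_pos.2 h0
  have p1 : 0 < Complex.normSq (1 + (c : ℂ) * m) := Complex.normSq_pos.2 h1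
  simp only [Complex.neg_im, Complex.inv_im, Complex.sub_im, Complex.add_im, Complex.ofReal_im,
    Complex.im_ofReal_mul, Complex.one_im] at e2
  have e3 : m.im / Complex.normSq m =
      z.im + a ^ 2 / γ * m.im / Complex.normSq (1 + (c : ℂ) * m) := by
    have : a ^ 2 / γ = a * c := by rw [hc]; ring
    rw [this]
    linear_combination e2
  have e4 : a ^ 2 / γ * m.im / Complex.normSq (1 + (c : ℂ) * m) < m.im / Complex.normSq m := by
    linarith
  rw [div_lt_div_iff₀ p1 p0] at e4
  have : m.im * (a ^ 2 / γ * Complex.normSq m) < m.im * Complex.normSq (1 + (c : ℂ) * m) := by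
    linarith
  exact lt_of_mul_lt_mul_left this hm.le

theorem mpPoly_unique {a γ : ℝ} (hγ : 0 < γ) {z m m' : ℂ} (hz : 0 < z.im)
    (hm : 0 < m.im) (hm' : 0 < m'.im) (h : mpPoly a (a / γ) z m = 0)
    (h' : mpPoly a (a / γ) z m' = 0) : m = m' := by
  have l := mpPoly_norm_lt hz hm h
  have l' := mpPoly_norm_lt hz hm' h'
  by_contra hne
  have h0 : m ≠ 0 := by rintro rfl; simp at hm
  have h0' : m' ≠ 0 := by rintro rfl; simp at hm'
  -- subtracting the two equations and dividing by `m - m'`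
  have key : (1 + ((a / γ : ℝ) : ℂ) * m) * (1 + ((a / γ : ℝ) : ℂ) * m')
      = ((a ^ 2 / γ : ℝ) : ℂ) * (m * m') := by
    apply mul_left_cancel₀ (sub_ne_zero.2 hne)
    have e : ((a ^ 2 / γ : ℝ) : ℂ) = a * ((a / γ : ℝ) : ℂ) := by push_cast; ring
    rw [e]
    rw [mpPoly] at h h'
    generalize ((a / γ : ℝ) : ℂ) = c at *
    linear_combination (-m' * (1 + c * m')) * h + (m * (1 + c * m)) * h'
  have key2 := congrArg Complex.normSq key
  simp only [map_mul, Complex.normSq_ofReal] at key2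
  have p := Complex.normSq_nonneg m
  have p' := Complex.normSq_nonneg m'
  have q : 0 ≤ a ^ 2 / γ := by positivity
  have := mul_lt_mul'' l l' (by positivity) (by positivity)
  rw [key2] at this
  exact absurd this (by linarith)

/-- A root in the closed upper half-plane lies in the open one. -/
theorem im_pos_of_mpPoly_eq_zero {a γ : ℝ} {z m : ℂ} (hz : 0 < z.im)
    (hm : 0 ≤ m.im) (h : mpPoly a (a / γ) z m = 0) : 0 < m.im := by
  refine lt_of_le_of_ne hm fun h0 => ?_
  have hmr : m = (m.re : ℂ) := by
    apply Complex.ext <;> simp [h0.symm]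
  set r := m.re
  rw [hmr, mpPoly] at h
  have him := congrArg Complex.im h
  have hre := congrArg Complex.re h
  rw [← Complex.ofReal_pow] at him hre
  simp only [Complex.add_im, Complex.add_re, Complex.mul_im, Complex.mul_re, Complex.ofReal_re,
    Complex.ofReal_im, Complex.one_im, Complex.one_re, Complex.zero_im, Complex.zero_re] at him hre
  have h1 : z.im * (r * (a / γ * r + 1)) = 0 := by linear_combination him
  have h2 : r * (a / γ * r + 1) = 0 := by
    rcases mul_eq_zero.1 h1 with h | h
    · exact absurd h hz.ne'
    · exact h
  have h3 : 1 + (a / γ - a) * r = 0 := by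
    linear_combination hre - (z.re + a) * h2
  rcases mul_eq_zero.1 h2 with h | h
  · rw [h] at h3; simp at h3
  · have h4 : a * r = 0 := by linear_combination h - h3
    have h5 : a / γ * r = 0 := by
      have : a / γ * r = (a * r) / γ := by ring
      rw [this, h4]; simp
    rw [h5] at h; simp at h

theorem continuous_mpPoly (a c : ℝ) (z : ℂ) : Continuous (mpPoly a c z) := by
  unfold mpPoly; fun_prop

/-- Bounded approximate solutions in the closed upper half-plane converge to the solution. -/
theorem tendsto_of_mpPoly_tendsto_zero {a γ : ℝ} (hγ : 0 < γ) {z : ℂ} (hz : 0 < z.im)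
    {m : ℕ → ℂ} {C : ℝ} (hC : ∀ k, ‖m k‖ ≤ C) (him : ∀ k, 0 ≤ (m k).im)
    (h : Tendsto (fun k => mpPoly a (a / γ) z (m k)) atTop (𝓝 0)) :
    ∃ l : ℂ, 0 < l.im ∧ mpPoly a (a / γ) z l = 0 ∧ Tendsto m atTop (𝓝 l) := by
  have hbd : ∀ φ : ℕ → ℕ, Tendsto φ atTop atTop →
      ∃ l : ℂ, 0 < l.im ∧ mpPoly a (a / γ) z l = 0 ∧
        ∃ ψ : ℕ → ℕ, StrictMono ψ ∧ Tendsto (fun k => m (φ (ψ k))) atTop (𝓝 l) := by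
    intro φ hφ
    obtain ⟨l, -, ψ, hψ, hl⟩ := tendsto_subseq_of_bounded
      (Metric.isBounded_closedBall (x := (0 : ℂ)) (r := C)) (x := fun k => m (φ k))
      (fun k => by simpa using hC (φ k))
    have h0 : 0 ≤ l.im :=
      ge_of_tendsto' ((Complex.continuous_im.tendsto _).comp hl) fun k => him _
    have hF : Tendsto (fun k => mpPoly a (a / γ) z (m (φ (ψ k)))) atTop
        (𝓝 (mpPoly a (a / γ) z l)) :=
      ((continuous_mpPoly a (a / γ) z).tendsto l).comp hl
    have hz0 : mpPoly a (a / γ) z l = 0 :=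
      tendsto_nhds_unique hF (h.comp (hφ.comp hψ.tendsto_atTop))
    exact ⟨l, im_pos_of_mpPoly_eq_zero hz h0 hz0, hz0, ψ, hψ, hl⟩
  obtain ⟨l, hl, hl0, -⟩ := hbd id tendsto_id
  refine ⟨l, hl, hl0, tendsto_of_subseq_tendsto fun φ hφ => ?_⟩
  obtain ⟨l', hl', hl0', ψ, -, hψ⟩ := hbd φ hφ
  rw [mpPoly_unique hγ hz hl hl' hl0 hl0']
  exact ⟨ψ, hψ⟩

/-! ### Stieltjes transforms of measures on the line -/

theorem ofReal_sub_ne_zero (t : ℝ) {z : ℂ} (hz : 0 < z.im) : (t : ℂ) - z ≠ 0 := by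
  intro h
  have := congrArg Complex.im h
  simp at this
  exact hz.ne' this

theorem norm_one_div_ofReal_sub_le (t : ℝ) {z : ℂ} (hz : 0 < z.im) :
    ‖1 / ((t : ℂ) - z)‖ ≤ 1 / z.im := by
  rw [norm_div, norm_one]
  apply one_div_le_one_div_of_le hz
  have := Complex.abs_im_le_norm ((t : ℂ) - z)
  simp only [Complex.sub_im, Complex.ofReal_im, zero_sub, abs_neg, abs_of_pos hz] at this
  exact this

theorem continuous_one_div_ofReal_sub {z : ℂ} (hz : 0 < z.im) :
    Continuous fun t : ℝ => 1 / ((t : ℂ) - z) :=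
  continuous_const.div (by fun_prop) fun t => ofReal_sub_ne_zero t hz

theorem integrable_one_div_ofReal_sub (ν : Measure ℝ) [IsFiniteMeasure ν] {z : ℂ}
    (hz : 0 < z.im) : Integrable (fun t : ℝ => 1 / ((t : ℂ) - z)) ν :=
  Integrable.of_bound (continuous_one_div_ofReal_sub hz).aestronglyMeasurable (1 / z.im)
    (ae_of_all _ fun t => norm_one_div_ofReal_sub_le t hz)

theorem norm_stieltjesTransform_le (ν : Measure ℝ) [IsProbabilityMeasure ν] {z : ℂ}
    (hz : 0 < z.im) : ‖stieltjesTransform ν z‖ ≤ 1 / z.im := by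
  rw [stieltjesTransform_eq]
  refine (norm_integral_le_of_norm_le_const
    (ae_of_all _ fun t => norm_one_div_ofReal_sub_le t hz)).trans ?_
  simp

theorem im_one_div_ofReal_sub (t x y : ℝ) :
    (1 / ((t : ℂ) - (x + y * Complex.I))).im = y / ((t - x) ^ 2 + y ^ 2) := by
  rw [one_div, Complex.inv_im, Complex.normSq_apply]
  simp
  ring_nf

theorem im_stieltjesTransform (ν : Measure ℝ) [IsFiniteMeasure ν] (x : ℝ) {y : ℝ} (hy : 0 < y) :
    (stieltjesTransform ν (x + y * Complex.I)).im = ∫ t, y / ((t - x) ^ 2 + y ^ 2) ∂ν := by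
  rw [stieltjesTransform_eq]
  have hz : 0 < ((x : ℂ) + y * Complex.I).im := by simpa using hy
  have := integral_im (integrable_one_div_ofReal_sub ν hz)
  simp only [RCLike.im_to_complex] at this
  rw [← this]
  simp only [im_one_div_ofReal_sub]

theorem integrable_poisson (ν : Measure ℝ) [IsFiniteMeasure ν] (x : ℝ) {y : ℝ} (hy : 0 < y) :
    Integrable (fun t : ℝ => y / ((t - x) ^ 2 + y ^ 2)) ν := by
  have hz : 0 < ((x : ℂ) + y * Complex.I).im := by simpa using hy
  simpa only [RCLike.im_to_complex, im_one_div_ofReal_sub] using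
    (integrable_one_div_ofReal_sub ν hz).im

theorem im_stieltjesTransform_pos (ν : Measure ℝ) [IsProbabilityMeasure ν] {z : ℂ}
    (hz : 0 < z.im) : 0 < (stieltjesTransform ν z).im := by
  have h := im_stieltjesTransform ν z.re hz
  rw [Complex.re_add_im] at h
  rw [h]
  have hpos : ∀ t : ℝ, 0 < z.im / ((t - z.re) ^ 2 + z.im ^ 2) := fun t => by positivity
  rw [integral_pos_iff_support_of_nonneg (fun t => (hpos t).le) (integrable_poisson ν z.re hz)]
  have : Function.support (fun t : ℝ => z.im / ((t - z.re) ^ 2 + z.im ^ 2)) = Set.univ := by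
    ext t; simpa using (hpos t).ne'
  rw [this]; simp

theorem stieltjesTransform_mpEquation_iff (ν : Measure ℝ) [IsProbabilityMeasure ν] {a γ : ℝ}
    {z : ℂ} (hz : 0 < z.im) :
    MPEquation a γ z (stieltjesTransform ν z) ↔
      mpPoly a (a / γ) z (stieltjesTransform ν z) = 0 :=
  mpEquation_iff_mpPoly (im_stieltjesTransform_pos ν hz)

theorem continuousOn_stieltjesTransform (ν : Measure ℝ) [IsFiniteMeasure ν] :
    ContinuousOn (stieltjesTransform ν) {z | 0 < z.im} := by
  intro z hz
  refine (hasDerivAt_resolventTransform z ?_).continuousAt.continuousWithinAt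
  rintro ⟨t, -, rfl⟩
  simp at hz

/-- The tails of a probability measure are controlled by its Stieltjes transform on the imaginary
axis. -/
theorem measureReal_tail_le (ν : Measure ℝ) [IsProbabilityMeasure ν] {R : ℝ} (hR : 0 < R) :
    ν.real {t | R ≤ |t|} ≤ 2 * (1 - R * (stieltjesTransform ν (R * Complex.I)).im) := by
  have h := im_stieltjesTransform ν 0 hR
  simp only [Complex.ofReal_zero, zero_add, sub_zero] at h
  have hi := integrable_poisson ν 0 hR
  simp only [sub_zero] at hi
  rw [h, ← integral_const_mul]
  have h1 : (1 : ℝ) - ∫ t, R * (R / (t ^ 2 + R ^ 2)) ∂ν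
      = ∫ t, (1 - R * (R / (t ^ 2 + R ^ 2))) ∂ν := by
    rw [integral_sub (integrable_const _) (hi.const_mul R)]; simp
  rw [h1, ← integral_const_mul]
  have hm : MeasurableSet {t : ℝ | R ≤ |t|} :=
    measurableSet_le measurable_const (by fun_prop)
  rw [← integral_indicator_one hm]
  apply integral_mono
  · exact (integrable_const (1 : ℝ)).indicator hm
  · exact ((integrable_const _).sub (hi.const_mul R)).const_mul 2
  intro t
  have hp : 0 < t ^ 2 + R ^ 2 := by positivity
  have e : 2 * (1 - R * (R / (t ^ 2 + R ^ 2))) = 2 * t ^ 2 / (t ^ 2 + R ^ 2) := by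
    field_simp; ring
  simp only [e]
  by_cases ht : R ≤ |t|
  · rw [Set.indicator_of_mem (by exact ht), Pi.one_apply, le_div_iff₀ hp]
    have : R ^ 2 ≤ t ^ 2 := by
      rw [← sq_abs t]; gcongr
    linarith
  · rw [Set.indicator_of_notMem (by exact ht)]
    positivity

/-- The Poisson integral of a compactly supported function, in the scaling in which its kernel does
not depend on the height. -/
theorem integral_mul_poisson (f : ℝ → ℝ) (t : ℝ) {y : ℝ} (hy : 0 < y) :
    ∫ x, f x * (y / ((t - x) ^ 2 + y ^ 2)) = ∫ u, f (t + y * u) * (1 + u ^ 2)⁻¹ := by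
  have h1 := integral_add_right_eq_self
    (fun x => f x * (y / ((t - x) ^ 2 + y ^ 2))) t (μ := volume)
  have h2 := Measure.integral_comp_mul_left
    (fun x => f (x + t) * (y / ((t - (x + t)) ^ 2 + y ^ 2))) y
  rw [← h1]
  have h3 : ∫ x, f (x + t) * (y / ((t - (x + t)) ^ 2 + y ^ 2)) =
      y * ∫ u, f (y * u + t) * (y / ((t - (y * u + t)) ^ 2 + y ^ 2)) := by
    rw [h2, abs_of_pos (inv_pos.2 hy), smul_eq_mul, mul_inv_cancel_left₀ hy.ne']
  rw [h3, ← integral_const_mul]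
  congr 1
  ext u
  rw [add_comm (y * u) t]
  have : (0 : ℝ) < 1 + u ^ 2 := by positivity
  have e : (t - (t + y * u)) ^ 2 + y ^ 2 = y ^ 2 * (1 + u ^ 2) := by ring
  rw [e]
  field_simp

/-- Stieltjes inversion against a compactly supported continuous test function. -/
theorem tendsto_integral_im_stieltjesTransform (ν : Measure ℝ) [IsFiniteMeasure ν]
    {f : ℝ → ℝ} (hf : Continuous f) (hs : HasCompactSupport f) :
    Tendsto (fun y : ℝ => ∫ x : ℝ, f x * (stieltjesTransform ν (x + y * Complex.I)).im)
      (𝓝[>] 0) (𝓝 (Real.pi * ∫ t, f t ∂ν)) := by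
  obtain ⟨C, hC⟩ := hf.bounded_above_of_compact_support hs
  have hC0 : 0 ≤ C := (norm_nonneg _).trans (hC 0)
  have hfi : Integrable f := hf.integrable_of_hasCompactSupport hs
  have e : ∀ y : ℝ, 0 < y →
      ∫ x : ℝ, f x * (stieltjesTransform ν (x + y * Complex.I)).im =
        ∫ t, (∫ u, f (t + y * u) * (1 + u ^ 2)⁻¹) ∂ν := by
    intro y hy
    have h1 : ∀ x : ℝ, f x * (stieltjesTransform ν (x + y * Complex.I)).im =
        ∫ t, f x * (y / ((t - x) ^ 2 + y ^ 2)) ∂ν := fun x => by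
      rw [im_stieltjesTransform ν x hy, integral_const_mul]
    simp only [h1]
    rw [integral_integral_swap]
    · simp only [integral_mul_poisson f _ hy]
    · have hc : Continuous fun q : ℝ × ℝ => y / ((q.2 - q.1) ^ 2 + y ^ 2) :=
        continuous_const.div (by fun_prop) fun q => by positivity
      refine (hfi.comp_fst ν).mul_bdd (c := 1 / y) hc.aestronglyMeasurable (ae_of_all _ fun q => ?_)
      rw [Real.norm_of_nonneg (by positivity), div_le_div_iff₀ (by positivity) hy]
      nlinarith [sq_nonneg (q.2 - q.1)]
  have hlim : Tendsto (fun y : ℝ => ∫ t, (∫ u, f (t + y * u) * (1 + u ^ 2)⁻¹) ∂ν)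
      (𝓝[>] 0) (𝓝 (∫ t, Real.pi * f t ∂ν)) := by
    have hb : ∀ y t u : ℝ, ‖f (t + y * u) * (1 + u ^ 2)⁻¹‖ ≤ C * (1 + u ^ 2)⁻¹ := by
      intro y t u
      rw [norm_mul, Real.norm_of_nonneg (show (0 : ℝ) ≤ (1 + u ^ 2)⁻¹ by positivity)]
      exact mul_le_mul_of_nonneg_right (hC _) (by positivity)
    have hcont : Continuous fun q : (ℝ × ℝ) × ℝ => f (q.1.2 + q.1.1 * q.2) * (1 + q.2 ^ 2)⁻¹ :=
      (hf.comp (by fun_prop)).mul (Continuous.inv₀ (by fun_prop) fun q => by positivity)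
    refine tendsto_integral_filter_of_dominated_convergence (fun _ => C * Real.pi) ?_ ?_
      (integrable_const _) ?_
    · refine Eventually.of_forall fun y => ?_
      have : Continuous fun q : ℝ × ℝ => f (q.1 + y * q.2) * (1 + q.2 ^ 2)⁻¹ :=
        hcont.comp (f := fun q : ℝ × ℝ => ((y, q.1), q.2)) (by fun_prop)
      exact (this.stronglyMeasurable.integral_prod_right').aestronglyMeasurable
    · refine Eventually.of_forall fun y => ae_of_all _ fun t => ?_
      refine (norm_integral_le_of_norm_le (integrable_inv_one_add_sq.const_mul C)
        (ae_of_all _ fun u => hb y t u)).trans ?_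
      rw [integral_const_mul, integral_univ_inv_one_add_sq]
    · refine ae_of_all _ fun t => ?_
      have : Real.pi * f t = ∫ u, f (t + 0 * u) * (1 + u ^ 2)⁻¹ := by
        simp only [zero_mul, add_zero]
        rw [integral_const_mul, integral_univ_inv_one_add_sq, mul_comm]
      rw [this]
      refine tendsto_integral_filter_of_dominated_convergence (fun u => C * (1 + u ^ 2)⁻¹) ?_ ?_
        (integrable_inv_one_add_sq.const_mul C) ?_
      · exact Eventually.of_forall fun y => (hcont.comp
          (f := fun u : ℝ => ((y, t), u)) (by fun_prop)).aestronglyMeasurable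
      · exact Eventually.of_forall fun y => ae_of_all _ fun u => hb y t u
      · refine ae_of_all _ fun u => ?_
        have : Continuous fun y : ℝ => f (t + y * u) * (1 + u ^ 2)⁻¹ :=
          hcont.comp (f := fun y : ℝ => ((y, t), u)) (by fun_prop)
        exact (this.tendsto 0).mono_left nhdsWithin_le_nhds
  rw [integral_const_mul] at hlim
  refine hlim.congr' ?_
  filter_upwards [self_mem_nhdsWithin] with y hy
  exact (e y hy).symm

/-- A finite measure on the line is determined by its Stieltjes transform. -/
theorem eq_of_stieltjesTransform_eq {ν ν' : Measure ℝ} [IsFiniteMeasure ν] [IsFiniteMeasure ν']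
    (h : ∀ z : ℂ, 0 < z.im → stieltjesTransform ν z = stieltjesTransform ν' z) : ν = ν' := by
  refine Measure.ext_of_integral_eq_on_compactlySupported fun f => ?_
  have h1 := tendsto_integral_im_stieltjesTransform ν f.continuous f.hasCompactSupport
  have h2 := tendsto_integral_im_stieltjesTransform ν' f.continuous f.hasCompactSupport
  refine mul_left_cancel₀ Real.pi_ne_zero (tendsto_nhds_unique (h1.congr' ?_) h2)
  filter_upwards [self_mem_nhdsWithin] with y hy
  congr 1
  ext x
  rw [h]
  simpa using hy

theorem eq_of_mpEquation {a γ : ℝ} (hγ : 0 < γ) {ν ν' : Measure ℝ} [IsProbabilityMeasure ν]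
    [IsProbabilityMeasure ν']
    (h : ∀ z : ℂ, 0 < z.im → MPEquation a γ z (stieltjesTransform ν z))
    (h' : ∀ z : ℂ, 0 < z.im → MPEquation a γ z (stieltjesTransform ν' z)) : ν = ν' := by
  refine eq_of_stieltjesTransform_eq fun z hz => ?_
  exact mpPoly_unique hγ hz (im_stieltjesTransform_pos ν hz) (im_stieltjesTransform_pos ν' hz)
    ((stieltjesTransform_mpEquation_iff ν hz).1 (h z hz))
    ((stieltjesTransform_mpEquation_iff ν' hz).1 (h' z hz))

/-! ### Convergence of measures from approximate solutions of the equation -/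

theorem tendsto_stieltjesTransform {ν : ℕ → ProbabilityMeasure ℝ} {μ : ProbabilityMeasure ℝ}
    (h : Tendsto ν atTop (𝓝 μ)) {z : ℂ} (hz : 0 < z.im) :
    Tendsto (fun k => stieltjesTransform (ν k) z) atTop (𝓝 (stieltjesTransform μ z)) := by
  have := (ProbabilityMeasure.tendsto_iff_forall_integral_rclike_tendsto ℂ).1 h
    (BoundedContinuousFunction.ofNormedAddCommGroup _ (continuous_one_div_ofReal_sub hz) _
      fun t => norm_one_div_ofReal_sub_le t hz)
  simpa only [stieltjesTransform_eq, BoundedContinuousFunction.coe_ofNormedAddCommGroup] using this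

/-- A countable set of points that suffices to test the equation: dense in the upper half-plane,
and containing the points at integer height over the origin that control the tails. -/
theorem exists_countable_dense_upperHalfPlane :
    ∃ D : Set ℂ, D.Countable ∧ (∀ z ∈ D, 0 < z.im) ∧ {z : ℂ | 0 < z.im} ⊆ closure D ∧
      ∀ N : ℕ, 0 < N → (((N : ℝ) : ℂ) * Complex.I) ∈ D := by
  obtain ⟨s, hs, hd⟩ := TopologicalSpace.exists_countable_dense ℂ
  have ho : IsOpen {z : ℂ | 0 < z.im} := isOpen_lt continuous_const Complex.continuous_im
  refine ⟨({z : ℂ | 0 < z.im} ∩ s) ∪ (fun N : ℕ => (((N : ℝ) : ℂ) * Complex.I)) '' {N | 0 < N},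
    (hs.mono Set.inter_subset_right).union ((Set.to_countable _).image _), ?_, ?_, ?_⟩
  · rintro z (hz | ⟨N, hN, rfl⟩)
    · exact hz.1
    · simpa using hN
  · exact (hd.open_subset_closure_inter ho).trans (closure_mono Set.subset_union_left)
  · exact fun N hN => Or.inr ⟨N, hN, rfl⟩

/-- High up on the imaginary axis a bounded solution behaves like `-1 / z`, the transform of a
measure of mass one. -/
theorem one_sub_mul_im_le {a c : ℝ} {R : ℝ} (hR : 1 ≤ R) {l : ℂ} (hl : ‖l‖ ≤ 1 / R)
    (h : mpPoly a c (R * Complex.I) l = 0) :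
    1 - R * l.im ≤ |c| * (2 + |a|) / R := by
  have hR0 : 0 < R := by linarith
  have e : 1 + R * Complex.I * l = -(c * (R * Complex.I + a) * l ^ 2 + c * l) := by
    rw [mpPoly] at h
    linear_combination h
  have hre : (1 + R * Complex.I * l).re = 1 - R * l.im := by
    simp [Complex.mul_re, Complex.mul_im]
    ring
  rw [← hre]
  refine (Complex.re_le_norm _).trans ?_
  rw [e, norm_neg]
  refine (norm_add_le _ _).trans ?_
  simp only [norm_mul, norm_pow, Complex.norm_real, Real.norm_eq_abs]
  have h1 : ‖(R : ℂ) * Complex.I + a‖ ≤ R + |a| * R := by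
    refine (norm_add_le _ _).trans ?_
    simp only [norm_mul, Complex.norm_real, Real.norm_eq_abs, Complex.norm_I, mul_one,
      abs_of_pos hR0]
    have := abs_nonneg a
    nlinarith
  have h2 : ‖l‖ ^ 2 ≤ (1 / R) ^ 2 := by gcongr
  calc |c| * ‖(R : ℂ) * Complex.I + a‖ * ‖l‖ ^ 2 + |c| * ‖l‖
      ≤ |c| * (R + |a| * R) * (1 / R) ^ 2 + |c| * (1 / R) := by gcongr
    _ = |c| * (2 + |a|) / R := by field_simp; ring

/-- The limits of the transforms at the points `i N` bound the limits of the tails beyond `N`. -/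
theorem isTightMeasureSet_of_mpPoly_tendsto_zero {a γ : ℝ} (hγ : 0 < γ)
    {ν : ℕ → ProbabilityMeasure ℝ}
    (h : ∀ N : ℕ, 0 < N → Tendsto (fun k => mpPoly a (a / γ) ((N : ℝ) * Complex.I)
      (stieltjesTransform (ν k) ((N : ℝ) * Complex.I))) atTop (𝓝 0)) :
    IsTightMeasureSet (Set.range fun k => (ν k : Measure ℝ)) := by
  apply isTightMeasureSet_range_of_tendsto_limsup_measure_norm_gt
  rw [ENNReal.tendsto_nhds_zero]
  intro ε hε
  obtain ⟨δ, hδ0, hδ⟩ : ∃ δ : ℝ, 0 < δ ∧ ENNReal.ofReal δ ≤ ε := by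
    rcases eq_or_ne ε ⊤ with rfl | hne
    · exact ⟨1, one_pos, le_top⟩
    · exact ⟨ε.toReal, ENNReal.toReal_pos hε.ne' hne, by rw [ENNReal.ofReal_toReal hne]⟩
  obtain ⟨N, hN⟩ := exists_nat_gt (max 1 (2 * (|a / γ| * (2 + |a|)) / δ))
  have hN1 : (1 : ℝ) < N := (le_max_left _ _).trans_lt hN
  have hN0 : (0 : ℝ) < N := by linarith
  have hN2 : 2 * (|a / γ| * (2 + |a|)) / N < δ := by
    have := (le_max_right _ _).trans_lt hN
    rw [div_lt_iff₀ hδ0] at this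
    rw [div_lt_iff₀ hN0]
    linarith
  have hz : 0 < (((N : ℝ) : ℂ) * Complex.I).im := by simpa using hN0
  have hzN : (((N : ℝ) : ℂ) * Complex.I).im = N := by simp
  have hb : ∀ k, ‖stieltjesTransform (ν k) (((N : ℝ) : ℂ) * Complex.I)‖ ≤ 1 / N := fun k => by
    have := norm_stieltjesTransform_le (ν k : Measure ℝ) hz
    rwa [hzN] at this
  obtain ⟨l, hl, hl0, hlim⟩ := tendsto_of_mpPoly_tendsto_zero hγ hz hb
    (fun k => (im_stieltjesTransform_pos (ν k : Measure ℝ) hz).le)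
    (h N (by exact_mod_cast hN0))
  have hlb : ‖l‖ ≤ 1 / N := le_of_tendsto' hlim.norm hb
  have h1 := one_sub_mul_im_le hN1.le hlb hl0
  have h2 : Tendsto (fun k => 2 * (1 - N * (stieltjesTransform (ν k)
      (((N : ℝ) : ℂ) * Complex.I)).im)) atTop (𝓝 (2 * (1 - N * l.im))) :=
    (((Complex.continuous_im.tendsto l).comp hlim).const_mul _ |>.const_sub _).const_mul _
  have h3 : 2 * (1 - N * l.im) < δ := by
    refine lt_of_le_of_lt ?_ hN2
    rw [mul_div_assoc]
    linarith
  have h4 := h2.eventually (gt_mem_nhds h3)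
  filter_upwards [eventually_ge_atTop (N : ℝ)] with r hr
  refine limsup_le_of_le (h := ?_)
  filter_upwards [h4] with k hk
  refine le_trans ?_ hδ
  have h5 := measureReal_tail_le (ν k : Measure ℝ) hN0
  have h6 : (ν k : Measure ℝ) {x | r < ‖x‖} ≤ (ν k : Measure ℝ) {t | (N : ℝ) ≤ |t|} :=
    measure_mono fun x hx => hr.trans (le_of_lt hx)
  refine h6.trans ?_
  rw [← ofReal_measureReal]
  exact ENNReal.ofReal_le_ofReal (h5.trans hk.le)

/-- Probability measures whose Stieltjes transforms asymptotically solve the equation on a dense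
set converge weakly, and their limit has a transform that solves it exactly. -/
theorem exists_tendsto_of_mpPoly_tendsto_zero {a γ : ℝ} (hγ : 0 < γ)
    {ν : ℕ → ProbabilityMeasure ℝ} {D : Set ℂ} (hD : ∀ z ∈ D, 0 < z.im)
    (hcl : {z : ℂ | 0 < z.im} ⊆ closure D)
    (hN : ∀ N : ℕ, 0 < N → (((N : ℝ) : ℂ) * Complex.I) ∈ D)
    (h : ∀ z ∈ D, Tendsto (fun k => mpPoly a (a / γ) z (stieltjesTransform (ν k) z))
      atTop (𝓝 0)) :
    ∃ μ : ProbabilityMeasure ℝ, Tendsto ν atTop (𝓝 μ) ∧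
      ∀ z : ℂ, 0 < z.im → MPEquation a γ z (stieltjesTransform μ z) := by
  have htight := isTightMeasureSet_of_mpPoly_tendsto_zero hγ fun N h0 => h _ (hN N h0)
  have hK : IsCompact (closure (Set.range ν)) := by
    apply isCompact_closure_of_isTightMeasureSet
    convert htight using 1
    ext m
    simp
  have hsub : ∀ φ : ℕ → ℕ, Tendsto φ atTop atTop → ∃ μ : ProbabilityMeasure ℝ,
      (∀ z : ℂ, 0 < z.im → MPEquation a γ z (stieltjesTransform μ z)) ∧
      ∃ ψ : ℕ → ℕ, Tendsto (fun k => ν (φ (ψ k))) atTop (𝓝 μ) := by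
    intro φ hφ
    obtain ⟨μ, -, ψ, hψ, hlim⟩ := hK.tendsto_subseq (x := fun k => ν (φ k))
      fun k => subset_closure ⟨_, rfl⟩
    refine ⟨μ, fun z hz => ?_, ψ, hlim⟩
    rw [stieltjesTransform_mpEquation_iff (μ : Measure ℝ) hz]
    have hon : Set.EqOn (fun z => mpPoly a (a / γ) z (stieltjesTransform μ z)) (fun _ => 0) D := by
      intro w hw
      have h1 := ((continuous_mpPoly a (a / γ) w).tendsto _).comp
        (tendsto_stieltjesTransform hlim (hD w hw))
      exact tendsto_nhds_unique h1 ((h w hw).comp (hφ.comp hψ.tendsto_atTop))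
    have hc : ContinuousOn (fun z => mpPoly a (a / γ) z (stieltjesTransform μ z))
        {z : ℂ | 0 < z.im} := by
      have := continuousOn_stieltjesTransform (μ : Measure ℝ)
      unfold mpPoly
      fun_prop
    exact hon.of_subset_closure hc continuousOn_const hD hcl hz
  obtain ⟨μ, hμ, -⟩ := hsub id tendsto_id
  refine ⟨μ, tendsto_of_subseq_tendsto fun φ hφ => ?_, hμ⟩
  obtain ⟨μ', hμ', ψ, hψ⟩ := hsub φ hφ
  have : μ = μ' := ProbabilityMeasure.toMeasure_injective (eq_of_mpEquation hγ hμ hμ')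
  rw [this]
  exact ⟨ψ, hψ⟩

/-! ### Identification of the solution with the Marchenko–Pastur law -/

/-- The density of the image of the Marchenko–Pastur law under `x ↦ a x - a`. -/
def shiftedDensity (a γ t : ℝ) : ℝ :=
  1 / |a| * mpDensity (1 / γ) ((t + a) / a)

theorem mpDensity_eq {y : ℝ} (hy : 0 < y) (s : ℝ) :
    mpDensity y s = √(max (4 * y * s - (s - 1 + y) ^ 2) 0) / (2 * Real.pi * y * s) := by
  rw [mpDensity]
  obtain ⟨r, hr, rfl⟩ : ∃ r : ℝ, 0 < r ∧ y = r ^ 2 :=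
    ⟨√y, Real.sqrt_pos.2 hy, (Real.sq_sqrt hy.le).symm⟩
  rw [Real.sqrt_sq hr.le]
  congr 2
  have e : 4 * r ^ 2 * s - (s - 1 + r ^ 2) ^ 2 = ((1 + r) ^ 2 - s) * (s - (1 - r) ^ 2) := by ring
  rw [e]
  rcases le_total ((1 + r) ^ 2) s with h1 | h1
  · have h2 : (1 - r) ^ 2 ≤ s := by nlinarith
    rw [max_eq_right (sub_nonpos.2 h1), max_eq_left (sub_nonneg.2 h2), zero_mul, max_eq_right]
    exact mul_nonpos_of_nonpos_of_nonneg (sub_nonpos.2 h1) (sub_nonneg.2 h2)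
  · rcases le_total s ((1 - r) ^ 2) with h2 | h2
    · rw [max_eq_right (sub_nonpos.2 h2), mul_zero, max_eq_right]
      exact mul_nonpos_of_nonneg_of_nonpos (sub_nonneg.2 h1) (sub_nonpos.2 h2)
    · rw [max_eq_left (sub_nonneg.2 h1), max_eq_left (sub_nonneg.2 h2), max_eq_left]
      exact mul_nonneg (sub_nonneg.2 h1) (sub_nonneg.2 h2)

theorem pi_mul_shiftedDensity {a γ : ℝ} (ha : a ≠ 0) (hγ : 0 < γ) (x : ℝ) :
    Real.pi * shiftedDensity a γ x =
      √(max (4 * (a / γ) * (x + a) - (x + a / γ) ^ 2) 0) / |2 * (a / γ) * (x + a)| := by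
  obtain ⟨y, hy, rfl⟩ : ∃ y : ℝ, 0 < y ∧ γ = 1 / y := ⟨1 / γ, by positivity, by simp⟩
  obtain ⟨s, rfl⟩ : ∃ s : ℝ, x = a * s - a := ⟨(x + a) / a, by field_simp; ring⟩
  have e0 : (a * s - a + a) / a = s := by field_simp; ring
  have e1 : 1 / (1 / y) = y := by simp
  have e2 : a / (1 / y) = a * y := by simp
  rw [shiftedDensity, e0, e1, e2, mpDensity_eq hy]
  have e3 : 4 * (a * y) * (a * s - a + a) - (a * s - a + a * y) ^ 2 =
      a ^ 2 * (4 * y * s - (s - 1 + y) ^ 2) := by ring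
  have e4 : 2 * (a * y) * (a * s - a + a) = 2 * a ^ 2 * y * s := by ring
  rw [e3, e4]
  rcases le_or_gt (4 * y * s - (s - 1 + y) ^ 2) 0 with h | h
  · rw [max_eq_right h, max_eq_right (mul_nonpos_of_nonneg_of_nonpos (sq_nonneg a) h)]
    simp
  · have hs : 0 < s := by
      have : 0 < 4 * y * s := by nlinarith [sq_nonneg (s - 1 + y)]
      exact pos_of_mul_pos_right this (by positivity)
    have ha' : 0 < |a| := abs_pos.2 ha
    have hp : 0 < a ^ 2 := by positivity
    rw [max_eq_left h.le, max_eq_left (mul_pos hp h).le, Real.sqrt_mul (sq_nonneg a),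
      Real.sqrt_sq_eq_abs, abs_of_pos (a := 2 * a ^ 2 * y * s) (by positivity), ← sq_abs a]
    have := Real.pi_pos
    field_simp

theorem shiftedDensity_nonneg {a γ : ℝ} (ha : a ≠ 0) (hγ : 0 < γ) (x : ℝ) :
    0 ≤ shiftedDensity a γ x := by
  have h : 0 ≤ Real.pi * shiftedDensity a γ x := by
    rw [pi_mul_shiftedDensity ha hγ]; positivity
  exact nonneg_of_mul_nonneg_right h Real.pi_pos

theorem measurable_mpDensity (y : ℝ) : Measurable (mpDensity y) := by
  unfold mpDensity
  fun_prop

theorem measurable_shiftedDensity (a γ : ℝ) : Measurable (shiftedDensity a γ) := by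
  unfold shiftedDensity
  exact ((measurable_mpDensity _).comp (by fun_prop)).const_mul _

/-- The function `m` may blow up at `-a`, but `(z + a) m` stays bounded. -/
theorem norm_mul_root_le {a c : ℝ} (hc : c ≠ 0) {z m : ℂ} (h : mpPoly a c z m = 0) :
    ‖(z + a) * m‖ ≤ 1 + (2 * ‖z‖ + |c| + |a|) / |c| := by
  set u := (z + a) * m with hu
  have e : c * u ^ 2 = -((z + c) * u + (z + a)) := by
    rw [mpPoly] at h
    rw [hu]
    linear_combination (z + a) * h
  have hc' : 0 < |c| := abs_pos.2 hc
  have hq : 0 ≤ (2 * ‖z‖ + |c| + |a|) / |c| := by positivity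
  rcases le_total ‖u‖ 1 with h1 | h1
  · linarith
  have h2 : |c| * ‖u‖ ^ 2 ≤ (‖z‖ + |c|) * ‖u‖ + (‖z‖ + |a|) := by
    calc |c| * ‖u‖ ^ 2 = ‖(c : ℂ) * u ^ 2‖ := by simp
      _ ≤ ‖z + c‖ * ‖u‖ + ‖z + a‖ := by
          rw [e, norm_neg, ← norm_mul]; exact norm_add_le _ _
      _ ≤ (‖z‖ + |c|) * ‖u‖ + (‖z‖ + |a|) := by
          gcongr
          · exact (norm_add_le _ _).trans (by simp)
          · exact (norm_add_le _ _).trans (by simp)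
  have h3 : |c| * ‖u‖ ≤ 2 * ‖z‖ + |c| + |a| := by
    have : (|c| * ‖u‖) * ‖u‖ ≤ (2 * ‖z‖ + |c| + |a|) * ‖u‖ := by
      have := norm_nonneg z
      have := abs_nonneg a
      nlinarith
    exact le_of_mul_le_mul_right this (by linarith)
  have h4 : ‖u‖ ≤ (2 * ‖z‖ + |c| + |a|) / |c| := by
    rw [le_div_iff₀ hc']; linarith
  linarith

theorem im_sq_eq (w : ℂ) : w.im ^ 2 = (‖w ^ 2‖ - (w ^ 2).re) / 2 := by
  rw [norm_pow, ← Complex.normSq_eq_norm_sq, Complex.normSq_apply, sq w, Complex.mul_re]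
  ring

theorem tendsto_ofReal_add_mul_I (x : ℝ) :
    Tendsto (fun y : ℝ => (x : ℂ) + y * Complex.I) (𝓝[>] 0) (𝓝 x) := by
  have : Continuous fun y : ℝ => (x : ℂ) + y * Complex.I := by fun_prop
  simpa using (this.tendsto 0).mono_left nhdsWithin_le_nhds

/-- Boundary values of the solution: its imaginary part tends to `π` times the density. The root
is written as `m = (w - (z + c)) / (2 c (z + a))` with `w ^ 2` the discriminant, and only `|Im w|`
is used, so that no branch of the square root has to be chosen. -/
theorem tendsto_im_root {a γ : ℝ} (ha : a ≠ 0) (hγ : 0 < γ) {m : ℂ → ℂ}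
    (him : ∀ z : ℂ, 0 < z.im → 0 < (m z).im)
    (hm : ∀ z : ℂ, 0 < z.im → mpPoly a (a / γ) z (m z) = 0) {x : ℝ} (hx : x ≠ -a) :
    Tendsto (fun y : ℝ => (m (x + y * Complex.I)).im) (𝓝[>] 0)
      (𝓝 (Real.pi * shiftedDensity a γ x)) := by
  have hc : a / γ ≠ 0 := div_ne_zero ha hγ.ne'
  rw [pi_mul_shiftedDensity ha hγ]
  set c := a / γ with hcdef
  have hxa : x + a ≠ 0 := fun h => hx (by linarith)
  set Δ := (x + c) ^ 2 - 4 * c * (x + a) with hΔ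
  set w : ℝ → ℂ := fun y => 2 * c * ((x + y * Complex.I) + a) * m (x + y * Complex.I)
    + ((x + y * Complex.I) + c) with hw
  have hzt := tendsto_ofReal_add_mul_I x
  have hw2 : Tendsto (fun y => w y ^ 2) (𝓝[>] 0) (𝓝 (Δ : ℂ)) := by
    have h1 : Tendsto (fun y : ℝ => ((x + y * Complex.I) + (c : ℂ)) ^ 2
        - 4 * c * ((x + y * Complex.I) + a)) (𝓝[>] 0) (𝓝 (((x : ℂ) + c) ^ 2 - 4 * c * (x + a))) :=
      ((hzt.add_const _).pow 2).sub ((hzt.add_const _).const_mul _)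
    have e : (Δ : ℂ) = ((x : ℂ) + c) ^ 2 - 4 * c * (x + a) := by rw [hΔ]; push_cast; ring
    rw [e]
    refine h1.congr' ?_
    filter_upwards [self_mem_nhdsWithin] with y hy
    have := hm (x + y * Complex.I) (by simpa using hy)
    rw [mpPoly] at this
    simp only [hw]
    linear_combination (-4 * c * ((x + y * Complex.I) + a)) * this
  have hwim : Tendsto (fun y => |(w y).im|) (𝓝[>] 0) (𝓝 √(max (-Δ) 0)) := by
    have h1 : Tendsto (fun y => √((‖w y ^ 2‖ - (w y ^ 2).re) / 2)) (𝓝[>] 0)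
        (𝓝 √((‖(Δ : ℂ)‖ - (Δ : ℂ).re) / 2)) :=
      (Real.continuous_sqrt.tendsto _).comp
        ((hw2.norm.sub ((Complex.continuous_re.tendsto _).comp hw2)).div_const 2)
    have e : (‖(Δ : ℂ)‖ - (Δ : ℂ).re) / 2 = max (-Δ) 0 := by
      rw [Complex.norm_real, Complex.ofReal_re, Real.norm_eq_abs]
      rcases le_total Δ 0 with h | h
      · rw [abs_of_nonpos h, max_eq_left (by linarith)]; ring
      · rw [abs_of_nonneg h, max_eq_right (by linarith)]; ring
    rw [e] at h1
    refine h1.congr fun y => ?_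
    rw [← im_sq_eq, Real.sqrt_sq_eq_abs]
  -- `m` is bounded near `x`, so `Im ((z + a) m)` may be replaced by `(x + a) Im m` in the limit
  obtain ⟨C, hC⟩ : ∃ C : ℝ, ∀ᶠ y : ℝ in 𝓝[>] 0, ‖m (x + y * Complex.I)‖ ≤ C := by
    have h1 : Tendsto
        (fun y : ℝ => (1 + (2 * ‖(x : ℂ) + y * Complex.I‖ + |c| + |a|) / |c|) / |x + a|)
        (𝓝[>] 0) (𝓝 ((1 + (2 * ‖(x : ℂ)‖ + |c| + |a|) / |c|) / |x + a|)) :=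
      ((((hzt.norm.const_mul 2).add_const _).add_const _).div_const _ |>.const_add 1).div_const _
    refine ⟨(1 + (2 * ‖(x : ℂ)‖ + |c| + |a|) / |c|) / |x + a| + 1, ?_⟩
    filter_upwards [h1.eventually (gt_mem_nhds (lt_add_one _)), self_mem_nhdsWithin] with y hy hy0
    refine le_trans ?_ hy.le
    rw [le_div_iff₀ (abs_pos.2 hxa)]
    refine le_trans ?_ (norm_mul_root_le hc (hm (x + y * Complex.I) (by simpa using hy0)))
    rw [norm_mul, mul_comm]
    gcongr
    have := Complex.abs_re_le_norm ((x : ℂ) + y * Complex.I + a)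
    simpa using this
  have hyt : Tendsto (fun y : ℝ => y) (𝓝[>] 0) (𝓝 0) := nhdsWithin_le_nhds
  have hre : Tendsto (fun y : ℝ => y * (m (x + y * Complex.I)).re) (𝓝[>] 0) (𝓝 0) := by
    have h1 : Tendsto (fun y : ℝ => |y| * C) (𝓝[>] 0) (𝓝 0) := by
      simpa using hyt.abs.mul_const C
    refine squeeze_zero_norm' ?_ h1
    filter_upwards [hC] with y hy
    rw [norm_mul, Real.norm_eq_abs]
    gcongr
    exact (Complex.abs_re_le_norm _).trans hy
  have hdiff : Tendsto (fun y : ℝ => (w y).im - 2 * c * (x + a) * (m (x + y * Complex.I)).im)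
      (𝓝[>] 0) (𝓝 0) := by
    have h1 : Tendsto (fun y : ℝ => 2 * c * (y * (m (x + y * Complex.I)).re) + y)
        (𝓝[>] 0) (𝓝 0) := by
      simpa using (hre.const_mul (2 * c)).add hyt
    refine h1.congr fun y => ?_
    simp [hw, Complex.add_im, Complex.mul_im, Complex.mul_re]
    ring
  have habs : Tendsto (fun y : ℝ => |2 * c * (x + a)| * (m (x + y * Complex.I)).im)
      (𝓝[>] 0) (𝓝 √(max (-Δ) 0)) := by
    have h2 := hwim.sub (squeeze_zero_norm' (Eventually.of_forall fun y =>
      (abs_abs_sub_abs_le (w y).im (2 * c * (x + a) * (m (x + y * Complex.I)).im)))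
      (by simpa using hdiff.abs))
    rw [sub_zero] at h2
    refine h2.congr' ?_
    filter_upwards [self_mem_nhdsWithin] with y hy
    have := him (x + y * Complex.I) (by simpa using hy)
    rw [abs_mul (2 * c * (x + a)), abs_of_pos this]
    ring
  have hne : |2 * c * (x + a)| ≠ 0 := by
    rw [abs_ne_zero]; positivity
  have := habs.div_const |2 * c * (x + a)|
  rw [show -Δ = 4 * c * (x + a) - (x + c) ^ 2 by rw [hΔ]; ring] at this
  refine this.congr fun y => ?_
  field_simp

/-- Stieltjes inversion for a solution of the equation, against test functions multiplied by
`|x + a|`. The factor compensates the only point `-a` near which the transform can be unbounded,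
and makes dominated convergence apply up to that point. -/
theorem integral_mul_abs_eq {a γ : ℝ} (ha : a ≠ 0) (hγ : 0 < γ) (μ : Measure ℝ)
    [IsProbabilityMeasure μ]
    (hm : ∀ z : ℂ, 0 < z.im → mpPoly a (a / γ) z (stieltjesTransform μ z) = 0)
    {f : ℝ → ℝ} (hf : Continuous f) (hs : HasCompactSupport f) :
    ∫ x, |x + a| * f x ∂μ = ∫ x, |x + a| * shiftedDensity a γ x * f x := by
  have hc : a / γ ≠ 0 := div_ne_zero ha hγ.ne'
  have hg : Continuous fun x => |x + a| * f x := by fun_prop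
  have h1 := tendsto_integral_im_stieltjesTransform μ hg (hs.mul_left (f := fun x => |x + a|))
  obtain ⟨R, hR⟩ := hs.isCompact.isBounded.subset_closedBall (0 : ℝ)
  have hR' : ∀ x, f x ≠ 0 → |x| ≤ R := fun x hx => by
    simpa using hR (subset_tsupport f hx)
  have h2 : Tendsto (fun y : ℝ => ∫ x : ℝ, |x + a| * f x *
      (stieltjesTransform μ (x + y * Complex.I)).im) (𝓝[>] 0)
      (𝓝 (∫ x, |x + a| * f x * (Real.pi * shiftedDensity a γ x))) := by
    refine tendsto_integral_filter_of_dominated_convergence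
      (fun x => |f x| * (1 + (2 * (R + 1) + |a / γ| + |a|) / |a / γ|)) ?_ ?_ ?_ ?_
    · filter_upwards [self_mem_nhdsWithin] with y hy
      refine (Continuous.mul hg ?_).aestronglyMeasurable
      refine Complex.continuous_im.comp ?_
      refine (continuousOn_stieltjesTransform μ).comp_continuous (by fun_prop) fun x => ?_
      simpa using hy
    · filter_upwards [self_mem_nhdsWithin, nhdsWithin_le_nhds (Iio_mem_nhds one_pos)] with y hy hy1
      refine ae_of_all _ fun x => ?_
      have hy : 0 < y := hy
      have hy1 : y < 1 := hy1
      by_cases hfx : f x = 0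
      · simp [hfx]
      have hz := norm_mul_root_le hc (hm (x + y * Complex.I) (by simpa using hy))
      have hn : ‖(x : ℂ) + y * Complex.I‖ ≤ R + 1 := by
        refine (norm_add_le _ _).trans ?_
        have := hR' x hfx
        simp only [Complex.norm_real, Real.norm_eq_abs, norm_mul, Complex.norm_I, mul_one,
          abs_of_pos hy]
        linarith
      rw [norm_mul, norm_mul, mul_assoc, mul_left_comm, Real.norm_eq_abs (f x)]
      refine mul_le_mul_of_nonneg_left ?_ (abs_nonneg _)
      calc ‖|x + a|‖ * ‖(stieltjesTransform μ (x + y * Complex.I)).im‖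
          ≤ ‖(x : ℂ) + y * Complex.I + a‖ * ‖stieltjesTransform μ (x + y * Complex.I)‖ := by
            gcongr
            · have := Complex.abs_re_le_norm ((x : ℂ) + y * Complex.I + a)
              simpa using this
            · exact Complex.abs_im_le_norm _
        _ ≤ 1 + (2 * ‖(x : ℂ) + y * Complex.I‖ + |a / γ| + |a|) / |a / γ| := by
            rw [← norm_mul]; exact hz
        _ ≤ _ := by gcongr
    · exact ((hf.integrable_of_hasCompactSupport hs).abs).mul_const _
    · have : ∀ᵐ x : ℝ, x ≠ -a := by simp [ae_iff]
      filter_upwards [this] with x hx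
      exact (tendsto_im_root ha hγ (fun z hz => im_stieltjesTransform_pos μ hz) hm hx).const_mul _
  have h3 := tendsto_nhds_unique h1 h2
  refine mul_left_cancel₀ Real.pi_ne_zero (h3.trans ?_)
  rw [← integral_const_mul]
  congr 1
  ext x
  ring

theorem abs_mul_shiftedDensity_le {a γ : ℝ} (ha : a ≠ 0) (hγ : 0 < γ) (x : ℝ) :
    |x + a| * shiftedDensity a γ x ≤ √(4 * |a / γ| * (|x| + |a|)) / |2 * (a / γ)| := by
  have hc : a / γ ≠ 0 := div_ne_zero ha hγ.ne'
  rcases eq_or_ne (x + a) 0 with h0 | h0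
  · rw [h0]; simp; positivity
  have hd := shiftedDensity_nonneg ha hγ x
  calc |x + a| * shiftedDensity a γ x
      ≤ |x + a| * (Real.pi * shiftedDensity a γ x) := by
        gcongr
        nlinarith [Real.pi_gt_three]
    _ = √(max (4 * (a / γ) * (x + a) - (x + a / γ) ^ 2) 0) / |2 * (a / γ)| := by
        rw [pi_mul_shiftedDensity ha hγ, abs_mul (2 * (a / γ))]
        have : |x + a| ≠ 0 := abs_ne_zero.2 h0
        have : |2 * (a / γ)| ≠ 0 := abs_ne_zero.2 (by positivity)
        field_simp
    _ ≤ _ := by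
        gcongr
        refine max_le ?_ (by positivity)
        have h1 : (a / γ) * (x + a) ≤ |a / γ| * (|x| + |a|) := by
          refine (le_abs_self _).trans ?_
          rw [abs_mul]
          gcongr
          exact abs_add_le _ _
        nlinarith [sq_nonneg (x + a / γ)]

theorem withDensity_abs_eq {a γ : ℝ} (ha : a ≠ 0) (hγ : 0 < γ) (μ : Measure ℝ)
    [IsProbabilityMeasure μ]
    (hm : ∀ z : ℂ, 0 < z.im → mpPoly a (a / γ) z (stieltjesTransform μ z) = 0) :
    μ.withDensity (fun x => ENNReal.ofReal |x + a|) =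
      (volume.withDensity fun x => ENNReal.ofReal (shiftedDensity a γ x)).withDensity
        (fun x => ENNReal.ofReal |x + a|) := by
  have hd := measurable_shiftedDensity a γ
  have hw : Measurable fun x : ℝ => |x + a| := by fun_prop
  have hwd : Measurable fun x : ℝ => |x + a| * shiftedDensity a γ x := hw.mul hd
  rw [← withDensity_mul _ (hd.ennreal_ofReal) (hw.ennreal_ofReal)]
  have e : ((fun x => ENNReal.ofReal (shiftedDensity a γ x)) * fun x => ENNReal.ofReal |x + a|) =
      fun x => ENNReal.ofReal (|x + a| * shiftedDensity a γ x) := by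
    ext x
    rw [Pi.mul_apply, ENNReal.ofReal_mul (abs_nonneg _), mul_comm]
  rw [e]
  have l1 : IsLocallyFiniteMeasure (μ.withDensity fun x => ENNReal.ofReal |x + a|) :=
    IsLocallyFiniteMeasure.withDensity_ofReal (by fun_prop)
  have l2 : IsLocallyFiniteMeasure
      (volume.withDensity fun x : ℝ => ENNReal.ofReal (|x + a| * shiftedDensity a γ x)) := by
    have : IsLocallyFiniteMeasure (volume.withDensity fun x : ℝ =>
        ENNReal.ofReal (√(4 * |a / γ| * (|x| + |a|)) / |2 * (a / γ)|)) :=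
      IsLocallyFiniteMeasure.withDensity_ofReal (by fun_prop)
    exact Measure.isLocallyFiniteMeasure_of_le (withDensity_mono (ae_of_all volume fun x =>
      ENNReal.ofReal_le_ofReal (abs_mul_shiftedDensity_le ha hγ x)))
  refine Measure.ext_of_integral_eq_on_compactlySupported fun f => ?_
  rw [integral_withDensity_eq_integral_toReal_smul hw.ennreal_ofReal
      (ae_of_all _ fun x => ENNReal.ofReal_lt_top),
    integral_withDensity_eq_integral_toReal_smul hwd.ennreal_ofReal
      (ae_of_all _ fun x => ENNReal.ofReal_lt_top)]
  have e1 : ∀ x : ℝ, (ENNReal.ofReal |x + a|).toReal = |x + a| := fun x =>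
    ENNReal.toReal_ofReal (abs_nonneg _)
  have e2 : ∀ x : ℝ, (ENNReal.ofReal (|x + a| * shiftedDensity a γ x)).toReal =
      |x + a| * shiftedDensity a γ x := fun x =>
    ENNReal.toReal_ofReal (mul_nonneg (abs_nonneg _) (shiftedDensity_nonneg ha hγ x))
  simp only [e1, e2, smul_eq_mul]
  exact integral_mul_abs_eq ha hγ μ hm f.continuous f.hasCompactSupport

/-- Away from `-a` the measure has the Marchenko–Pastur density. -/
theorem restrict_compl_singleton_eq {a γ : ℝ} (ha : a ≠ 0) (hγ : 0 < γ) (μ : Measure ℝ)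
    [IsProbabilityMeasure μ]
    (hm : ∀ z : ℂ, 0 < z.im → mpPoly a (a / γ) z (stieltjesTransform μ z) = 0) :
    μ.restrict {-a}ᶜ = volume.withDensity fun x => ENNReal.ofReal (shiftedDensity a γ x) := by
  have hw : Measurable fun x : ℝ => ENNReal.ofReal |x + a| := by fun_prop
  have hS : MeasurableSet ({-a}ᶜ : Set ℝ) := (measurableSet_singleton _).compl
  set ρ := volume.withDensity fun x => ENNReal.ofReal (shiftedDensity a γ x) with hρ
  have hr : ρ.restrict {-a}ᶜ = ρ := by
    refine Measure.restrict_eq_self_of_ae_mem ?_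
    have : ∀ᵐ x : ℝ, x ∈ ({-a}ᶜ : Set ℝ) := by simp [ae_iff]
    exact (withDensity_absolutelyContinuous _ _).ae_le this
  have h1 := congrArg (fun ν => Measure.restrict ν {-a}ᶜ) (withDensity_abs_eq ha hγ μ hm)
  simp only [restrict_withDensity hS] at h1
  rw [← restrict_withDensity hS (fun x => ENNReal.ofReal (shiftedDensity a γ x)), ← hρ, hr] at h1
  have hne : ∀ x ∈ ({-a}ᶜ : Set ℝ), ENNReal.ofReal |x + a| ≠ 0 := by
    intro x hx h
    rw [ENNReal.ofReal_eq_zero] at h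
    have : x + a = 0 := abs_nonpos_iff.1 h
    exact hx (by simp; linarith)
  have i1 := withDensity_inv_same (μ := μ.restrict {-a}ᶜ) hw
    ((ae_restrict_iff' hS).2 (ae_of_all _ hne)) (ae_of_all _ fun _ => ENNReal.ofReal_ne_top)
  have i2 := withDensity_inv_same (μ := ρ.restrict {-a}ᶜ) hw
    ((ae_restrict_iff' hS).2 (ae_of_all _ hne)) (ae_of_all _ fun _ => ENNReal.ofReal_ne_top)
  rw [hr] at i2
  rw [← i1, h1, i2]

/-- The mass of an atom is the residue of the Stieltjes transform, up to sign. -/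
theorem tendsto_mul_stieltjesTransform_singleton (μ : Measure ℝ) [IsProbabilityMeasure μ] (b : ℝ) :
    Tendsto (fun y : ℝ => (y * Complex.I) * stieltjesTransform μ (b + y * Complex.I)) (𝓝[>] 0)
      (𝓝 (-(μ.real {b} : ℂ))) := by
  have h1 : Tendsto
      (fun y : ℝ => ∫ t : ℝ, (y * Complex.I) * (1 / ((t : ℂ) - (b + y * Complex.I))) ∂μ)
      (𝓝[>] 0) (𝓝 (∫ t : ℝ, ({b} : Set ℝ).indicator (fun _ => (-1 : ℂ)) t ∂μ)) := by
    refine tendsto_integral_filter_of_dominated_convergence (fun _ => 1) ?_ ?_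
      (integrable_const _) ?_
    · filter_upwards [self_mem_nhdsWithin] with y hy
      exact (continuous_const.mul (continuous_one_div_ofReal_sub
        (by simpa using hy))).aestronglyMeasurable
    · filter_upwards [self_mem_nhdsWithin] with y hy
      refine ae_of_all _ fun t => ?_
      have hy : 0 < y := hy
      have := norm_one_div_ofReal_sub_le t (z := b + y * Complex.I) (by simpa using hy)
      have e : ((b : ℂ) + y * Complex.I).im = y := by simp
      rw [e] at this
      rw [norm_mul]
      calc _ ≤ y * (1 / y) := by
            gcongr
            simp [abs_of_pos hy]
        _ = 1 := by field_simp
    · refine ae_of_all _ fun t => ?_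
      by_cases ht : t = b
      · subst ht
        simp only [Set.mem_singleton_iff, Set.indicator_of_mem]
        refine tendsto_const_nhds.congr' ?_
        filter_upwards [self_mem_nhdsWithin] with y hy
        have hy : (y : ℂ) ≠ 0 := by
          have : (0 : ℝ) < y := hy
          exact_mod_cast this.ne'
        have := Complex.I_ne_zero
        field_simp
        ring
      · rw [Set.indicator_of_notMem (by simpa using ht)]
        have hz := tendsto_ofReal_add_mul_I b
        have hne : (t : ℂ) - b ≠ 0 := sub_ne_zero.2 (by exact_mod_cast ht)
        have h2 : Tendsto (fun y : ℝ => 1 / ((t : ℂ) - (b + y * Complex.I))) (𝓝[>] 0)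
            (𝓝 (1 / ((t : ℂ) - b))) :=
          (tendsto_const_nhds (x := (1 : ℂ))).div (tendsto_const_nhds.sub hz) hne
        have h3 : Tendsto (fun y : ℝ => (y : ℂ) * Complex.I) (𝓝[>] 0) (𝓝 0) := by
          simpa using tendsto_ofReal_add_mul_I 0
        simpa using h3.mul h2
  have e : ∫ t : ℝ, ({b} : Set ℝ).indicator (fun _ => (-1 : ℂ)) t ∂μ = -(μ.real {b} : ℂ) := by
    rw [integral_indicator_const _ (measurableSet_singleton b)]
    simp
  rw [e] at h1
  refine h1.congr fun y => ?_
  rw [integral_const_mul, stieltjesTransform_eq]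

/-- The quadratic equation leaves `0` and `1 - γ` as possible masses of the atom, and the
contraction inequality rules out `0` when `γ < 1`. -/
theorem measureReal_singleton_eq {a γ : ℝ} (ha : a ≠ 0) (hγ : 0 < γ) (μ : Measure ℝ)
    [IsProbabilityMeasure μ]
    (hm : ∀ z : ℂ, 0 < z.im → mpPoly a (a / γ) z (stieltjesTransform μ z) = 0) :
    μ.real {-a} = max (1 - γ) 0 := by
  set c := a / γ with hcdef
  have hc : c ≠ 0 := div_ne_zero ha hγ.ne'
  have hac : a = c * γ := by rw [hcdef]; field_simp
  have hu := tendsto_mul_stieltjesTransform_singleton μ (-a)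
  set κ := μ.real {-a} with hκ
  have hκ0 : 0 ≤ κ := measureReal_nonneg
  have hz := tendsto_ofReal_add_mul_I (-a)
  push_cast at hz hu
  have hyI : Tendsto (fun y : ℝ => (y : ℂ) * Complex.I) (𝓝[>] 0) (𝓝 0) := by
    simpa using tendsto_ofReal_add_mul_I 0
  -- the equation for `u = (z + a) m` at `z = -a + i y`
  have heq : ∀ᶠ y : ℝ in 𝓝[>] 0,
      c * ((y * Complex.I) * stieltjesTransform μ (-a + y * Complex.I)) ^ 2
      + (-a + y * Complex.I + c) * ((y * Complex.I) * stieltjesTransform μ (-a + y * Complex.I))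
      + y * Complex.I = 0 := by
    filter_upwards [self_mem_nhdsWithin] with y hy
    have := hm (-a + y * Complex.I) (by simpa using hy)
    rw [mpPoly] at this
    linear_combination (y * Complex.I) * this
  have hlim := (((hu.pow 2).const_mul (c : ℂ)).add ((hz.add_const (c : ℂ)).mul hu)).add hyI
  have h0 := tendsto_nhds_unique (hlim.congr' heq) tendsto_const_nhds
  have h1 : c * (κ * (κ - (1 - γ))) = 0 := by
    have h0' : c * (-κ) ^ 2 + (-a + c) * (-κ) + 0 = 0 := by exact_mod_cast h0
    rw [hac] at h0'
    linear_combination h0'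
  have h2 : κ = 0 ∨ κ = 1 - γ := by
    rcases mul_eq_zero.1 ((mul_eq_zero.1 h1).resolve_left hc) with h | h
    · exact Or.inl h
    · exact Or.inr (by linarith)
  rcases le_or_gt 1 γ with h | h
  · rw [max_eq_right (by linarith)]
    rcases h2 with h2 | h2 <;> linarith
  · rw [max_eq_left (by linarith)]
    refine h2.resolve_left fun hκz => ?_
    rw [hκz] at hu
    simp only [Complex.ofReal_zero, neg_zero] at hu
    have hca : (c : ℂ) - a ≠ 0 := by
      rw [← Complex.ofReal_sub, Complex.ofReal_ne_zero, hac]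
      have : c - c * γ = c * (1 - γ) := by ring
      rw [this]
      exact mul_ne_zero hc (by linarith)
    have hden : Tendsto (fun y : ℝ =>
        c * ((y * Complex.I) * stieltjesTransform μ (-a + y * Complex.I))
          + (-a + y * Complex.I + c)) (𝓝[>] 0) (𝓝 ((c : ℂ) - a)) := by
      have := (hu.const_mul (c : ℂ)).add (hz.add_const (c : ℂ))
      convert this using 2
      ring
    have hS : Tendsto (fun y : ℝ => stieltjesTransform μ (-a + y * Complex.I)) (𝓝[>] 0)
        (𝓝 (-1 / ((c : ℂ) - a))) := by
      refine ((tendsto_const_nhds (x := (-1 : ℂ))).div hden hca).congr' ?_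
      filter_upwards [heq, hden.eventually_ne hca, self_mem_nhdsWithin] with y hy hy1 hy2
      have hy0 : (y : ℂ) * Complex.I ≠ 0 := by
        have : (0 : ℝ) < y := hy2
        exact mul_ne_zero (by exact_mod_cast this.ne') Complex.I_ne_zero
      rw [Pi.div_apply, div_eq_iff hy1]
      apply mul_left_cancel₀ hy0
      linear_combination -hy
    have hineq := le_of_tendsto_of_tendsto
      (((Complex.continuous_normSq.tendsto _).comp hS).const_mul (a ^ 2 / γ))
      ((Complex.continuous_normSq.tendsto _).comp ((hS.const_mul (c : ℂ)).const_add 1))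
      (by
        filter_upwards [self_mem_nhdsWithin] with y hy
        have hz0 : 0 < (-(a : ℂ) + y * Complex.I).im := by simpa using hy
        exact (mpPoly_norm_lt hz0 (im_stieltjesTransform_pos μ hz0) (hm _ hz0)).le)
    have e1 : (1 : ℂ) + c * (-1 / ((c : ℂ) - a)) = ((-a / (c - a) : ℝ) : ℂ) := by
      push_cast; field_simp; ring
    have e2 : (-1 : ℂ) / ((c : ℂ) - a) = ((-1 / (c - a) : ℝ) : ℂ) := by push_cast; rfl
    rw [e1, e2, Complex.normSq_ofReal, Complex.normSq_ofReal] at hineq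
    have hca' : c - a ≠ 0 := by exact_mod_cast hca
    have hp : 0 < a ^ 2 / (c - a) ^ 2 := by positivity
    have h5 : a ^ 2 / (c - a) ^ 2 * (1 / γ) ≤ a ^ 2 / (c - a) ^ 2 * 1 := by
      have e3 : a ^ 2 / γ * (-1 / (c - a) * (-1 / (c - a))) = a ^ 2 / (c - a) ^ 2 * (1 / γ) := by
        field_simp
      have e4 : -a / (c - a) * (-a / (c - a)) = a ^ 2 / (c - a) ^ 2 * 1 := by
        field_simp
      rwa [e3, e4] at hineq
    have h6 := le_of_mul_le_mul_left h5 hp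
    rw [div_le_one hγ] at h6
    linarith

/-- The law with atom `(1 - γ)⁺` at `-a` and the shifted Marchenko–Pastur density is the only
possible solution of the equation. -/
theorem eq_of_mpEquation_of_ne_zero {a γ : ℝ} (ha : a ≠ 0) (hγ : 0 < γ) (μ : Measure ℝ)
    [IsProbabilityMeasure μ]
    (h : ∀ z : ℂ, 0 < z.im → MPEquation a γ z (stieltjesTransform μ z)) :
    μ = ENNReal.ofReal (max (1 - γ) 0) • Measure.dirac (-a)
      + volume.withDensity fun t => ENNReal.ofReal (shiftedDensity a γ t) := by
  have hm : ∀ z : ℂ, 0 < z.im → mpPoly a (a / γ) z (stieltjesTransform μ z) = 0 := fun z hz =>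
    (stieltjesTransform_mpEquation_iff μ hz).1 (h z hz)
  rw [← restrict_compl_singleton_eq ha hγ μ hm, ← measureReal_singleton_eq ha hγ μ hm,
    ofReal_measureReal, ← Measure.restrict_singleton]
  exact (Measure.restrict_add_restrict_compl (measurableSet_singleton _)).symm

theorem map_mpLaw {a γ : ℝ} (ha : a ≠ 0) :
    (mpLaw (1 / γ)).map (fun x => a * x - a) =
      ENNReal.ofReal (max (1 - γ) 0) • Measure.dirac (-a)
        + volume.withDensity fun t => ENNReal.ofReal (shiftedDensity a γ t) := by
  have hmeas : Measurable fun x : ℝ => a * x - a := by fun_prop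
  have hvol : ENNReal.ofReal |a| • Measure.map (fun x : ℝ => a * x - a) volume = volume := by
    have : (fun x : ℝ => a * x - a) = (fun x => x - a) ∘ fun x => a * x := rfl
    rw [this, ← Measure.map_map (by fun_prop) (by fun_prop), Real.map_volume_mul_left ha,
      Measure.map_smul, smul_smul, ← ENNReal.ofReal_mul (abs_nonneg _), ← abs_mul,
      mul_inv_cancel₀ ha]
    simp [map_sub_right_eq_self]
  rw [mpLaw, Measure.map_add _ _ hmeas, Measure.map_smul, Measure.map_dirac' hmeas]
  have e1 : 1 - 1 / (1 / γ) = 1 - γ := by simp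
  have e2 : a * 0 - a = -a := by ring
  rw [e1, e2]
  congr 1
  ext s hs
  rw [Measure.map_apply hmeas hs, withDensity_apply _ (hmeas hs), withDensity_apply _ hs]
  conv_rhs => rw [← hvol]
  have hg : Measurable fun t => ENNReal.ofReal (shiftedDensity a γ t) :=
    (measurable_shiftedDensity a γ).ennreal_ofReal
  rw [Measure.restrict_smul, lintegral_smul_measure, setLIntegral_map hs hg hmeas,
    smul_eq_mul, ← lintegral_const_mul]
  swap
  · exact hg.comp hmeas
  congr 1
  ext x
  have ha' : |a| ≠ 0 := abs_ne_zero.2 ha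
  rw [← ENNReal.ofReal_mul (abs_nonneg a), shiftedDensity]
  congr 1
  have : (a * x - a + a) / a = x := by field_simp; ring
  rw [this]
  field_simp

/-! ### Resolvents of real symmetric matrices -/

section Resolvent

open scoped Matrix.Norms.L2Operator

variable {ι : Type*} [Fintype ι] [DecidableEq ι]

/-- The resolvent `(A - z)⁻¹` of a real matrix, as a complex matrix. -/
def matResolvent (A : Matrix ι ι ℝ) (z : ℂ) : Matrix ι ι ℂ :=
  (A.map Complex.ofReal - z • (1 : Matrix ι ι ℂ))⁻¹

theorem exists_unitary_diagonalization {A : Matrix ι ι ℝ} (hA : A.IsHermitian) :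
    ∃ U ∈ unitary (Matrix ι ι ℂ), A.map Complex.ofReal =
      U * Matrix.diagonal (fun i => (hA.eigenvalues i : ℂ)) * star U := by
  have hf : ∀ M N : Matrix ι ι ℝ, (M * N).map Complex.ofReal =
      M.map Complex.ofReal * N.map Complex.ofReal := fun M N =>
    Matrix.map_mul (f := Complex.ofRealHom)
  have hstar : ∀ M : Matrix ι ι ℝ, (star M).map Complex.ofReal = star (M.map Complex.ofReal) := by
    intro M; ext i j; simp [Matrix.star_eq_conjTranspose]
  have h1 : (1 : Matrix ι ι ℝ).map Complex.ofReal = 1 := by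
    ext i j; simp [Matrix.one_apply]
    split_ifs <;> simp
  refine ⟨(hA.eigenvectorUnitary : Matrix ι ι ℝ).map Complex.ofReal, ?_, ?_⟩
  · have hU := hA.eigenvectorUnitary.2
    rw [Unitary.mem_iff] at hU ⊢
    rw [← hstar, ← hf, ← hf, hU.1, hU.2, h1]
    exact ⟨rfl, rfl⟩
  · conv_lhs => rw [hA.spectral_theorem]
    rw [Unitary.conjStarAlgAut_apply, hf, hf, hstar]
    congr 2
    ext i j
    simp [Matrix.diagonal_apply]
    split_ifs <;> simp

theorem exists_matResolvent_diagonalization {A : Matrix ι ι ℝ} (hA : A.IsHermitian) {z : ℂ}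
    (hz : 0 < z.im) :
    ∃ U ∈ unitary (Matrix ι ι ℂ),
      matResolvent A z =
        U * Matrix.diagonal (fun i => 1 / ((hA.eigenvalues i : ℂ) - z)) * star U ∧
      (A.map Complex.ofReal - z • (1 : Matrix ι ι ℂ)) * matResolvent A z = 1 := by
  obtain ⟨U, hU, hAU⟩ := exists_unitary_diagonalization hA
  have hU1 : star U * U = 1 := (Unitary.mem_iff.1 hU).1
  have hU2 : U * star U = 1 := (Unitary.mem_iff.1 hU).2
  have e : A.map Complex.ofReal - z • (1 : Matrix ι ι ℂ) =
      U * Matrix.diagonal (fun i => (hA.eigenvalues i : ℂ) - z) * star U := by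
    have : Matrix.diagonal (fun i => (hA.eigenvalues i : ℂ) - z) =
        Matrix.diagonal (fun i => (hA.eigenvalues i : ℂ)) - z • (1 : Matrix ι ι ℂ) := by
      ext i j
      simp [Matrix.diagonal_apply, Matrix.one_apply]
      split_ifs <;> simp
    rw [this, mul_sub, sub_mul, ← hAU]
    congr 1
    rw [Matrix.mul_smul, Matrix.smul_mul, mul_one, hU2]
  have h1 : (A.map Complex.ofReal - z • (1 : Matrix ι ι ℂ)) *
      (U * Matrix.diagonal (fun i => 1 / ((hA.eigenvalues i : ℂ) - z)) * star U) = 1 := by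
    rw [e]
    have hd : Matrix.diagonal (fun i => (hA.eigenvalues i : ℂ) - z) *
        Matrix.diagonal (fun i => 1 / ((hA.eigenvalues i : ℂ) - z)) = 1 := by
      rw [Matrix.diagonal_mul_diagonal, ← Matrix.diagonal_one]
      congr 1
      ext i
      exact mul_one_div_cancel (ofReal_sub_ne_zero _ hz)
    calc _ = U * (Matrix.diagonal (fun i => (hA.eigenvalues i : ℂ) - z) * (star U * U) *
        Matrix.diagonal (fun i => 1 / ((hA.eigenvalues i : ℂ) - z))) * star U := by
          simp only [mul_assoc]
      _ = 1 := by rw [hU1, mul_one, hd, mul_one, hU2]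
  have h2 : matResolvent A z =
      U * Matrix.diagonal (fun i => 1 / ((hA.eigenvalues i : ℂ) - z)) * star U :=
    Matrix.inv_eq_right_inv h1
  exact ⟨U, hU, h2, by rw [h2, h1]⟩

theorem mul_matResolvent {A : Matrix ι ι ℝ} (hA : A.IsHermitian) {z : ℂ} (hz : 0 < z.im) :
    (A.map Complex.ofReal - z • (1 : Matrix ι ι ℂ)) * matResolvent A z = 1 := by
  obtain ⟨U, -, -, h⟩ := exists_matResolvent_diagonalization hA hz
  exact h

theorem matResolvent_mul {A : Matrix ι ι ℝ} (hA : A.IsHermitian) {z : ℂ} (hz : 0 < z.im) :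
    matResolvent A z * (A.map Complex.ofReal - z • (1 : Matrix ι ι ℂ)) = 1 :=
  mul_eq_one_comm.1 (mul_matResolvent hA hz)

theorem det_sub_smul_one_ne_zero {A : Matrix ι ι ℝ} (hA : A.IsHermitian) {z : ℂ}
    (hz : 0 < z.im) : (A.map Complex.ofReal - z • (1 : Matrix ι ι ℂ)).det ≠ 0 :=
  (Matrix.isUnit_det_of_right_inverse (mul_matResolvent hA hz)).ne_zero

theorem trace_matResolvent {A : Matrix ι ι ℝ} (hA : A.IsHermitian) {z : ℂ} (hz : 0 < z.im) :
    (matResolvent A z).trace = ∑ i, 1 / ((hA.eigenvalues i : ℂ) - z) := by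
  obtain ⟨U, hU, h, -⟩ := exists_matResolvent_diagonalization hA hz
  rw [h, Matrix.trace_mul_comm, ← mul_assoc, (Unitary.mem_iff.1 hU).1, one_mul,
    Matrix.trace_diagonal]

theorem norm_matResolvent_le {A : Matrix ι ι ℝ} (hA : A.IsHermitian) {z : ℂ} (hz : 0 < z.im) :
    ‖matResolvent A z‖ ≤ 1 / z.im := by
  obtain ⟨U, hU, h, -⟩ := exists_matResolvent_diagonalization hA hz
  rw [h, CStarRing.norm_mul_mem_unitary _ (Unitary.star_mem hU),
    CStarRing.norm_mem_unitary_mul _ hU,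
    Matrix.l2_opNorm_diagonal]
  exact (pi_norm_le_iff_of_nonneg (by positivity)).2 fun i => norm_one_div_ofReal_sub_le _ hz

theorem norm_entry_le_l2_opNorm (M : Matrix ι ι ℂ) (i j : ι) : ‖M i j‖ ≤ ‖M‖ := by
  have h1 := M.l2_opNorm_mulVec (EuclideanSpace.single j (1 : ℂ))
  have h2 := PiLp.norm_apply_le (WithLp.toLp 2 (M.mulVec (EuclideanSpace.single j (1 : ℂ)).ofLp)) i
  simp at h1 h2
  exact h2.trans h1

/-- The trace is taken on the range, where it is a sum of `rank T` diagonal entries in an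
orthonormal basis. -/
theorem norm_trace_le_rank_mul (T : Matrix ι ι ℂ) : ‖T.trace‖ ≤ T.rank * ‖T‖ := by
  set L : EuclideanSpace ℂ ι →ₗ[ℂ] EuclideanSpace ℂ ι := Matrix.toEuclideanLin T with hL
  have htr : T.trace = LinearMap.trace ℂ (EuclideanSpace ℂ ι) L :=
    (Matrix.trace_toLin_eq T (EuclideanSpace.basisFun ι ℂ).toBasis).symm
  have hrank : T.rank = Module.finrank ℂ (LinearMap.range L) :=
    T.rank_eq_finrank_range_toLin (EuclideanSpace.basisFun ι ℂ).toBasis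
      (EuclideanSpace.basisFun ι ℂ).toBasis
  have hL2 : ∀ v, ‖L v‖ ≤ ‖T‖ * ‖v‖ := fun v => T.l2_opNorm_mulVec v
  set V := LinearMap.range L
  have h1 : LinearMap.trace ℂ (EuclideanSpace ℂ ι) L =
      LinearMap.trace ℂ V (L.rangeRestrict ∘ₗ V.subtype) := by
    rw [LinearMap.trace_comp_comm']
    rfl
  rw [htr, h1, LinearMap.trace_eq_sum_inner _ (stdOrthonormalBasis ℂ V), hrank]
  refine (norm_sum_le _ _).trans ?_
  have : ∀ i ∈ Finset.univ, ‖inner ℂ (stdOrthonormalBasis ℂ V i)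
      ((L.rangeRestrict ∘ₗ V.subtype) (stdOrthonormalBasis ℂ V i))‖ ≤ ‖T‖ := by
    intro i _
    refine (norm_inner_le_norm (𝕜 := ℂ) (E := V) _ _).trans ?_
    rw [(stdOrthonormalBasis ℂ V).orthonormal.1 i, one_mul]
    have := hL2 (stdOrthonormalBasis ℂ V i : EuclideanSpace ℂ ι)
    have hn : ‖((stdOrthonormalBasis ℂ V i : V) : EuclideanSpace ℂ ι)‖ = 1 :=
      (stdOrthonormalBasis ℂ V).orthonormal.1 i
    rw [hn, mul_one] at this
    exact this
  refine (Finset.sum_le_card_nsmul _ _ _ this).trans ?_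
  simp

theorem matResolvent_sub {A B : Matrix ι ι ℝ} (hA : A.IsHermitian) (hB : B.IsHermitian) {z : ℂ}
    (hz : 0 < z.im) :
    matResolvent A z - matResolvent B z =
      matResolvent A z * (B - A).map Complex.ofReal * matResolvent B z := by
  have e : (B - A).map Complex.ofReal = (B.map Complex.ofReal - z • (1 : Matrix ι ι ℂ))
      - (A.map Complex.ofReal - z • (1 : Matrix ι ι ℂ)) := by
    ext i j; simp
  rw [e, mul_sub, sub_mul, matResolvent_mul hA hz, mul_assoc, mul_matResolvent hB hz]
  simp

theorem rank_le_two_of_eq_zero {M : Matrix ι ι ℂ} (i : ι)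
    (h : ∀ j l, j ≠ i → l ≠ i → M j l = 0) : M.rank ≤ 2 := by
  have e : M = (Matrix.of fun j => ![Pi.single i 1 j, if j = i then 0 else M j i]) *
      (Matrix.of ![M i, Pi.single i 1] : Matrix (Fin 2) ι ℂ) := by
    ext j l
    rw [Matrix.mul_apply, Fin.sum_univ_two]
    by_cases hj : j = i
    · subst hj; simp
    · by_cases hl : l = i
      · subst hl; simp [hj]
      · simp [hj, hl, h j l hj hl]
  rw [e]
  exact (Matrix.rank_mul_le_left _ _).trans ((Matrix.rank_le_card_width _).trans (by simp))

/-- Changing one row and the corresponding column of a symmetric matrix is a perturbation of rank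
two, and moves the trace of the resolvent by a bounded amount. -/
theorem norm_trace_matResolvent_sub_le {A B : Matrix ι ι ℝ} (hA : A.IsHermitian)
    (hB : B.IsHermitian) {z : ℂ} (hz : 0 < z.im) (i : ι)
    (h : ∀ j l, j ≠ i → l ≠ i → A j l = B j l) :
    ‖(matResolvent A z).trace - (matResolvent B z).trace‖ ≤ 4 / z.im := by
  rw [← Matrix.trace_sub]
  refine (norm_trace_le_rank_mul _).trans ?_
  have hr : (matResolvent A z - matResolvent B z).rank ≤ 2 := by
    rw [matResolvent_sub hA hB hz]
    refine (Matrix.rank_mul_le_left _ _).trans ((Matrix.rank_mul_le_right _ _).trans ?_)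
    refine rank_le_two_of_eq_zero i fun j l hj hl => ?_
    simp [h j l hj hl]
  have hn : ‖matResolvent A z - matResolvent B z‖ ≤ 1 / z.im + 1 / z.im :=
    (norm_sub_le _ _).trans (add_le_add (norm_matResolvent_le hA hz) (norm_matResolvent_le hB hz))
  calc ((matResolvent A z - matResolvent B z).rank : ℝ) * ‖matResolvent A z - matResolvent B z‖
      ≤ 2 * (1 / z.im + 1 / z.im) := by
        gcongr
        exact_mod_cast hr
    _ = 4 / z.im := by ring

theorem norm_matResolvent_apply_le {A : Matrix ι ι ℝ} (hA : A.IsHermitian) {z : ℂ}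
    (hz : 0 < z.im) (i j : ι) : ‖matResolvent A z i j‖ ≤ 1 / z.im :=
  (norm_entry_le_l2_opNorm _ i j).trans (norm_matResolvent_le hA hz)

theorem norm_matResolvent_mul_apply_le {A B : Matrix ι ι ℝ} (hA : A.IsHermitian)
    (hB : B.IsHermitian) {z : ℂ} (hz : 0 < z.im) (i j : ι) :
    ‖(matResolvent A z * matResolvent B z) i j‖ ≤ 1 / z.im * (1 / z.im) := by
  refine (norm_entry_le_l2_opNorm _ i j).trans ((norm_mul_le _ _).trans ?_)
  exact mul_le_mul (norm_matResolvent_le hA hz) (norm_matResolvent_le hB hz) (norm_nonneg _)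
    (by positivity)

end Resolvent

theorem stieltjesTransform_esd {n : ℕ} [NeZero n] {A : Matrix (Fin n) (Fin n) ℝ}
    (hA : A.IsHermitian) {z : ℂ} (hz : 0 < z.im) :
    stieltjesTransform (esd A hA) z = (matResolvent A z).trace / n := by
  rw [stieltjesTransform_eq, trace_matResolvent hA hz]
  change ∫ t : ℝ, 1 / ((t : ℂ) - z) ∂((n : ENNReal)⁻¹ • ∑ i, Measure.dirac (hA.eigenvalues i)) = _
  rw [integral_smul_measure, integral_finsetSum_measure]
  · simp [div_eq_inv_mul]
  · exact fun i _ => integrable_one_div_ofReal_sub _ hz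

/-! ### Concentration of functions with bounded differences -/

theorem integral_exp_le_of_oscillation_le {E : Type*} [MeasurableSpace E] (μ : Measure E)
    [IsProbabilityMeasure μ] {f : E → ℝ} (hf : Measurable f) {c : ℝ}
    (hc : ∀ x y, |f x - f y| ≤ c) (t : ℝ) :
    ∫ x, Real.exp (t * (f x - ∫ y, f y ∂μ)) ∂μ ≤ Real.exp (c ^ 2 * t ^ 2 / 2) := by
  obtain ⟨x₀⟩ := nonempty_of_isProbabilityMeasure μ
  have hc0 : 0 ≤ c := (abs_nonneg _).trans (hc x₀ x₀)
  have h := (hasSubgaussianMGF_of_mem_Icc (μ := μ) (a := f x₀ - c) (b := f x₀ + c)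
    hf.aemeasurable (ae_of_all _ fun x => by
      have := abs_le.1 (hc x x₀)
      constructor <;> linarith)).mgf_le t
  rw [mgf] at h
  refine h.trans (le_of_eq ?_)
  congr 2
  have : f x₀ + c - (f x₀ - c) = 2 * c := by ring
  rw [this]
  simp [abs_of_nonneg hc0]

theorem integrable_of_oscillation_le {E : Type*} [MeasurableSpace E] (μ : Measure E)
    [IsProbabilityMeasure μ] {f : E → ℝ} (hf : Measurable f) {c : ℝ}
    (hc : ∀ x y, |f x - f y| ≤ c) : Integrable f μ := by
  obtain ⟨x₀⟩ := nonempty_of_isProbabilityMeasure μ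
  refine Integrable.of_bound hf.aestronglyMeasurable (|f x₀| + c) (ae_of_all _ fun x => ?_)
  have := hc x x₀
  rw [Real.norm_eq_abs]
  have h2 := abs_sub_abs_le_abs_sub (f x) (f x₀)
  linarith

theorem integrable_exp_of_oscillation_le {E : Type*} [MeasurableSpace E] (μ : Measure E)
    [IsProbabilityMeasure μ] {f : E → ℝ} (hf : Measurable f) {c : ℝ}
    (hc : ∀ x y, |f x - f y| ≤ c) (t b : ℝ) :
    Integrable (fun x => Real.exp (t * (f x - b))) μ := by
  obtain ⟨x₀⟩ := nonempty_of_isProbabilityMeasure μ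
  refine Integrable.of_bound (by fun_prop) (Real.exp (|t| * (c + |f x₀ - b|)))
    (ae_of_all _ fun x => ?_)
  rw [Real.norm_of_nonneg (Real.exp_pos _).le]
  apply Real.exp_le_exp.2
  refine (le_abs_self _).trans ?_
  rw [abs_mul]
  gcongr
  calc |f x - b| = |(f x - f x₀) + (f x₀ - b)| := by ring_nf
    _ ≤ _ := (abs_add_le _ _).trans (by linarith [hc x x₀])

/-- A function on a finite product that changes by at most `c` when one coordinate is changed. -/
def HasBoundedDifferences {n : ℕ} {E : Type*} (f : (Fin n → E) → ℝ) (c : ℝ) : Prop :=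
  ∀ (i : Fin n) (x y : Fin n → E), (∀ j, j ≠ i → x j = y j) → |f x - f y| ≤ c

theorem HasBoundedDifferences.oscillation_le {n : ℕ} {E : Type*} {f : (Fin n → E) → ℝ} {c : ℝ}
    (h : HasBoundedDifferences f c) (x y : Fin n → E) : |f x - f y| ≤ n * c := by
  induction n with
  | zero => simp [Subsingleton.elim x y]
  | succ n ih =>
    have h1 : |f x - f (Fin.cons (y 0) (Fin.tail x))| ≤ c := by
      refine h 0 _ _ fun j hj => ?_
      obtain ⟨k, rfl⟩ := Fin.exists_succ_eq.2 hj
      simp [Fin.tail]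
    have h2 : |f (Fin.cons (y 0) (Fin.tail x)) - f (Fin.cons (y 0) (Fin.tail y))| ≤ n * c := by
      refine ih (f := fun x' => f (Fin.cons (y 0) x')) (fun i u v huv => ?_) _ _
      refine h i.succ _ _ fun j hj => ?_
      refine Fin.cases ?_ (fun k hk => ?_) j hj
      · simp
      · simpa using huv k (fun hki => hk (by rw [hki]))
    rw [Fin.cons_self_tail] at h2
    have h3 := abs_sub_le (f x) (f (Fin.cons (y 0) (Fin.tail x))) (f y)
    push_cast
    linarith

/-- The exponential moment bound behind McDiarmid's inequality: integrating out one coordinate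
preserves bounded differences, and costs one application of Hoeffding's lemma. -/
theorem HasBoundedDifferences.integral_exp_le {n : ℕ} {E : Type*} [MeasurableSpace E]
    (μ : Fin n → Measure E) [∀ i, IsProbabilityMeasure (μ i)] {f : (Fin n → E) → ℝ}
    (hf : Measurable f) {c : ℝ} (h : HasBoundedDifferences f c) (t : ℝ) :
    ∫ x, Real.exp (t * (f x - ∫ y, f y ∂Measure.pi μ)) ∂Measure.pi μ ≤
      Real.exp (n * (c ^ 2 * t ^ 2 / 2)) := by
  induction n with
  | zero =>
    have : ∀ x, f x = f default := fun x => by rw [Subsingleton.elim x default]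
    simp [this]
  | succ n ih =>
    set ν : Measure (Fin n → E) := Measure.pi fun j => μ j.succ with hν
    have hmp : MeasurePreserving (MeasurableEquiv.piFinSuccAbove (fun _ => E) 0).symm
        ((μ 0).prod ν) (Measure.pi μ) := (measurePreserving_piFinSuccAbove μ 0).symm
    have hcons : ∀ (a : E) (x : Fin n → E),
        (MeasurableEquiv.piFinSuccAbove (fun _ => E) 0).symm (a, x) =
          (Fin.cons a x : Fin (n+1) → E) :=
      fun a x => by simp [MeasurableEquiv.piFinSuccAbove, Fin.consEquiv]
    have hmc : Measurable fun q : E × (Fin n → E) => (Fin.cons q.1 q.2 : Fin (n+1) → E) := by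
      have := (MeasurableEquiv.piFinSuccAbove (fun _ : Fin (n+1) => E) 0).symm.measurable
      convert this using 1
      ext q : 1
      exact (hcons q.1 q.2).symm
    have hfm : Measurable fun q : E × (Fin n → E) => f (Fin.cons q.1 q.2) := hf.comp hmc
    have hosc : ∀ (p q : E × (Fin n → E)),
        |f (Fin.cons p.1 p.2) - f (Fin.cons q.1 q.2)| ≤ (n + 1 : ℕ) * c :=
      fun p q => h.oscillation_le _ _
    have hsplit : ∀ F : (Fin (n+1) → E) → ℝ,
        Integrable (fun q : E × (Fin n → E) => F (Fin.cons q.1 q.2)) ((μ 0).prod ν) →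
        ∫ x, F x ∂Measure.pi μ = ∫ x, ∫ a, F (Fin.cons a x) ∂(μ 0) ∂ν := by
      intro F hF
      have e : ∀ q : E × (Fin n → E), F ((MeasurableEquiv.piFinSuccAbove (fun _ => E) 0).symm q) =
          F (Fin.cons q.1 q.2) := fun q => by rw [← hcons]
      rw [← hmp.integral_comp']
      simp only [e]
      exact integral_prod_symm _ hF
    set g : (Fin n → E) → ℝ := fun x => ∫ a, f (Fin.cons a x) ∂(μ 0) with hg
    have hosc1 : ∀ (x : Fin n → E) (a b : E), |f (Fin.cons a x) - f (Fin.cons b x)| ≤ c := by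
      intro x a b
      refine h 0 _ _ fun j hj => ?_
      obtain ⟨k, rfl⟩ := Fin.exists_succ_eq.2 hj
      simp
    have hm1 : ∀ x : Fin n → E, Measurable fun a => f (Fin.cons a x) := fun x =>
      hfm.comp (measurable_id.prodMk measurable_const)
    have hgm : Measurable g :=
      (hfm.stronglyMeasurable.integral_prod_left' (μ := μ 0)).measurable
    have hgb : HasBoundedDifferences g c := by
      intro i x y hxy
      rw [hg]
      simp only
      rw [← integral_sub (integrable_of_oscillation_le _ (hm1 x) (hosc1 x))
        (integrable_of_oscillation_le _ (hm1 y) (hosc1 y)), ← Real.norm_eq_abs]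
      refine (norm_integral_le_of_norm_le_const (C := c) (ae_of_all _ fun a => ?_)).trans (by simp)
      refine h i.succ _ _ fun j hj => ?_
      refine Fin.cases ?_ (fun k hk => ?_) j hj
      · simp
      · simpa using hxy k (fun hki => hk (by rw [hki]))
    have hint : ∫ x, f x ∂Measure.pi μ = ∫ x, g x ∂ν :=
      hsplit f (integrable_of_oscillation_le _ hfm hosc)
    set b := ∫ x, g x ∂ν with hb
    rw [hint, hsplit (fun x => Real.exp (t * (f x - b)))
      (integrable_exp_of_oscillation_le _ hfm hosc t b)]
    have hin : ∀ x : Fin n → E, ∫ a, Real.exp (t * (f (Fin.cons a x) - b)) ∂(μ 0) ≤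
        Real.exp (c ^ 2 * t ^ 2 / 2) * Real.exp (t * (g x - b)) := by
      intro x
      have e : ∀ a, Real.exp (t * (f (Fin.cons a x) - b)) =
          Real.exp (t * (f (Fin.cons a x) - g x)) * Real.exp (t * (g x - b)) := fun a => by
        rw [← Real.exp_add]; ring_nf
      simp only [e]
      rw [integral_mul_const]
      gcongr
      exact integral_exp_le_of_oscillation_le (μ 0) (hm1 x) (hosc1 x) t
    have hi := (integrable_exp_of_oscillation_le ν hgm hgb.oscillation_le t b).const_mul
      (Real.exp (c ^ 2 * t ^ 2 / 2))
    have hi' : Integrable (fun x => ∫ a, Real.exp (t * (f (Fin.cons a x) - b)) ∂(μ 0)) ν :=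
      (integrable_exp_of_oscillation_le ((μ 0).prod ν) hfm hosc t b).integral_prod_right
    refine (integral_mono hi' hi hin).trans ?_
    rw [integral_const_mul]
    refine (mul_le_mul_of_nonneg_left (ih (fun j => μ j.succ) hgm hgb) (Real.exp_pos _).le).trans ?_
    rw [← Real.exp_add]
    apply le_of_eq
    push_cast
    ring_nf

/-- McDiarmid's inequality, without the optimal constant. -/
theorem HasBoundedDifferences.measureReal_le {n : ℕ} {E : Type*} [MeasurableSpace E]
    (μ : Fin n → Measure E) [∀ i, IsProbabilityMeasure (μ i)] {f : (Fin n → E) → ℝ}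
    (hf : Measurable f) {c : ℝ} (h : HasBoundedDifferences f c) {ε : ℝ} (hε : 0 ≤ ε) :
    (Measure.pi μ).real {x | ε ≤ |f x - ∫ y, f y ∂Measure.pi μ|} ≤
      2 * Real.exp (-ε ^ 2 / (2 * (n * c ^ 2))) := by
  have hsub : HasSubgaussianMGF (fun x => f x - ∫ y, f y ∂Measure.pi μ)
      ⟨n * c ^ 2, by positivity⟩ (Measure.pi μ) := by
    refine ⟨fun t => integrable_exp_of_oscillation_le _ hf h.oscillation_le t _, fun t => ?_⟩
    refine (h.integral_exp_le μ hf t).trans (le_of_eq ?_)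
    congr 1
    change _ = n * c ^ 2 * t ^ 2 / 2
    ring
  have h1 : _ ≤ Real.exp (-ε ^ 2 / (2 * (n * c ^ 2))) := hsub.measure_ge_le hε
  have h2 : _ ≤ Real.exp (-ε ^ 2 / (2 * (n * c ^ 2))) := hsub.neg.measure_ge_le hε
  have h3 : {x | ε ≤ |f x - ∫ y, f y ∂Measure.pi μ|} ⊆
      {x | ε ≤ f x - ∫ y, f y ∂Measure.pi μ} ∪
        {x | ε ≤ (-fun x => f x - ∫ y, f y ∂Measure.pi μ) x} := by
    intro x hx
    rcases le_abs'.1 (show ε ≤ |f x - ∫ y, f y ∂Measure.pi μ| from hx) with h | h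
    · right
      simp only [Set.mem_ofPred_eq, Pi.neg_apply]
      linarith
    · left; exact h
  refine (measureReal_mono h3).trans ((measureReal_union_le _ _).trans ?_)
  linarith

/-! ### Gaussian integration by parts -/

theorem integrable_pow_gaussianReal_zero (v : NNReal) (j : ℕ) :
    Integrable (fun t : ℝ => t ^ j) (gaussianReal 0 v) := by
  have := (memLp_id_gaussianReal (μ := 0) (v := v) (j : NNReal)).integrable_norm_pow'
  have h2 : Integrable (fun t : ℝ => ‖t‖ ^ j) (gaussianReal 0 v) := by simpa using this
  exact h2.mono' (by fun_prop) (ae_of_all _ fun t => by simp)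

theorem integrable_one_add_sq_pow_gaussianReal (v : NNReal) (k : ℕ) :
    Integrable (fun t : ℝ => (1 + t ^ 2) ^ k) (gaussianReal 0 v) := by
  have e : (fun t : ℝ => (1 + t ^ 2) ^ k) =
      fun t => ∑ j ∈ Finset.range (k + 1), t ^ (2 * (k - j)) * (k.choose j : ℝ) := by
    ext t
    rw [add_pow]
    refine Finset.sum_congr rfl fun j _ => ?_
    rw [one_pow, one_mul, pow_mul]
  rw [e]
  exact integrable_finsetSum _ fun j _ => (integrable_pow_gaussianReal_zero v _).mul_const _

/-- Gaussian integration by parts in one variable, for functions of polynomial growth. -/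
theorem integral_mul_gaussianReal {v : NNReal} (hv : v ≠ 0) {f f' : ℝ → ℂ} {C : ℝ} {k : ℕ}
    (hf : ∀ t, HasDerivAt f (f' t) t) (hfC : ∀ t, ‖f t‖ ≤ C * (1 + t ^ 2) ^ k)
    (hfC' : ∀ t, ‖f' t‖ ≤ C * (1 + t ^ 2) ^ k) :
    ∫ t, (t : ℂ) * f t ∂gaussianReal 0 v = v * ∫ t, f' t ∂gaussianReal 0 v := by
  have hv' : (v : ℝ) ≠ 0 := by exact_mod_cast hv
  have hcont : Continuous f := continuous_iff_continuousAt.2 fun t => (hf t).continuousAt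
  have hm' : Measurable f' := by
    have : f' = deriv f := by ext t; exact (hf t).deriv.symm
    rw [this]; exact measurable_deriv f
  have hg : ∀ {F : ℝ → ℂ}, AEStronglyMeasurable F volume → ∀ {D : ℝ} {j : ℕ},
      (∀ t, ‖F t‖ ≤ D * (1 + t ^ 2) ^ j) →
      Integrable (fun t => F t * (gaussianPDFReal 0 v t : ℂ)) := by
    intro F hF D j hD
    have h1 : Integrable (fun t : ℝ => gaussianPDFReal 0 v t • (D * (1 + t ^ 2) ^ j)) := by
      have := (integrable_one_add_sq_pow_gaussianReal v j).const_mul D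
      rw [gaussianReal_of_var_ne_zero _ hv] at this
      rw [integrable_withDensity_iff_integrable_smul' (measurable_gaussianPDF 0 v)
        (ae_of_all _ fun _ => gaussianPDF_lt_top)] at this
      simpa [gaussianPDF, ENNReal.toReal_ofReal, gaussianPDFReal_nonneg] using this
    refine h1.mono' ?_ (ae_of_all _ fun t => ?_)
    · exact hF.mul (Complex.measurable_ofReal.comp
        (measurable_gaussianPDFReal 0 v)).aestronglyMeasurable
    · rw [norm_mul, Complex.norm_real, Real.norm_of_nonneg (gaussianPDFReal_nonneg 0 v t),
        mul_comm, smul_eq_mul]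
      exact mul_le_mul_of_nonneg_left (hD t) (gaussianPDFReal_nonneg 0 v t)
  have hpdf : ∀ t : ℝ, HasDerivAt (fun t => (gaussianPDFReal 0 v t : ℂ))
      ((-(t / v) * gaussianPDFReal 0 v t : ℝ) : ℂ) t := by
    intro t
    refine HasDerivAt.ofReal_comp ?_
    have h1 : HasDerivAt (fun s : ℝ => -(s - 0) ^ 2 / (2 * v)) (-(t / v)) t := by
      have := (((hasDerivAt_id t).sub_const 0).pow 2).neg.div_const (2 * (v : ℝ))
      refine this.congr_deriv ?_
      simp
      field_simp
    have h2 := h1.exp.const_mul ((√(2 * Real.pi * v))⁻¹)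
    refine h2.congr_deriv ?_
    rw [gaussianPDFReal]
    ring
  have hid : ∀ t : ℝ, ‖(t : ℂ) * f t‖ ≤ C * (1 + t ^ 2) ^ (k + 1) := by
    intro t
    rw [norm_mul, Complex.norm_real, Real.norm_eq_abs, pow_succ, ← mul_assoc, mul_comm]
    have h1 : |t| ≤ 1 + t ^ 2 := by nlinarith [sq_abs t, sq_nonneg (|t| - 1), abs_nonneg t]
    exact mul_le_mul (hfC t) h1 (abs_nonneg _) ((norm_nonneg _).trans (hfC t))
  have i1 := hg (hcont.aestronglyMeasurable) hfC
  have i2 := hg hm'.aestronglyMeasurable hfC'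
  have i3 := hg ((Complex.continuous_ofReal.mul hcont).aestronglyMeasurable) hid
  have hibp := integral_mul_deriv_eq_deriv_mul_of_integrable (u := f)
    (u' := f') (v := fun t => (gaussianPDFReal 0 v t : ℂ))
    (v' := fun t : ℝ => ((-(t / v) * gaussianPDFReal 0 v t : ℝ) : ℂ)) (fun t _ => hf t)
    (fun t _ => hpdf t)
    (by
      refine (i3.const_mul (-(1 / v : ℂ))).congr (ae_of_all _ fun t => ?_)
      simp only [Pi.mul_apply]
      push_cast
      ring) i2 i1
  rw [integral_gaussianReal_eq_integral_smul hv, integral_gaussianReal_eq_integral_smul hv]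
  simp only [Complex.real_smul]
  have e1 : ∫ t : ℝ, (gaussianPDFReal 0 v t : ℂ) * ((t : ℂ) * f t) =
      -v * ∫ t : ℝ, f t * ((-(t / v) * gaussianPDFReal 0 v t : ℝ) : ℂ) := by
    rw [← integral_const_mul]
    congr 1
    ext t
    push_cast
    have : (v : ℂ) ≠ 0 := by exact_mod_cast hv
    field_simp
  rw [e1, hibp]
  simp only [mul_comm (f' _)]
  ring

section Pi

variable {ι : Type*} [Fintype ι]

/-- Resampling one coordinate independently preserves a product measure. -/
theorem measurePreserving_update [DecidableEq ι] (μ : ι → Measure ℝ)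
    [∀ i, IsProbabilityMeasure (μ i)] (i : ι) :
    MeasurePreserving (fun q : ℝ × (ι → ℝ) => Function.update q.2 i q.1)
      ((μ i).prod (Measure.pi μ)) (Measure.pi μ) := by
  have hm : Measurable fun q : ℝ × (ι → ℝ) => Function.update q.2 i q.1 := by
    refine measurable_pi_iff.2 fun j => ?_
    by_cases h : j = i
    · subst h; simpa using measurable_fst
    · simp only [Function.update_of_ne h]
      exact (measurable_pi_apply j).comp measurable_snd
  refine ⟨hm, (Measure.pi_eq fun s hs => ?_).symm⟩
  rw [Measure.map_apply hm (MeasurableSet.univ_pi hs)]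
  have e : (fun q : ℝ × (ι → ℝ) => Function.update q.2 i q.1) ⁻¹' (Set.univ.pi s) =
      s i ×ˢ Set.univ.pi (Function.update s i Set.univ) := by
    ext ⟨t, x⟩
    simp only [Set.mem_preimage, Set.mem_pi, Set.mem_univ, true_imp_iff, Set.mem_prod]
    constructor
    · intro h
      refine ⟨by simpa using h i, fun j => ?_⟩
      by_cases hj : j = i
      · subst hj; simp
      · simpa [hj] using h j
    · rintro ⟨h1, h2⟩ j
      by_cases hj : j = i
      · subst hj; simpa using h1
      · simpa [hj] using h2 j
  rw [e, Measure.prod_prod, Measure.pi_pi, ← Finset.mul_prod_erase _ _ (Finset.mem_univ i),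
    ← Finset.mul_prod_erase _ (fun j => μ j (s j)) (Finset.mem_univ i)]
  simp only [Function.update_self, measure_univ, one_mul]
  congr 1
  refine Finset.prod_congr rfl fun j hj => ?_
  rw [Function.update_of_ne (Finset.ne_of_mem_erase hj)]

/-- A weight on `ι → ℝ` whose powers dominate all polynomials; being a product, it is easy to
integrate against product measures. -/
def growthWeight (x : ι → ℝ) : ℝ := ∏ i, (1 + x i ^ 2)

theorem one_le_prod_one_add_sq {ι : Type*} (s : Finset ι) (x : ι → ℝ) :
    1 ≤ ∏ i ∈ s, (1 + x i ^ 2) := by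
  have := Finset.prod_le_prod (s := s) (f := fun _ => (1 : ℝ)) (g := fun i => 1 + x i ^ 2)
    (fun _ _ => zero_le_one) (fun i _ => by nlinarith [sq_nonneg (x i)])
  simpa using this

theorem one_le_growthWeight (x : ι → ℝ) : 1 ≤ growthWeight x :=
  one_le_prod_one_add_sq _ x

theorem growthWeight_nonneg (x : ι → ℝ) : 0 ≤ growthWeight x :=
  zero_le_one.trans (one_le_growthWeight x)

theorem abs_le_growthWeight (x : ι → ℝ) (i : ι) : |x i| ≤ growthWeight x := by
  classical
  rw [growthWeight, ← Finset.mul_prod_erase _ _ (Finset.mem_univ i)]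
  have h1 := one_le_prod_one_add_sq (Finset.univ.erase i) x
  have h2 : |x i| ≤ 1 + x i ^ 2 := by
    nlinarith [sq_abs (x i), sq_nonneg (|x i| - 1), abs_nonneg (x i)]
  have h3 : 0 ≤ 1 + x i ^ 2 := by positivity
  nlinarith

theorem growthWeight_update [DecidableEq ι] (x : ι → ℝ) (i : ι) (t : ℝ) :
    growthWeight (Function.update x i t) =
      (∏ j ∈ Finset.univ.erase i, (1 + x j ^ 2)) * (1 + t ^ 2) := by
  rw [growthWeight, ← Finset.mul_prod_erase _ _ (Finset.mem_univ i), Function.update_self, mul_comm]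
  congr 1
  refine Finset.prod_congr rfl fun j hj => ?_
  rw [Function.update_of_ne (Finset.ne_of_mem_erase hj)]

theorem integrable_growthWeight_pow (v : NNReal) (k : ℕ) :
    Integrable (fun x : ι → ℝ => growthWeight x ^ k)
      (Measure.pi fun _ => gaussianReal 0 v) := by
  have := Integrable.fintype_prod (f := fun (_ : ι) (t : ℝ) => (1 + t ^ 2) ^ k)
    (μ := fun _ => gaussianReal 0 v) fun _ => integrable_one_add_sq_pow_gaussianReal v k
  simpa only [growthWeight, Finset.prod_pow] using this

theorem integrable_of_norm_le_growthWeight (v : NNReal) {F : (ι → ℝ) → ℂ} (hF : Continuous F)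
    {C : ℝ} {k : ℕ} (h : ∀ x, ‖F x‖ ≤ C * growthWeight x ^ k) :
    Integrable F (Measure.pi fun _ => gaussianReal 0 v) :=
  ((integrable_growthWeight_pow v k).const_mul C).mono' hF.aestronglyMeasurable (ae_of_all _ h)

/-- Gaussian integration by parts in one of several independent variables. -/
theorem integral_mul_pi_gaussianReal [DecidableEq ι] {v : NNReal} (hv : v ≠ 0) (i : ι)
    {F F' : (ι → ℝ) → ℂ}
    (hF : Continuous F) (hF' : Continuous F')
    (hderiv : ∀ x, HasDerivAt (fun t => F (Function.update x i t)) (F' x) (x i))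
    {C : ℝ} {k : ℕ} (hC : ∀ x, ‖F x‖ ≤ C * growthWeight x ^ k)
    (hC' : ∀ x, ‖F' x‖ ≤ C * growthWeight x ^ k) :
    ∫ x, (x i : ℂ) * F x ∂(Measure.pi fun _ => gaussianReal 0 v) =
      v * ∫ x, F' x ∂(Measure.pi fun _ => gaussianReal 0 v) := by
  set π : Measure (ι → ℝ) := Measure.pi fun _ => gaussianReal 0 v with hπ
  have hmp := measurePreserving_update (fun _ : ι => gaussianReal 0 v) i
  have hsplit : ∀ {H : (ι → ℝ) → ℂ}, Continuous H → Integrable H π →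
      ∫ x, H x ∂π = ∫ x, ∫ t, H (Function.update x i t) ∂gaussianReal 0 v ∂π := by
    intro H hH hHi
    have h1 : ∫ x, H x ∂π = ∫ q, H (Function.update q.2 i q.1) ∂((gaussianReal 0 v).prod π) := by
      conv_lhs => rw [hπ, ← hmp.map_eq]
      rw [integral_map hmp.measurable.aemeasurable hH.aestronglyMeasurable]
    rw [h1]
    exact integral_prod_symm _ (hmp.integrable_comp_of_integrable hHi)
  have hxF : ∀ x, ‖(x i : ℂ) * F x‖ ≤ C * growthWeight x ^ (k + 1) := by
    intro x
    rw [norm_mul, Complex.norm_real, Real.norm_eq_abs, pow_succ, ← mul_assoc, mul_comm]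
    exact mul_le_mul (hC x) (abs_le_growthWeight x i) (abs_nonneg _)
      ((norm_nonneg _).trans (hC x))
  have hcx : Continuous fun x : ι → ℝ => (x i : ℂ) * F x :=
    (Complex.continuous_ofReal.comp (continuous_apply i)).mul hF
  rw [hsplit hcx (integrable_of_norm_le_growthWeight v hcx hxF),
    hsplit hF' (integrable_of_norm_le_growthWeight v hF' hC'), ← integral_const_mul]
  congr 1
  ext x
  simp only [Function.update_self]
  have hb : ∀ {H : (ι → ℝ) → ℂ}, (∀ x, ‖H x‖ ≤ C * growthWeight x ^ k) → ∀ t : ℝ,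
      ‖H (Function.update x i t)‖ ≤
        C * (∏ j ∈ Finset.univ.erase i, (1 + x j ^ 2)) ^ k * (1 + t ^ 2) ^ k := by
    intro H hH t
    have := hH (Function.update x i t)
    rwa [growthWeight_update, mul_pow, ← mul_assoc] at this
  refine integral_mul_gaussianReal hv (fun t => ?_) (hb hC) (hb hC')
  have := hderiv (Function.update x i t)
  simpa using this

end Pi

/-! ### The approximate equation for the mean Stieltjes transform -/

section Wishart

variable {ι κ : Type*} [Fintype ι] [DecidableEq ι] [Fintype κ]

theorem continuous_matResolvent {T : Type*} [TopologicalSpace T] {A : T → Matrix ι ι ℝ}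
    (hA : Continuous A) (hH : ∀ t, (A t).IsHermitian) {z : ℂ} (hz : 0 < z.im) :
    Continuous fun t => matResolvent (A t) z := by
  have hB : Continuous fun t => (A t).map Complex.ofReal - z • (1 : Matrix ι ι ℂ) :=
    (hA.matrix_map Complex.continuous_ofReal).sub continuous_const
  simp only [matResolvent, Matrix.inv_def, Ring.inverse_eq_inv']
  exact (hB.matrix_det.inv₀ fun t => det_sub_smul_one_ne_zero (hH t) hz).smul hB.matrix_adjugate

theorem transpose_matResolvent {A : Matrix ι ι ℝ} (hA : A.IsHermitian) (z : ℂ) :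
    (matResolvent A z).transpose = matResolvent A z := by
  have h : A.transpose = A := by simpa [Matrix.IsHermitian] using hA
  rw [matResolvent, Matrix.transpose_nonsing_inv, Matrix.transpose_sub, Matrix.transpose_smul,
    Matrix.transpose_one, ← Matrix.transpose_map, h]

theorem hasDerivAt_of_sub_eq_mul {f φ : ℝ → ℂ} {s : ℝ} (h : ∀ t, f t - f s = (t - s : ℝ) * φ t)
    (hφ : ContinuousAt φ s) : HasDerivAt f (φ s) s := by
  rw [hasDerivAt_iff_tendsto_slope]
  refine (hφ.tendsto.mono_left nhdsWithin_le_nhds).congr' ?_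
  filter_upwards [self_mem_nhdsWithin] with t ht
  have : ((t - s : ℝ) : ℂ) ≠ 0 := by exact_mod_cast sub_ne_zero.2 ht
  rw [slope_def_module, h, Complex.real_smul, Complex.ofReal_inv, inv_mul_cancel_left₀ this]

/-- The derivative `-G A' G` of the resolvent, along a path that is quadratic in its parameter as
the Wishart matrix is in each variable. -/
theorem hasDerivAt_matResolvent_apply {A : ℝ → Matrix ι ι ℝ} (hH : ∀ t, (A t).IsHermitian)
    {s : ℝ} {A₁ A₂ : Matrix ι ι ℝ} (hA : ∀ t, A t = A s + (t - s) • A₁ + (t - s) ^ 2 • A₂)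
    {z : ℂ} (hz : 0 < z.im) (i j : ι) :
    HasDerivAt (fun t => matResolvent (A t) z i j)
      (-(matResolvent (A s) z * A₁.map Complex.ofReal * matResolvent (A s) z) i j) s := by
  have hcont : Continuous A := by
    have : A = fun t => A s + (t - s) • A₁ + (t - s) ^ 2 • A₂ := funext hA
    rw [this]; fun_prop
  set φ : ℝ → ℂ := fun t => -(matResolvent (A t) z * (A₁ + (t - s) • A₂).map Complex.ofReal *
    matResolvent (A s) z) i j with hφ
  have hcφ : Continuous φ := by
    have h1 : Continuous fun t => (A₁ + (t - s) • A₂).map Complex.ofReal :=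
      Continuous.matrix_map (by fun_prop) Complex.continuous_ofReal
    have h2 := ((continuous_matResolvent hcont hH hz).matrix_mul h1).matrix_mul
      (continuous_const (y := matResolvent (A s) z))
    exact (h2.matrix_elem i j).neg
  have e : -(matResolvent (A s) z * A₁.map Complex.ofReal * matResolvent (A s) z) i j = φ s := by
    simp [hφ]
  rw [e]
  refine hasDerivAt_of_sub_eq_mul (fun t => ?_) hcφ.continuousAt
  have h1 := congrFun (congrFun (matResolvent_sub (hH t) (hH s) hz) i) j
  rw [Matrix.sub_apply] at h1
  rw [h1]
  have h2 : (A s - A t).map Complex.ofReal =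
      (-((t - s : ℝ) : ℂ)) • (A₁ + (t - s) • A₂).map Complex.ofReal := by
    rw [hA t]
    ext k l
    simp
    ring
  rw [h2, Matrix.mul_smul, Matrix.smul_mul, Matrix.smul_apply, hφ, smul_eq_mul, neg_mul, mul_neg]

/-- The centred sample covariance matrix `a X Xᵀ - a`, which differs from the kernel matrix only on
the diagonal. -/
def wishartMatrix {ι : Type*} [DecidableEq ι] (a : ℝ) (M : Matrix ι κ ℝ) : Matrix ι ι ℝ :=
  a • (M * M.transpose) - a • (1 : Matrix ι ι ℝ)

theorem wishartMatrix_isHermitian {ι : Type*} [DecidableEq ι] (a : ℝ) (M : Matrix ι κ ℝ) :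
    (wishartMatrix a M).IsHermitian := by
  rw [Matrix.IsHermitian, Matrix.conjTranspose_eq_transpose_of_trivial, wishartMatrix,
    Matrix.transpose_sub, Matrix.transpose_smul, Matrix.transpose_smul, Matrix.transpose_mul,
    Matrix.transpose_transpose, Matrix.transpose_one]

theorem matResolvent_wishartMatrix_mul (a : ℝ) (M : Matrix ι κ ℝ) {z : ℂ} (hz : 0 < z.im) :
    matResolvent (wishartMatrix a M) z *
        ((a : ℂ) • (M.map Complex.ofReal * (M.map Complex.ofReal).transpose)) =
      1 + ((a : ℂ) + z) • matResolvent (wishartMatrix a M) z := by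
  have e : (a : ℂ) • (M.map Complex.ofReal * (M.map Complex.ofReal).transpose) =
      ((wishartMatrix a M).map Complex.ofReal - z • (1 : Matrix ι ι ℂ)) +
        ((a : ℂ) + z) • (1 : Matrix ι ι ℂ) := by
    ext i j
    simp [wishartMatrix, Matrix.mul_apply, Matrix.one_apply]
    split_ifs <;> simp
  rw [e, mul_add, matResolvent_mul (wishartMatrix_isHermitian a M) hz, Matrix.mul_smul, mul_one]

theorem mul_single_mul_apply {l m : Type*} [DecidableEq κ] (P : Matrix l ι ℂ) (Q : Matrix κ m ℂ)
    (i : ι) (α : κ) (b : l) (j : m) :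
    (P * Matrix.single i α (1 : ℂ) * Q) b j = P b i * Q α j := by
  rw [Matrix.mul_apply, Finset.sum_eq_single α]
  · rw [Matrix.mul_single_apply_same, mul_one]
  · intro β _ hβ
    rw [Matrix.mul_single_apply_of_ne (hbj := hβ), zero_mul]
  · simp

/-- The matrix with entries `x (i, j)`. -/
def matOf {ι κ : Type*} (x : ι × κ → ℝ) : Matrix ι κ ℝ := Matrix.of fun i α => x (i, α)

theorem matOf_update {ι κ : Type*} [DecidableEq ι] [DecidableEq κ]
    (x : ι × κ → ℝ) (i : ι) (α : κ) (t : ℝ) :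
    matOf (Function.update x (i, α) t) = matOf x + (t - x (i, α)) • Matrix.single i α 1 := by
  ext j β
  by_cases h : (j, β) = (i, α)
  · obtain ⟨rfl, rfl⟩ := Prod.mk.inj h
    simp [matOf]
  · rw [matOf, Matrix.of_apply, Function.update_of_ne h]
    have h' : ¬(i = j ∧ α = β) := fun hh => h (by rw [hh.1, hh.2])
    simp [matOf, h']

theorem wishartMatrix_matOf_update {ι : Type*} [DecidableEq ι] [DecidableEq κ] (a : ℝ)
    (x : ι × κ → ℝ) (i : ι) (α : κ) (t : ℝ) :
    wishartMatrix a (matOf (Function.update x (i, α) t)) = wishartMatrix a (matOf x) +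
      (t - x (i, α)) • (a • (Matrix.single i α (1 : ℝ) * (matOf x).transpose +
        matOf x * (Matrix.single i α (1 : ℝ)).transpose)) +
      (t - x (i, α)) ^ 2 •
        (a • (Matrix.single i α (1 : ℝ) * (Matrix.single i α (1 : ℝ)).transpose)) := by
  rw [matOf_update]
  set E : Matrix ι κ ℝ := Matrix.single i α 1
  set r := t - x (i, α)
  simp only [wishartMatrix, Matrix.transpose_add, Matrix.transpose_smul, Matrix.mul_add,
    Matrix.add_mul, Matrix.mul_smul, Matrix.smul_mul, smul_add, smul_smul]
  have e1 : r * a = a * r := mul_comm _ _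
  have e2 : r ^ 2 * a = a * (r * r) := by ring
  rw [e1, e2]
  abel

/-- The entry `(Xᵀ G)_{αi}` paired with `X_{iα}` in the integration by parts. -/
def resolventEntry (a : ℝ) (z : ℂ) (i : ι) (α : κ) (x : ι × κ → ℝ) : ℂ :=
  (((matOf x).map Complex.ofReal).transpose * matResolvent (wishartMatrix a (matOf x)) z) α i

/-- The derivative of `resolventEntry` with respect to the variable `X_{iα}`. -/
def resolventEntryDeriv (a : ℝ) (z : ℂ) (i : ι) (α : κ) (x : ι × κ → ℝ) : ℂ :=
  matResolvent (wishartMatrix a (matOf x)) z i i - a * (resolventEntry a z i α x ^ 2 +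
    (((matOf x).map Complex.ofReal).transpose * matResolvent (wishartMatrix a (matOf x)) z *
      (matOf x).map Complex.ofReal) α α * matResolvent (wishartMatrix a (matOf x)) z i i)

theorem hasDerivAt_resolventEntry [DecidableEq κ] (a : ℝ) {z : ℂ} (hz : 0 < z.im) (i : ι) (α : κ)
    (x : ι × κ → ℝ) :
    HasDerivAt (fun t => resolventEntry a z i α (Function.update x (i, α) t))
      (resolventEntryDeriv a z i α x) (x (i, α)) := by
  set A₁ := a • (Matrix.single i α (1 : ℝ) * (matOf x).transpose +
        matOf x * (Matrix.single i α (1 : ℝ)).transpose) with hA₁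
  have hG : ∀ j, HasDerivAt (fun t => matResolvent (wishartMatrix a
      (matOf (Function.update x (i, α) t))) z j i)
      (-(matResolvent (wishartMatrix a (matOf x)) z * A₁.map Complex.ofReal *
        matResolvent (wishartMatrix a (matOf x)) z) j i) (x (i, α)) := by
    intro j
    have := hasDerivAt_matResolvent_apply
      (A := fun t => wishartMatrix a (matOf (Function.update x (i, α) t))) (s := x (i, α))
      (fun t => wishartMatrix_isHermitian a _) (A₁ := A₁)
      (fun t => by rw [Function.update_eq_self]; exact wishartMatrix_matOf_update a x i α t)
      hz j i
    simpa only [Function.update_eq_self] using this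
  have hX : ∀ j, HasDerivAt (fun t => ((Function.update x (i, α) t (j, α) : ℝ) : ℂ))
      (if j = i then 1 else 0) (x (i, α)) := by
    intro j
    by_cases h : j = i
    · subst h
      simpa using (hasDerivAt_id (x (j, α))).ofReal_comp
    · have : (j, α) ≠ (i, α) := fun hh => h (Prod.mk.inj hh).1
      simpa [Function.update_of_ne this, h] using hasDerivAt_const (x (i, α)) ((x (j, α) : ℝ) : ℂ)
  have hsum := HasDerivAt.fun_sum (u := Finset.univ) fun j _ => (hX j).mul (hG j)
  have hfun : (fun t => resolventEntry a z i α (Function.update x (i, α) t)) = fun t =>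
      ∑ j, ((Function.update x (i, α) t (j, α) : ℝ) : ℂ) *
        matResolvent (wishartMatrix a (matOf (Function.update x (i, α) t))) z j i := by
    ext t
    simp [resolventEntry, Matrix.mul_apply, matOf]
  rw [hfun]
  refine hsum.congr_deriv ?_
  simp only [Function.update_eq_self]
  set G := matResolvent (wishartMatrix a (matOf x)) z with hGdef
  set Y := (matOf x).map Complex.ofReal with hY
  have hA₁c : A₁.map Complex.ofReal = (a : ℂ) • (Matrix.single i α (1 : ℂ) * Y.transpose +
      Y * Matrix.single α i (1 : ℂ)) := by
    rw [hA₁, Matrix.transpose_single]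
    ext k l
    simp only [Matrix.map_apply, Matrix.smul_apply, Matrix.add_apply, Matrix.mul_apply,
      Matrix.transpose_apply, Matrix.single_apply, hY, smul_eq_mul, ite_mul, mul_ite, one_mul,
      mul_one, zero_mul, mul_zero]
    push_cast
    simp only [apply_ite Complex.ofReal, Complex.ofReal_zero]
  rw [Finset.sum_add_distrib]
  have s1 : ∑ j, (if j = i then (1 : ℂ) else 0) * G j i = G i i := by simp
  have s2 : ∑ j, ((x (j, α) : ℝ) : ℂ) * -(G * A₁.map Complex.ofReal * G) j i =
      -(Y.transpose * (G * A₁.map Complex.ofReal * G)) α i := by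
    rw [Matrix.mul_apply, ← Finset.sum_neg_distrib]
    refine Finset.sum_congr rfl fun j _ => ?_
    simp [hY, matOf]
  have s3 : Y.transpose * (G * A₁.map Complex.ofReal * G) =
      (a : ℂ) • ((Y.transpose * G) * Matrix.single i α (1 : ℂ) * (Y.transpose * G) +
        (Y.transpose * G * Y) * Matrix.single α i (1 : ℂ) * G) := by
    rw [hA₁c]
    simp only [Matrix.mul_smul, Matrix.smul_mul, Matrix.mul_add, Matrix.add_mul, Matrix.mul_assoc]
  rw [s1, s2, s3, Matrix.smul_apply, Matrix.add_apply, mul_single_mul_apply, mul_single_mul_apply,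
    resolventEntryDeriv, resolventEntry, smul_eq_mul, ← hGdef, ← hY]
  ring

theorem sum_mul_resolventEntry (a : ℝ) {z : ℂ} (hz : 0 < z.im) (x : ι × κ → ℝ) :
    a * ∑ i, ∑ α, (x (i, α) : ℂ) * resolventEntry a z i α x =
      Fintype.card ι + (a + z) * (matResolvent (wishartMatrix a (matOf x)) z).trace := by
  have h := congrArg Matrix.trace (matResolvent_wishartMatrix_mul a (matOf x) hz)
  rw [Matrix.trace_add, Matrix.trace_one, Matrix.trace_smul, smul_eq_mul] at h
  rw [← h, Matrix.mul_smul, Matrix.trace_smul, smul_eq_mul, Matrix.trace_mul_comm, Matrix.mul_assoc,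
    Matrix.trace]
  rfl

/-- In the sum of the derivatives all traces reduce to those of `G` and `G * G`, since
`a G X Xᵀ = 1 + (a + z) G`. -/
theorem sum_resolventEntryDeriv (a : ℝ) {z : ℂ} (hz : 0 < z.im) (x : ι × κ → ℝ) :
    ∑ i, ∑ α, resolventEntryDeriv a z i α x =
      Fintype.card κ * (matResolvent (wishartMatrix a (matOf x)) z).trace
      - ((matResolvent (wishartMatrix a (matOf x)) z).trace + (a + z) *
        (matResolvent (wishartMatrix a (matOf x)) z *
          matResolvent (wishartMatrix a (matOf x)) z).trace)
      - (Fintype.card ι + (a + z) * (matResolvent (wishartMatrix a (matOf x)) z).trace) *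
        (matResolvent (wishartMatrix a (matOf x)) z).trace := by
  have hR := matResolvent_wishartMatrix_mul a (matOf x) hz
  have hsym := transpose_matResolvent (wishartMatrix_isHermitian a (matOf x)) z
  simp only [resolventEntryDeriv, resolventEntry]
  set G := matResolvent (wishartMatrix a (matOf x)) z with hGdef
  set Y := (matOf x).map Complex.ofReal with hY
  have h1 : (a : ℂ) * (Y.transpose * G * Y).trace = Fintype.card ι + (a + z) * G.trace := by
    rw [Matrix.mul_assoc, Matrix.trace_mul_comm, Matrix.mul_assoc, ← smul_eq_mul,
      ← Matrix.trace_smul, ← Matrix.mul_smul, hR, Matrix.trace_add, Matrix.trace_one,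
      Matrix.trace_smul, smul_eq_mul]
  have h2 : (a : ℂ) * ∑ i, ∑ α, (Y.transpose * G) α i ^ 2 = G.trace + (a + z) * (G * G).trace := by
    have e : ∑ i, ∑ α, (Y.transpose * G) α i ^ 2 =
        ((Y.transpose * G).transpose * (Y.transpose * G)).trace := by
      rw [Matrix.trace]
      refine Finset.sum_congr rfl fun i _ => ?_
      rw [Matrix.diag_apply, Matrix.mul_apply]
      refine Finset.sum_congr rfl fun α _ => ?_
      rw [Matrix.transpose_apply, sq]
    rw [e, Matrix.transpose_mul, Matrix.transpose_transpose, hsym]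
    have e2 : G * Y * (Y.transpose * G) = G * (Y * Y.transpose) * G := by
      simp only [Matrix.mul_assoc]
    rw [e2, ← smul_eq_mul, ← Matrix.trace_smul, ← Matrix.smul_mul, ← Matrix.mul_smul, hR,
      Matrix.add_mul, one_mul, Matrix.trace_add, Matrix.smul_mul, Matrix.trace_smul, smul_eq_mul]
  have h3 : ∑ i, ∑ α, (Y.transpose * G * Y) α α * G i i =
      (Y.transpose * G * Y).trace * G.trace := by
    rw [Matrix.trace, Matrix.trace, Finset.sum_mul_sum, Finset.sum_comm]
    rfl
  simp only [Finset.sum_sub_distrib, ← Finset.mul_sum, Finset.sum_add_distrib]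
  rw [h3, mul_add, h2, ← mul_assoc (a : ℂ), h1]
  simp only [Finset.sum_const, Finset.card_univ, nsmul_eq_mul, ← Finset.mul_sum]
  rw [show ∑ i, G i i = G.trace from rfl]
  ring

theorem continuous_wishartMatrix_matOf {ι : Type*} [DecidableEq ι] (a : ℝ) :
    Continuous fun x : ι × κ → ℝ => wishartMatrix a (matOf x) := by
  unfold wishartMatrix
  have h : Continuous fun x : ι × κ → ℝ => matOf x :=
    continuous_matrix fun i α => continuous_apply (i, α)
  exact ((h.matrix_mul h.matrix_transpose).const_smul a).sub continuous_const

theorem continuous_wishart_resolvent (a : ℝ) {z : ℂ} (hz : 0 < z.im) :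
    Continuous fun x : ι × κ → ℝ => matResolvent (wishartMatrix a (matOf x)) z :=
  continuous_matResolvent (continuous_wishartMatrix_matOf a)
    (fun _ => wishartMatrix_isHermitian a _) hz

theorem continuous_complex_matOf {ι κ : Type*} :
    Continuous fun x : ι × κ → ℝ => (matOf x).map Complex.ofReal :=
  continuous_matrix fun i α => Complex.continuous_ofReal.comp (continuous_apply (i, α))

theorem continuous_resolventEntry (a : ℝ) {z : ℂ} (hz : 0 < z.im) (i : ι) (α : κ) :
    Continuous (resolventEntry a z i α) :=
  (continuous_complex_matOf.matrix_transpose.matrix_mul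
    (continuous_wishart_resolvent a hz)).matrix_elem α i

theorem continuous_resolventEntryDeriv (a : ℝ) {z : ℂ} (hz : 0 < z.im) (i : ι) (α : κ) :
    Continuous (resolventEntryDeriv a z i α) := by
  have h1 := (continuous_wishart_resolvent (ι := ι) (κ := κ) a hz).matrix_elem i i
  have h2 := ((continuous_complex_matOf.matrix_transpose.matrix_mul
    (continuous_wishart_resolvent (ι := ι) (κ := κ) a hz)).matrix_mul
      continuous_complex_matOf).matrix_elem α α
  exact h1.sub (continuous_const.mul (((continuous_resolventEntry a hz i α).pow 2).add (h2.mul h1)))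

theorem norm_resolventEntry_le (a : ℝ) {z : ℂ} (hz : 0 < z.im) (i : ι) (α : κ) (x : ι × κ → ℝ) :
    ‖resolventEntry a z i α x‖ ≤ Fintype.card ι / z.im * growthWeight x := by
  rw [resolventEntry, Matrix.mul_apply]
  refine (norm_sum_le _ _).trans ?_
  have : ∀ j ∈ Finset.univ, ‖((matOf x).map Complex.ofReal).transpose α j *
      matResolvent (wishartMatrix a (matOf x)) z j i‖ ≤ growthWeight x * (1 / z.im) := by
    intro j _
    rw [norm_mul]
    refine mul_le_mul ?_ (norm_matResolvent_apply_le (wishartMatrix_isHermitian a _) hz j i)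
      (norm_nonneg _) (growthWeight_nonneg x)
    simpa [matOf] using abs_le_growthWeight x (j, α)
  refine (Finset.sum_le_card_nsmul _ _ _ this).trans (le_of_eq ?_)
  simp only [Finset.card_univ, nsmul_eq_mul]
  ring

theorem norm_resolventEntryDeriv_le (a : ℝ) {z : ℂ} (hz : 0 < z.im) (i : ι) (α : κ)
    (x : ι × κ → ℝ) :
    ‖resolventEntryDeriv a z i α x‖ ≤
      (1 / z.im + |a| * ((Fintype.card ι / z.im) ^ 2 + (Fintype.card ι) ^ 2 / z.im * (1 / z.im))) *
        growthWeight x ^ 2 := by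
  have hW := one_le_growthWeight x
  have hG := norm_matResolvent_apply_le (wishartMatrix_isHermitian a (matOf x)) hz i i
  have hq : ‖(((matOf x).map Complex.ofReal).transpose *
      matResolvent (wishartMatrix a (matOf x)) z * (matOf x).map Complex.ofReal) α α‖ ≤
      (Fintype.card ι) ^ 2 / z.im * growthWeight x ^ 2 := by
    rw [Matrix.mul_apply]
    refine (norm_sum_le _ _).trans ?_
    have : ∀ j ∈ Finset.univ, ‖(((matOf x).map Complex.ofReal).transpose *
        matResolvent (wishartMatrix a (matOf x)) z) α j * (matOf x).map Complex.ofReal j α‖ ≤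
        Fintype.card ι / z.im * growthWeight x * growthWeight x := by
      intro j _
      rw [norm_mul]
      refine mul_le_mul (norm_resolventEntry_le a hz j α x) ?_ (norm_nonneg _) ?_
      · simpa [matOf] using abs_le_growthWeight x (j, α)
      · have := growthWeight_nonneg x
        positivity
    refine (Finset.sum_le_card_nsmul _ _ _ this).trans (le_of_eq ?_)
    simp only [Finset.card_univ, nsmul_eq_mul]
    ring
  have he := norm_resolventEntry_le a hz i α x
  have hW0 := growthWeight_nonneg x
  rw [resolventEntryDeriv]
  calc _ ≤ 1 / z.im + |a| * ((Fintype.card ι / z.im * growthWeight x) ^ 2 +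
        (Fintype.card ι) ^ 2 / z.im * growthWeight x ^ 2 * (1 / z.im)) := by
        refine (norm_sub_le _ _).trans (add_le_add hG ?_)
        rw [norm_mul, Complex.norm_real, Real.norm_eq_abs]
        refine mul_le_mul_of_nonneg_left ((norm_add_le _ _).trans (add_le_add ?_ ?_)) (abs_nonneg _)
        · rw [norm_pow]; gcongr
        · rw [norm_mul]
          exact mul_le_mul hq hG (norm_nonneg _) (by positivity)
    _ ≤ 1 / z.im * growthWeight x ^ 2 + |a| * ((Fintype.card ι / z.im * growthWeight x) ^ 2 +
        (Fintype.card ι) ^ 2 / z.im * growthWeight x ^ 2 * (1 / z.im)) := by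
        gcongr
        exact le_mul_of_one_le_right (by positivity) (one_le_pow₀ hW)
    _ = _ := by ring

theorem norm_trace_matResolvent_le {A : Matrix ι ι ℝ} (hA : A.IsHermitian) {z : ℂ}
    (hz : 0 < z.im) : ‖(matResolvent A z).trace‖ ≤ Fintype.card ι * (1 / z.im) := by
  rw [Matrix.trace]
  refine (norm_sum_le _ _).trans ((Finset.sum_le_card_nsmul _ _ _ fun i _ =>
    norm_matResolvent_apply_le hA hz i i).trans (le_of_eq ?_))
  simp

theorem norm_trace_matResolvent_mul_self_le {A : Matrix ι ι ℝ} (hA : A.IsHermitian) {z : ℂ}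
    (hz : 0 < z.im) :
    ‖(matResolvent A z * matResolvent A z).trace‖ ≤ Fintype.card ι * (1 / z.im * (1 / z.im)) := by
  rw [Matrix.trace]
  refine (norm_sum_le _ _).trans ((Finset.sum_le_card_nsmul _ _ _ fun i _ =>
    norm_matResolvent_mul_apply_le hA hA hz i i).trans (le_of_eq ?_))
  simp

/-- Integrating by parts in every variable: the exact identity between the first two moments of the
trace of the resolvent. -/
theorem integral_trace_identity (a : ℝ) {z : ℂ} (hz : 0 < z.im) {v : NNReal} (hv : v ≠ 0) :
    let π : Measure (ι × κ → ℝ) := Measure.pi fun _ => gaussianReal 0 v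
    let T : (ι × κ → ℝ) → ℂ := fun x => (matResolvent (wishartMatrix a (matOf x)) z).trace
    let T₂ : (ι × κ → ℝ) → ℂ := fun x =>
      (matResolvent (wishartMatrix a (matOf x)) z *
        matResolvent (wishartMatrix a (matOf x)) z).trace
    Fintype.card ι + (a + z) * ∫ x, T x ∂π =
      a * v * (Fintype.card κ * ∫ x, T x ∂π - (∫ x, T x ∂π + (a + z) * ∫ x, T₂ x ∂π)
        - (Fintype.card ι * ∫ x, T x ∂π + (a + z) * ∫ x, T x ^ 2 ∂π)) := by
  classical
  intro π T T₂
  have hG := continuous_wishart_resolvent (ι := ι) (κ := κ) a hz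
  have hTc : Continuous T := hG.matrix_trace
  have hT₂c : Continuous T₂ := (hG.matrix_mul hG).matrix_trace
  have hTb : ∀ x, ‖T x‖ ≤ Fintype.card ι * (1 / z.im) := fun x =>
    norm_trace_matResolvent_le (wishartMatrix_isHermitian a _) hz
  have hTi : Integrable T π := Integrable.of_bound hTc.aestronglyMeasurable _ (ae_of_all _ hTb)
  have hT₂i : Integrable T₂ π := Integrable.of_bound hT₂c.aestronglyMeasurable _
    (ae_of_all _ fun x => norm_trace_matResolvent_mul_self_le (wishartMatrix_isHermitian a _) hz)
  have hTsi : Integrable (fun x => T x ^ 2) π := by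
    refine Integrable.of_bound (hTc.pow 2).aestronglyMeasurable
      ((Fintype.card ι * (1 / z.im)) ^ 2) (ae_of_all _ fun x => ?_)
    rw [norm_pow]
    exact pow_le_pow_left₀ (norm_nonneg _) (hTb x) 2
  set C : ℝ := max (Fintype.card ι / z.im) (1 / z.im + |a| * ((Fintype.card ι / z.im) ^ 2 +
    (Fintype.card ι) ^ 2 / z.im * (1 / z.im))) with hC
  have hb1 : ∀ i α x, ‖resolventEntry a z i α x‖ ≤ C * growthWeight (ι := ι × κ) x ^ 2 := by
    intro i α x
    have hW := one_le_growthWeight x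
    calc _ ≤ Fintype.card ι / z.im * growthWeight x := norm_resolventEntry_le a hz i α x
      _ ≤ C * growthWeight x ^ 2 := by
        have : growthWeight x ≤ growthWeight x ^ 2 := by nlinarith
        exact mul_le_mul (le_max_left _ _) this (by linarith)
          ((by positivity : (0 : ℝ) ≤ Fintype.card ι / z.im).trans (le_max_left _ _))
  have hb2 : ∀ i α x, ‖resolventEntryDeriv a z i α x‖ ≤ C * growthWeight (ι := ι × κ) x ^ 2 := by
    intro i α x
    exact (norm_resolventEntryDeriv_le a hz i α x).trans
      (mul_le_mul_of_nonneg_right (le_max_right _ _) (sq_nonneg _))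
  have hibp : ∀ i α, ∫ x, (x (i, α) : ℂ) * resolventEntry a z i α x ∂π =
      v * ∫ x, resolventEntryDeriv a z i α x ∂π := fun i α =>
    integral_mul_pi_gaussianReal hv (i, α) (continuous_resolventEntry a hz i α)
      (continuous_resolventEntryDeriv a hz i α) (hasDerivAt_resolventEntry a hz i α)
      (hb1 i α) (hb2 i α)
  have hi1 : ∀ i α, Integrable (fun x : ι × κ → ℝ =>
      (x (i, α) : ℂ) * resolventEntry a z i α x) π := by
    intro i α
    refine integrable_of_norm_le_growthWeight (C := C) (k := 3) v
      ((Complex.continuous_ofReal.comp (continuous_apply _)).mul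
        (continuous_resolventEntry a hz i α)) fun x => ?_
    rw [norm_mul, Complex.norm_real, Real.norm_eq_abs]
    calc |x (i, α)| * ‖resolventEntry a z i α x‖
        ≤ growthWeight x * (C * growthWeight x ^ 2) :=
          mul_le_mul (abs_le_growthWeight x _) (hb1 i α x) (norm_nonneg _) (growthWeight_nonneg x)
      _ = _ := by ring
  have hi2 : ∀ i α, Integrable (resolventEntryDeriv a z i α) π := fun i α =>
    integrable_of_norm_le_growthWeight v (continuous_resolventEntryDeriv a hz i α) (hb2 i α)
  have hL : ∫ x, (a * ∑ i, ∑ α, (x (i, α) : ℂ) * resolventEntry a z i α x) ∂π =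
      a * v * ∫ x, ∑ i, ∑ α, resolventEntryDeriv a z i α x ∂π := by
    have hs : ∀ {H : ι → κ → (ι × κ → ℝ) → ℂ}, (∀ i α, Integrable (H i α) π) →
        ∫ x, ∑ i, ∑ α, H i α x ∂π = ∑ i, ∑ α, ∫ x, H i α x ∂π := by
      intro H hH
      rw [integral_finsetSum _ fun i _ => integrable_finsetSum Finset.univ fun α _ => hH i α]
      exact Finset.sum_congr rfl fun i _ => integral_finsetSum _ fun α _ => hH i α
    rw [integral_const_mul, hs hi1, hs hi2, mul_assoc]
    simp only [hibp, Finset.mul_sum]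
  have e1 : ∫ x, (a * ∑ i, ∑ α, (x (i, α) : ℂ) * resolventEntry a z i α x) ∂π =
      Fintype.card ι + (a + z) * ∫ x, T x ∂π := by
    simp only [sum_mul_resolventEntry a hz]
    rw [integral_add (integrable_const _) (hTi.const_mul _), integral_const_mul]
    simp
  have e2 : ∫ x, ∑ i, ∑ α, resolventEntryDeriv a z i α x ∂π =
      Fintype.card κ * ∫ x, T x ∂π - (∫ x, T x ∂π + (a + z) * ∫ x, T₂ x ∂π)
        - (Fintype.card ι * ∫ x, T x ∂π + (a + z) * ∫ x, T x ^ 2 ∂π) := by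
    have e3 : ∀ x, ∑ i, ∑ α, resolventEntryDeriv a z i α x =
        Fintype.card κ * T x - (T x + (a + z) * T₂ x)
          - (Fintype.card ι * T x + (a + z) * T x ^ 2) := fun x => by
      rw [sum_resolventEntryDeriv a hz]; simp only [T, T₂]; ring
    simp only [e3]
    have j1 : Integrable (fun x => (Fintype.card κ : ℂ) * T x) π := hTi.const_mul _
    have j2 : Integrable (fun x => (a + z) * T₂ x) π := hT₂i.const_mul _
    have j3 : Integrable (fun x => (Fintype.card ι : ℂ) * T x) π := hTi.const_mul _
    have j4 : Integrable (fun x => (a + z) * T x ^ 2) π := hTsi.const_mul _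
    have j5 : Integrable (fun x => T x + (a + z) * T₂ x) π := hTi.add j2
    have j6 : Integrable (fun x => (Fintype.card ι : ℂ) * T x + (a + z) * T x ^ 2) π := j3.add j4
    have j7 : Integrable (fun x => (Fintype.card κ : ℂ) * T x - (T x + (a + z) * T₂ x)) π :=
      j1.sub j5
    rw [integral_sub j7 j6, integral_sub j1 j5, integral_add hTi j2, integral_add j3 j4]
    simp only [integral_const_mul]
  rw [← e1, hL, e2]

end Wishart

/-- The first two moments of the Stieltjes transform of `a X Xᵀ - a`, where `X` is `n × p` with
independent centred Gaussian entries of variance `1 / p`, satisfy the equation up to `O(1 / p)`. -/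
theorem norm_approx_mpEquation_le (a : ℝ) {z : ℂ} (hz : 0 < z.im) {n p : ℕ} (hn : n ≠ 0)
    (hp : p ≠ 0) :
    let π : Measure (Fin n × Fin p → ℝ) := Measure.pi fun _ => gaussianReal 0 (p : NNReal)⁻¹
    let m : (Fin n × Fin p → ℝ) → ℂ := fun x =>
      (matResolvent (wishartMatrix a (matOf x)) z).trace / n
    ‖((a * (n / p) : ℝ) : ℂ) * (z + a) * ∫ x, m x ^ 2 ∂π +
      (z + ((a * (n / p) : ℝ) : ℂ)) * ∫ x, m x ∂π + 1‖ ≤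
      |a| / p * (1 / z.im + ‖a + z‖ * (1 / z.im * (1 / z.im))) := by
  intro π m
  have hv : ((p : NNReal)⁻¹) ≠ 0 := by positivity
  have h := integral_trace_identity (ι := Fin n) (κ := Fin p) a hz hv
  simp only [Fintype.card_fin] at h
  set T : (Fin n × Fin p → ℝ) → ℂ := fun x => (matResolvent (wishartMatrix a (matOf x)) z).trace
  set T₂ : (Fin n × Fin p → ℝ) → ℂ := fun x =>
      (matResolvent (wishartMatrix a (matOf x)) z *
        matResolvent (wishartMatrix a (matOf x)) z).trace
  have hn' : (n : ℂ) ≠ 0 := by exact_mod_cast hn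
  have hp' : (p : ℂ) ≠ 0 := by exact_mod_cast hp
  have hnr : (0 : ℝ) < n := by positivity
  have hpr : (0 : ℝ) < p := by positivity
  have e1 : ∫ x, m x ∂π = (∫ x, T x ∂π) / n := integral_div _ _
  have e2 : ∫ x, m x ^ 2 ∂π = (∫ x, T x ^ 2 ∂π) / n ^ 2 := by
    simp only [m, div_pow]
    exact integral_div _ _
  have e3 : ((a * (n / p) : ℝ) : ℂ) * (z + a) * ∫ x, m x ^ 2 ∂π +
      (z + ((a * (n / p) : ℝ) : ℂ)) * ∫ x, m x ∂π + 1 =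
      -((a / p : ℝ) : ℂ) * ((∫ x, T x ∂π) / n + (a + z) * ((∫ x, T₂ x ∂π) / n)) := by
    rw [e1, e2]
    change (n : ℂ) + (a + z) * ∫ x, T x ∂π = a * (((p : NNReal)⁻¹ : NNReal) : ℂ) *
      (p * ∫ x, T x ∂π - (∫ x, T x ∂π + (a + z) * ∫ x, T₂ x ∂π)
        - (n * ∫ x, T x ∂π + (a + z) * ∫ x, T x ^ 2 ∂π)) at h
    push_cast at h ⊢
    generalize (∫ x, T x ∂π) = t at *
    generalize (∫ x, T₂ x ∂π) = t₂ at *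
    generalize (∫ x, T x ^ 2 ∂π) = s at *
    field_simp at h ⊢
    linear_combination h
  rw [e3, norm_mul, norm_neg, Complex.norm_real, Real.norm_eq_abs, abs_div, abs_of_pos hpr]
  refine mul_le_mul_of_nonneg_left ((norm_add_le _ _).trans (add_le_add ?_ ?_)) (by positivity)
  · rw [norm_div, Complex.norm_natCast, div_le_iff₀ hnr]
    refine (norm_integral_le_of_norm_le_const (C := n * (1 / z.im))
      (ae_of_all _ fun x => ?_)).trans ?_
    · simpa using norm_trace_matResolvent_le (wishartMatrix_isHermitian a (matOf x)) hz
    · simp [mul_comm]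
  · rw [norm_mul, norm_div, Complex.norm_natCast]
    refine mul_le_mul_of_nonneg_left ?_ (norm_nonneg _)
    rw [div_le_iff₀ hnr]
    refine (norm_integral_le_of_norm_le_const (C := n * (1 / z.im * (1 / z.im)))
      (ae_of_all _ fun x => ?_)).trans ?_
    · simpa using norm_trace_matResolvent_mul_self_le (wishartMatrix_isHermitian a (matOf x)) hz
    · simp [mul_comm]

/-! ### The kernel matrix: comparison, concentration and laws -/

/-- The kernel matrix with linear kernel `ξ ↦ a ξ` of the rows of `x`. -/
def linearKernelMatrix {n p : ℕ} (a : ℝ) (x : Fin n → Fin p → ℝ) :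
    Matrix (Fin n) (Fin n) ℝ :=
  kernelMatrix (fun ξ => a * ξ) fun i => WithLp.toLp 2 (x i)

theorem linearKernelMatrix_isHermitian {n p : ℕ} (a : ℝ) (x : Fin n → Fin p → ℝ) :
    (linearKernelMatrix a x).IsHermitian :=
  kernelMatrix_isHermitian _ _

theorem linearKernelMatrix_apply {n p : ℕ} (a : ℝ) (x : Fin n → Fin p → ℝ) (i j : Fin n) :
    linearKernelMatrix a x i j = if i = j then 0 else a * ∑ α, x i α * x j α := by
  simp only [linearKernelMatrix, kernelMatrix, Matrix.of_apply, PiLp.inner_apply]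
  simp [mul_comm]

theorem wishartMatrix_sub_linearKernelMatrix {n p : ℕ} (a : ℝ) (x : Fin n → Fin p → ℝ) :
    wishartMatrix a (Matrix.of x) - linearKernelMatrix a x =
      Matrix.diagonal fun i => a * (∑ α, x i α ^ 2 - 1) := by
  ext i j
  rw [Matrix.sub_apply, linearKernelMatrix_apply, Matrix.diagonal_apply, wishartMatrix,
    Matrix.sub_apply, Matrix.smul_apply, Matrix.smul_apply, Matrix.mul_apply]
  by_cases h : i = j
  · subst h
    simp [sq, mul_sub]
  · simp [h]

/-- Restoring the diagonal changes the trace of the resolvent by at most the sum of the deviations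
of the squared lengths of the points from one. -/
theorem norm_trace_linearKernelMatrix_sub_le {n p : ℕ} (a : ℝ) (x : Fin n → Fin p → ℝ)
    {z : ℂ} (hz : 0 < z.im) :
    ‖(matResolvent (linearKernelMatrix a x) z).trace -
        (matResolvent (wishartMatrix a (Matrix.of x)) z).trace‖ ≤
      |a| * (1 / z.im * (1 / z.im)) * ∑ i, |∑ α, x i α ^ 2 - 1| := by
  have hA := linearKernelMatrix_isHermitian a x
  have hB := wishartMatrix_isHermitian a (Matrix.of x)
  rw [← Matrix.trace_sub, matResolvent_sub hA hB hz, wishartMatrix_sub_linearKernelMatrix,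
    Matrix.trace_mul_comm, ← Matrix.mul_assoc, Matrix.trace, Finset.mul_sum]
  refine (norm_sum_le _ _).trans (Finset.sum_le_sum fun i _ => ?_)
  have e : (Matrix.diagonal fun i => a * (∑ α, x i α ^ 2 - 1)).map Complex.ofReal =
      Matrix.diagonal fun i => ((a * (∑ α, x i α ^ 2 - 1) : ℝ) : ℂ) :=
    Matrix.diagonal_map Complex.ofReal_zero
  rw [Matrix.diag_apply, e, Matrix.mul_diagonal, norm_mul, Complex.norm_real, Real.norm_eq_abs,
    abs_mul]
  have h1 := norm_matResolvent_mul_apply_le hB hA hz i i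
  calc _ ≤ 1 / z.im * (1 / z.im) * (|a| * |∑ α, x i α ^ 2 - 1|) := by gcongr
    _ = _ := by ring

theorem continuous_linearKernelMatrix {n p : ℕ} (a : ℝ) :
    Continuous fun x : Fin n → Fin p → ℝ => linearKernelMatrix a x := by
  refine continuous_matrix fun i j => ?_
  simp only [linearKernelMatrix_apply]
  split_ifs
  · exact continuous_const
  · fun_prop

/-- The Stieltjes transform of the empirical spectral distribution of the kernel matrix, as a
function of the data. -/
def kernelStieltjes {n p : ℕ} (a : ℝ) (z : ℂ) (x : Fin n → Fin p → ℝ) : ℂ :=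
  (matResolvent (linearKernelMatrix a x) z).trace / n

theorem continuous_kernelStieltjes {n p : ℕ} (a : ℝ) {z : ℂ} (hz : 0 < z.im) :
    Continuous (kernelStieltjes (n := n) (p := p) a z) :=
  (continuous_matResolvent (continuous_linearKernelMatrix a)
    (fun x => linearKernelMatrix_isHermitian a x) hz).matrix_trace.div_const _

theorem norm_trace_div_le {n : ℕ} {A : Matrix (Fin n) (Fin n) ℝ} (hA : A.IsHermitian) {z : ℂ}
    (hz : 0 < z.im) : ‖(matResolvent A z).trace / n‖ ≤ 1 / z.im := by
  rcases eq_or_ne n 0 with rfl | hn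
  · simp [hz.le]
  rw [norm_div, Complex.norm_natCast, div_le_iff₀ (by positivity), mul_comm]
  simpa using norm_trace_matResolvent_le hA hz

theorem norm_kernelStieltjes_le {n p : ℕ} (a : ℝ) {z : ℂ} (hz : 0 < z.im)
    (x : Fin n → Fin p → ℝ) : ‖kernelStieltjes a z x‖ ≤ 1 / z.im :=
  norm_trace_div_le (linearKernelMatrix_isHermitian a x) hz

/-- Moving the `i`-th point changes only the `i`-th row and column of the kernel matrix. -/
theorem norm_kernelStieltjes_sub_le {n p : ℕ} (a : ℝ) {z : ℂ} (hz : 0 < z.im) (i : Fin n)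
    (x y : Fin n → Fin p → ℝ) (h : ∀ j, j ≠ i → x j = y j) :
    ‖kernelStieltjes a z x - kernelStieltjes a z y‖ ≤ 4 / z.im / n := by
  rw [kernelStieltjes, kernelStieltjes, ← sub_div, norm_div, Complex.norm_natCast]
  gcongr
  refine norm_trace_matResolvent_sub_le (linearKernelMatrix_isHermitian a x)
    (linearKernelMatrix_isHermitian a y) hz i fun j l hj hl => ?_
  simp only [linearKernelMatrix_apply]
  rw [h j hj, h l hl]

theorem hasBoundedDifferences_re_kernelStieltjes {n p : ℕ} (a : ℝ) {z : ℂ} (hz : 0 < z.im) :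
    HasBoundedDifferences (fun x : Fin n → Fin p → ℝ => (kernelStieltjes a z x).re)
      (4 / z.im / n) := fun i x y h => by
  rw [← Complex.sub_re]
  exact (Complex.abs_re_le_norm _).trans (norm_kernelStieltjes_sub_le a hz i x y h)

theorem hasBoundedDifferences_im_kernelStieltjes {n p : ℕ} (a : ℝ) {z : ℂ} (hz : 0 < z.im) :
    HasBoundedDifferences (fun x : Fin n → Fin p → ℝ => (kernelStieltjes a z x).im)
      (4 / z.im / n) := fun i x y h => by
  rw [← Complex.sub_im]
  exact (Complex.abs_im_le_norm _).trans (norm_kernelStieltjes_sub_le a hz i x y h)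

section Law

variable {Ω : Type*} [MeasurableSpace Ω] {P : Measure Ω}

theorem map_entries_eq_pi [IsProbabilityMeasure P] {n p : ℕ} {v : NNReal}
    {X : Fin n → Ω → EuclideanSpace ℝ (Fin p)}
    (hlaw : ∀ i j, HasLaw (fun ω => X i ω j) (gaussianReal 0 v) P)
    (hindep : iIndepFun (fun (ij : Fin n × Fin p) ω => X ij.1 ω ij.2) P) :
    P.map (fun ω (ij : Fin n × Fin p) => X ij.1 ω ij.2) = Measure.pi fun _ => gaussianReal 0 v := by
  rw [(iIndepFun_iff_map_fun_eq_pi_map (f := fun (ij : Fin n × Fin p) ω => X ij.1 ω ij.2)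
    fun ij => (hlaw ij.1 ij.2).aemeasurable).1 hindep]
  congr 1
  ext1 ij
  exact (hlaw ij.1 ij.2).map_eq

theorem aemeasurable_entries {n p : ℕ} {v : NNReal} {X : Fin n → Ω → EuclideanSpace ℝ (Fin p)}
    (hlaw : ∀ i j, HasLaw (fun ω => X i ω j) (gaussianReal 0 v) P) :
    AEMeasurable (fun ω (ij : Fin n × Fin p) => X ij.1 ω ij.2) P :=
  aemeasurable_pi_lambda _ fun ij => (hlaw ij.1 ij.2).aemeasurable

theorem aemeasurable_rows {n p : ℕ} {v : NNReal} {X : Fin n → Ω → EuclideanSpace ℝ (Fin p)}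
    (hlaw : ∀ i j, HasLaw (fun ω => X i ω j) (gaussianReal 0 v) P) :
    AEMeasurable (fun ω (i : Fin n) (j : Fin p) => X i ω j) P :=
  aemeasurable_pi_lambda _ fun i => aemeasurable_pi_lambda _ fun j => (hlaw i j).aemeasurable

theorem map_rows_eq_pi [IsProbabilityMeasure P] {n p : ℕ} {v : NNReal}
    {X : Fin n → Ω → EuclideanSpace ℝ (Fin p)}
    (hlaw : ∀ i j, HasLaw (fun ω => X i ω j) (gaussianReal 0 v) P)
    (hindep : iIndepFun (fun (ij : Fin n × Fin p) ω => X ij.1 ω ij.2) P) :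
    P.map (fun ω (i : Fin n) (j : Fin p) => X i ω j) =
      Measure.pi fun _ => Measure.pi fun _ => gaussianReal 0 v := by
  have h1 := map_entries_eq_pi hlaw hindep
  have h2 := Measure.infinitePi_map_curry (ι := Fin n) (κ := Fin p) (fun _ _ => gaussianReal 0 v)
  simp only [Measure.infinitePi_eq_pi] at h2
  rw [← h2, ← h1, AEMeasurable.map_map_of_aemeasurable
    (MeasurableEquiv.measurable _).aemeasurable (aemeasurable_entries hlaw)]
  rfl

theorem measureReal_deviation_le [IsProbabilityMeasure P] {n p : ℕ} {v : NNReal}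
    {X : Fin n → Ω → EuclideanSpace ℝ (Fin p)}
    (hlaw : ∀ i j, HasLaw (fun ω => X i ω j) (gaussianReal 0 v) P)
    (hindep : iIndepFun (fun (ij : Fin n × Fin p) ω => X ij.1 ω ij.2) P)
    {f : (Fin n → Fin p → ℝ) → ℝ} (hf : Measurable f) {c : ℝ} (h : HasBoundedDifferences f c)
    {ε : ℝ} (hε : 0 ≤ ε) :
    P.real {ω | ε ≤ |f (fun i j => X i ω j) - ∫ ω', f (fun i j => X i ω' j) ∂P|} ≤
      2 * Real.exp (-ε ^ 2 / (2 * (n * c ^ 2))) := by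
  have hX := aemeasurable_rows hlaw
  have hm := map_rows_eq_pi hlaw hindep
  have h1 := h.measureReal_le (fun _ : Fin n => Measure.pi fun _ : Fin p => gaussianReal 0 v) hf hε
  rw [← hm, integral_map hX hf.aestronglyMeasurable, measureReal_def,
    Measure.map_apply_of_aemeasurable hX (measurableSet_le measurable_const (by fun_prop))] at h1
  exact h1

end Law

theorem integrable_pow_eval_pi_gaussianReal {ι : Type*} [Fintype ι] (v : NNReal) (i : ι) (j : ℕ) :
    Integrable (fun x : ι → ℝ => x i ^ j) (Measure.pi fun _ => gaussianReal 0 v) :=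
  (measurePreserving_eval _ i).integrable_comp_of_integrable
    (integrable_pow_gaussianReal_zero v j)

theorem integrable_abs_sum_sq_sub_one {n p : ℕ} {v : NNReal} (i : Fin n) :
    Integrable (fun x : Fin n × Fin p → ℝ => |∑ α, x (i, α) ^ 2 - 1|)
      (Measure.pi fun _ => gaussianReal 0 v) :=
  ((integrable_finsetSum _ fun α _ => integrable_pow_eval_pi_gaussianReal v (i, α) 2).sub
    (integrable_const 1)).abs

/-- The mean deviation of the squared length of a Gaussian vector of covariance `p⁻¹ I` from its
mean `1` is `O(p ^ (-1/2))`. -/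
theorem integral_abs_sum_sq_sub_one_le {n p : ℕ} (hp : p ≠ 0) (i : Fin n) :
    ∫ x : Fin n × Fin p → ℝ, |∑ α, x (i, α) ^ 2 - 1|
        ∂(Measure.pi fun _ => gaussianReal 0 (p : NNReal)⁻¹) ≤
      √((∫ t : ℝ, t ^ 4 ∂gaussianReal 0 1) / p) := by
  set v : NNReal := (p : NNReal)⁻¹ with hv
  set π : Measure (Fin n × Fin p → ℝ) := Measure.pi fun _ => gaussianReal 0 v with hπ
  set K := ∫ t : ℝ, t ^ 4 ∂gaussianReal 0 1 with hK
  have hpr : (0 : ℝ) < p := by positivity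
  have hvr : (v : ℝ) = 1 / p := by simp [hv]
  have hev : ∀ α : Fin p, MeasurePreserving (fun x : Fin n × Fin p → ℝ => x (i, α)) π
      (gaussianReal 0 v) := fun α => measurePreserving_eval _ (i, α)
  have hmom : ∀ (α : Fin p) (j : ℕ), ∫ x, x (i, α) ^ j ∂π = ∫ t, t ^ j ∂gaussianReal 0 v := by
    intro α j
    rw [← (hev α).map_eq, integral_map (hev α).measurable.aemeasurable (by fun_prop)]
  have hint : ∀ (α : Fin p) (j : ℕ), Integrable (fun x : Fin n × Fin p → ℝ => x (i, α) ^ j) π :=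
    fun α j => integrable_pow_eval_pi_gaussianReal v (i, α) j
  have hm2 : ∫ t, t ^ 2 ∂gaussianReal 0 v = v := by
    have h := variance_of_integral_eq_zero (μ := gaussianReal 0 v) (X := fun t : ℝ => t)
      (by fun_prop) (by simp)
    rw [variance_fun_id_gaussianReal] at h
    exact h.symm
  have hm4 : ∫ t, t ^ 4 ∂gaussianReal 0 v = (v : ℝ) ^ 2 * K := by
    have h := gaussianReal_map_const_mul (μ := 0) (v := 1) (√(v : ℝ))
    have e : NNReal.mk (√(v : ℝ) ^ 2) (sq_nonneg _) * 1 = v := by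
      rw [mul_one]; ext; simp
    rw [mul_zero, e] at h
    rw [← h, integral_map (by fun_prop) (by fun_prop), hK, ← integral_const_mul]
    congr 1
    ext t
    rw [mul_pow]
    congr 1
    rw [show (4 : ℕ) = 2 * 2 from rfl, pow_mul, Real.sq_sqrt (NNReal.coe_nonneg v)]
  have hL2 : ∀ α : Fin p, MemLp (fun x : Fin n × Fin p → ℝ => x (i, α) ^ 2) 2 π := by
    intro α
    rw [memLp_two_iff_integrable_sq (hint α 2).aestronglyMeasurable]
    simpa only [← pow_mul] using hint α 4
  have hvar : ∀ α : Fin p, Var[fun x : Fin n × Fin p → ℝ => x (i, α) ^ 2; π] ≤ (v : ℝ) ^ 2 * K := by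
    intro α
    refine (variance_le_expectation_sq (hint α 2).aestronglyMeasurable).trans (le_of_eq ?_)
    rw [← hm4, ← hmom α 4]
    congr 1
    ext x
    simp only [Pi.pow_apply]
    ring
  have hind : iIndepFun (fun (ij : Fin n × Fin p) (x : Fin n × Fin p → ℝ) => x ij) π :=
    iIndepFun_pi (X := fun _ t => t) fun _ => aemeasurable_id
  set Y : (Fin n × Fin p → ℝ) → ℝ := fun x => ∑ α, x (i, α) ^ 2 with hY
  have hYL2 : MemLp Y 2 π := memLp_finsetSum _ fun α _ => hL2 α
  have hYint : ∫ x, Y x ∂π = 1 := by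
    rw [hY, integral_finsetSum _ fun α _ => hint α 2]
    simp only [hmom, hm2, hvr]
    simp
    field_simp
  have hYvar : Var[Y; π] ≤ K / p := by
    have h := IndepFun.variance_sum (μ := π) (s := Finset.univ)
      (X := fun α (x : Fin n × Fin p → ℝ) => x (i, α) ^ 2) (fun α _ => hL2 α)
      (fun α _ β _ hαβ => by
        have h1 := hind.indepFun (i := (i, α)) (j := (i, β)) (fun h => hαβ (Prod.mk.inj h).2)
        exact h1.comp (φ := fun t : ℝ => t ^ 2) (ψ := fun t : ℝ => t ^ 2) (by fun_prop)
          (by fun_prop))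
    have e : (∑ α, fun x : Fin n × Fin p → ℝ => x (i, α) ^ 2) = Y := by
      ext x; simp [hY]
    rw [e] at h
    rw [h]
    refine (Finset.sum_le_sum fun α _ => hvar α).trans (le_of_eq ?_)
    rw [hvr]
    simp
    field_simp
  have hZL2 : MemLp (fun x => |Y x - 1|) 2 π := (hYL2.sub (memLp_const 1)).abs
  have h1 := variance_nonneg (fun x => |Y x - 1|) π
  rw [variance_eq_sub hZL2] at h1
  have h2 : ∫ x, ((fun x => |Y x - 1|) ^ 2) x ∂π = Var[Y; π] := by
    rw [variance_eq_integral hYL2.aemeasurable, hYint]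
    congr 1
    ext x
    simp
  rw [h2] at h1
  apply Real.le_sqrt_of_sq_le
  linarith

/-! ### The limit of the Stieltjes transforms -/

section Limit

variable {Ω : Type*} [MeasurableSpace Ω] {P : Measure Ω} [IsProbabilityMeasure P]

/-- Borel–Cantelli for tails that are exponentially small in `n k`, which is at least `k`. -/
theorem ae_tendsto_zero_of_measureReal_le {n : ℕ → ℕ} (hn : StrictMono n) {Y : ℕ → Ω → ℝ} {C : ℝ}
    (hC : 0 < C) (h : ∀ k (ε : ℝ), 0 < ε → P.real {ω | ε ≤ |Y k ω|} ≤
      2 * Real.exp (-(ε ^ 2 / C) * n k)) :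
    ∀ᵐ ω ∂P, Tendsto (fun k => Y k ω) atTop (𝓝 0) := by
  have hev : ∀ ε : ℝ, 0 < ε → ∀ᵐ ω ∂P, ∀ᶠ k in atTop, |Y k ω| < ε := by
    intro ε hε
    have hr : Real.exp (-(ε ^ 2 / C)) < 1 := by
      rw [Real.exp_lt_one_iff]
      have : 0 < ε ^ 2 / C := by positivity
      linarith
    have hs : Summable fun k : ℕ => P.real {ω | ε ≤ |Y k ω|} := by
      refine Summable.of_nonneg_of_le (fun _ => measureReal_nonneg) (fun k => ?_)
        ((summable_geometric_of_lt_one (Real.exp_pos _).le hr).mul_left 2)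
      refine (h k ε hε).trans ?_
      rw [← Real.exp_nat_mul]
      gcongr 2 * Real.exp ?_
      have hk : (k : ℝ) ≤ n k := by exact_mod_cast hn.le_apply
      have : 0 < ε ^ 2 / C := by positivity
      nlinarith
    have hs' : ∑' k, P {ω | ε ≤ |Y k ω|} ≠ ⊤ := by
      have e : ∀ k, P {ω | ε ≤ |Y k ω|} = ENNReal.ofReal (P.real {ω | ε ≤ |Y k ω|}) :=
        fun k => (ofReal_measureReal).symm
      simp only [e]
      rw [← ENNReal.ofReal_tsum_of_nonneg (fun _ => measureReal_nonneg) hs]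
      exact ENNReal.ofReal_ne_top
    filter_upwards [ae_eventually_notMem hs'] with ω hω
    filter_upwards [hω] with k hk
    simpa using hk
  have hall : ∀ᵐ ω ∂P, ∀ j : ℕ, ∀ᶠ k in atTop, |Y k ω| < 1 / ((j : ℝ) + 1) :=
    ae_all_iff.2 fun j => hev _ (by positivity)
  filter_upwards [hall] with ω hω
  rw [Metric.tendsto_nhds]
  intro ε hε
  obtain ⟨j, hj⟩ := exists_nat_one_div_lt hε
  filter_upwards [hω j] with k hk
  simpa using hk.trans hj

/-- Replacing a bounded random variable `W` by a constant `e` in the first two moments costs a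
multiple of the mean of `‖W - e‖`. -/
theorem norm_mpPoly_sub_le {c : ℝ} {a : ℝ} {z : ℂ} {η : ℝ} {W : Ω → ℂ}
    (hW : AEStronglyMeasurable W P)
    (hWb : ∀ ω, ‖W ω‖ ≤ η) {e : ℂ} (he : ‖e‖ ≤ η) :
    ‖mpPoly a c z e - ((c : ℂ) * (z + a) * ∫ ω, W ω ^ 2 ∂P + (z + c) * ∫ ω, W ω ∂P + 1)‖ ≤
      (‖(c : ℂ) * (z + a)‖ * (2 * η) + ‖z + c‖) * ∫ ω, ‖W ω - e‖ ∂P := by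
  have hi1 : Integrable W P := Integrable.of_bound hW η (ae_of_all _ hWb)
  have hi2 : Integrable (fun ω => W ω ^ 2) P :=
    Integrable.of_bound (hW.pow 2) (η ^ 2) (ae_of_all _ fun ω => by
      rw [norm_pow]; exact pow_le_pow_left₀ (norm_nonneg _) (hWb ω) 2)
  have hd : Integrable (fun ω => ‖W ω - e‖) P := (hi1.sub (integrable_const e)).norm
  have e1 : ‖(∫ ω, W ω ∂P) - e‖ ≤ ∫ ω, ‖W ω - e‖ ∂P := by
    have : (∫ ω, W ω ∂P) - e = ∫ ω, (W ω - e) ∂P := by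
      rw [integral_sub hi1 (integrable_const e)]; simp
    rw [this]
    exact norm_integral_le_integral_norm _
  have e2 : ‖(∫ ω, W ω ^ 2 ∂P) - e ^ 2‖ ≤ 2 * η * ∫ ω, ‖W ω - e‖ ∂P := by
    have : (∫ ω, W ω ^ 2 ∂P) - e ^ 2 = ∫ ω, (W ω ^ 2 - e ^ 2) ∂P := by
      rw [integral_sub hi2 (integrable_const _)]; simp
    rw [this, ← integral_const_mul]
    refine norm_integral_le_of_norm_le (hd.const_mul _) (ae_of_all _ fun ω => ?_)
    rw [sq_sub_sq, norm_mul]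
    gcongr
    linarith [norm_add_le (W ω) e, hWb ω]
  have e3 : mpPoly a c z e - ((c : ℂ) * (z + a) * ∫ ω, W ω ^ 2 ∂P + (z + c) * ∫ ω, W ω ∂P + 1) =
      -((c : ℂ) * (z + a) * ((∫ ω, W ω ^ 2 ∂P) - e ^ 2) + (z + c) * ((∫ ω, W ω ∂P) - e)) := by
    rw [mpPoly]; ring
  rw [e3, norm_neg]
  refine (norm_add_le _ _).trans ?_
  rw [norm_mul, norm_mul (z + c)]
  calc _ ≤ ‖(c : ℂ) * (z + a)‖ * (2 * η * ∫ ω, ‖W ω - e‖ ∂P) +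
        ‖z + c‖ * ∫ ω, ‖W ω - e‖ ∂P := by gcongr
    _ = _ := by ring

/-- Replacing the kernel matrix by the Wishart matrix changes the Stieltjes transform by
`O(p ^ (-1/2))` in the mean. -/
theorem integral_norm_sub_kernelStieltjes_le {n p : ℕ} (hp : p ≠ 0) (hn : n ≠ 0) (a : ℝ) {z : ℂ}
    (hz : 0 < z.im) :
    ∫ x : Fin n × Fin p → ℝ, ‖(matResolvent (wishartMatrix a (matOf x)) z).trace / n -
        kernelStieltjes a z (fun i j => x (i, j))‖
        ∂(Measure.pi fun _ => gaussianReal 0 (p : NNReal)⁻¹) ≤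
      |a| * (1 / z.im * (1 / z.im)) * √((∫ t : ℝ, t ^ 4 ∂gaussianReal 0 1) / p) := by
  set π : Measure (Fin n × Fin p → ℝ) := Measure.pi fun _ => gaussianReal 0 (p : NNReal)⁻¹ with hπ
  set C := |a| * (1 / z.im * (1 / z.im)) with hC
  have hC0 : 0 ≤ C := by positivity
  have hsq : ∀ i, Integrable (fun x : Fin n × Fin p → ℝ => |∑ α, x (i, α) ^ 2 - 1|) π :=
    fun i => integrable_abs_sum_sq_sub_one i
  have hb : ∀ x : Fin n × Fin p → ℝ, ‖(matResolvent (wishartMatrix a (matOf x)) z).trace / n -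
      kernelStieltjes a z (fun i j => x (i, j))‖ ≤
        C / n * ∑ i, |∑ α, x (i, α) ^ 2 - 1| := by
    intro x
    have h := norm_trace_linearKernelMatrix_sub_le a (fun i j => x (i, j)) hz
    rw [norm_sub_rev, kernelStieltjes, ← sub_div, norm_div, Complex.norm_natCast,
      div_mul_eq_mul_div]
    gcongr
    exact h
  calc _ ≤ ∫ x, C / n * ∑ i, |∑ α, x (i, α) ^ 2 - 1| ∂π :=
        integral_mono_of_nonneg (ae_of_all _ fun _ => norm_nonneg _)
          ((integrable_finsetSum _ fun i _ => hsq i).const_mul _) (ae_of_all _ hb)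
    _ = C / n * ∑ i, ∫ x, |∑ α, x (i, α) ^ 2 - 1| ∂π := by
        rw [integral_const_mul, integral_finsetSum _ fun i _ => hsq i]
    _ ≤ C / n * ∑ _i : Fin n, √((∫ t : ℝ, t ^ 4 ∂gaussianReal 0 1) / p) := by
        gcongr with i
        exact integral_abs_sum_sq_sub_one_le hp i
    _ = _ := by
        have : (n : ℝ) ≠ 0 := Nat.cast_ne_zero.2 hn
        simp
        field_simp

/-- The mean Stieltjes transform of the kernel matrix approximately solves the equation. -/
theorem norm_mpPoly_integral_kernelStieltjes_le {n p : ℕ} (hp : p ≠ 0) (hn : n ≠ 0)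
    {X : Fin n → Ω → EuclideanSpace ℝ (Fin p)}
    (hlaw : ∀ i j, HasLaw (fun ω => X i ω j) (gaussianReal 0 (p : NNReal)⁻¹) P)
    (hindep : iIndepFun (fun (ij : Fin n × Fin p) ω => X ij.1 ω ij.2) P) (a : ℝ) {z : ℂ}
    (hz : 0 < z.im) :
    let G : Ω → ℂ := fun ω => kernelStieltjes a z (fun i j => X i ω j)
    let c : ℝ := a * (n / p)
    ‖mpPoly a c z (∫ ω, G ω ∂P)‖ ≤
      (‖(c : ℂ) * (z + a)‖ * (2 * (1 / z.im)) + ‖z + c‖) *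
        (|a| * (1 / z.im * (1 / z.im)) * √((∫ t : ℝ, t ^ 4 ∂gaussianReal 0 1) / p) +
          ∫ ω, ‖G ω - ∫ ω', G ω' ∂P‖ ∂P) +
      |a| / p * (1 / z.im + ‖a + z‖ * (1 / z.im * (1 / z.im))) := by
  intro G c
  set E := ∫ ω, G ω ∂P with hE
  set π : Measure (Fin n × Fin p → ℝ) := Measure.pi fun _ => gaussianReal 0 (p : NNReal)⁻¹ with hπ
  let x : Ω → Fin n × Fin p → ℝ := fun ω ij => X ij.1 ω ij.2
  have hx : AEMeasurable x P := aemeasurable_entries hlaw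
  have hmap : P.map x = π := map_entries_eq_pi hlaw hindep
  let m : (Fin n × Fin p → ℝ) → ℂ := fun x => (matResolvent (wishartMatrix a (matOf x)) z).trace / n
  have hm : Continuous m := (continuous_wishart_resolvent a hz).matrix_trace.div_const _
  have hg : Continuous fun y : Fin n × Fin p → ℝ => kernelStieltjes a z (fun i j => y (i, j)) :=
    (continuous_kernelStieltjes a hz).comp (by fun_prop)
  have hGb : ∀ ω, ‖G ω‖ ≤ 1 / z.im := fun ω => norm_kernelStieltjes_le a hz _
  have hmb : ∀ ω, ‖m (x ω)‖ ≤ 1 / z.im := fun ω =>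
    norm_trace_div_le (wishartMatrix_isHermitian a _) hz
  have hEb : ‖E‖ ≤ 1 / z.im := by
    refine (norm_integral_le_of_norm_le_const (ae_of_all P hGb)).trans (le_of_eq ?_)
    simp
  have hWm : AEStronglyMeasurable (fun ω => m (x ω)) P :=
    (hm.measurable.comp_aemeasurable hx).aestronglyMeasurable
  have hGm : AEStronglyMeasurable G P := (hg.measurable.comp_aemeasurable hx).aestronglyMeasurable
  have hWi : Integrable (fun ω => m (x ω)) P := Integrable.of_bound hWm _ (ae_of_all _ hmb)
  have hGi : Integrable G P := Integrable.of_bound hGm _ (ae_of_all _ hGb)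
  have h1 := norm_mpPoly_sub_le (c := c) (a := a) (z := z) hWm hmb hEb
  have h2 := norm_approx_mpEquation_le a hz hn hp
  have e1 : ∫ y, m y ^ 2 ∂π = ∫ ω, m (x ω) ^ 2 ∂P := by
    rw [← hmap, integral_map hx (by fun_prop)]
  have e2 : ∫ y, m y ∂π = ∫ ω, m (x ω) ∂P := by
    rw [← hmap, integral_map hx (by fun_prop)]
  change ‖(c : ℂ) * (z + a) * ∫ y, m y ^ 2 ∂π + (z + (c : ℂ)) * ∫ y, m y ∂π + 1‖ ≤ _ at h2
  rw [e1, e2] at h2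
  have h3 : ∫ ω, ‖m (x ω) - G ω‖ ∂P ≤
      |a| * (1 / z.im * (1 / z.im)) * √((∫ t : ℝ, t ^ 4 ∂gaussianReal 0 1) / p) := by
    refine le_trans (le_of_eq ?_) (integral_norm_sub_kernelStieltjes_le (n := n) hp hn a hz)
    rw [← hπ, ← hmap, integral_map hx]
    exact (hm.sub hg).norm.aestronglyMeasurable
  have h4 : ∫ ω, ‖m (x ω) - E‖ ∂P ≤ ∫ ω, ‖m (x ω) - G ω‖ ∂P + ∫ ω, ‖G ω - E‖ ∂P := by
    have i1 : Integrable (fun ω => ‖m (x ω) - G ω‖) P := (hWi.sub hGi).norm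
    have i2 : Integrable (fun ω => ‖G ω - E‖) P := (hGi.sub (integrable_const E)).norm
    have i3 : Integrable (fun ω => ‖m (x ω) - E‖) P := (hWi.sub (integrable_const E)).norm
    rw [← integral_add i1 i2]
    exact integral_mono i3 (i1.add i2) fun ω => norm_sub_le_norm_sub_add_norm_sub _ _ _
  refine (norm_le_norm_sub_add _ _).trans (add_le_add (h1.trans ?_) h2)
  gcongr
  exact h4.trans (by gcongr)

variable {n p : ℕ → ℕ} {X : (k : ℕ) → Fin (n k) → Ω → EuclideanSpace ℝ (Fin (p k))}

/-- The Stieltjes transforms concentrate around their means. -/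
theorem ae_tendsto_kernelStieltjes_sub_integral [∀ k, NeZero (n k)] (hn : StrictMono n)
    (hlaw : ∀ k i j, HasLaw (fun ω => X k i ω j) (gaussianReal 0 ((p k : NNReal)⁻¹)) P)
    (hindep : ∀ k, iIndepFun (fun (ij : Fin (n k) × Fin (p k)) ω => X k ij.1 ω ij.2) P)
    (a : ℝ) {z : ℂ} (hz : 0 < z.im) :
    ∀ᵐ ω ∂P, Tendsto (fun k => kernelStieltjes a z (fun i j => X k i ω j) -
      ∫ ω', kernelStieltjes a z (fun i j => X k i ω' j) ∂P) atTop (𝓝 0) := by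
  have hC : (0 : ℝ) < 2 * (4 / z.im) ^ 2 := by positivity
  have key : ∀ k (ε : ℝ) (f : (Fin (n k) → Fin (p k) → ℝ) → ℝ), 0 < ε → Measurable f →
      HasBoundedDifferences f (4 / z.im / n k) →
      P.real {ω | ε ≤ |f (fun i j => X k i ω j) - ∫ ω', f (fun i j => X k i ω' j) ∂P|} ≤
      2 * Real.exp (-(ε ^ 2 / (2 * (4 / z.im) ^ 2)) * n k) := by
    intro k ε f hε hf hb
    refine (measureReal_deviation_le (hlaw k) (hindep k) hf hb hε.le).trans (le_of_eq ?_)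
    have : (n k : ℝ) ≠ 0 := Nat.cast_ne_zero.2 (NeZero.ne _)
    congr 2
    field_simp
  have hmeas : ∀ k, Measurable (kernelStieltjes (n := n k) (p := p k) a z) := fun k =>
    (continuous_kernelStieltjes a hz).measurable
  have hint : ∀ k, Integrable (fun ω => kernelStieltjes a z (fun i j => X k i ω j)) P := fun k =>
    Integrable.of_bound
      ((hmeas k).comp_aemeasurable (aemeasurable_rows (hlaw k))).aestronglyMeasurable
      (1 / z.im) (ae_of_all _ fun ω => norm_kernelStieltjes_le a hz _)
  have hre := ae_tendsto_zero_of_measureReal_le hn hC fun k ε hε =>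
    key k ε _ hε (Complex.measurable_re.comp (hmeas k))
      (hasBoundedDifferences_re_kernelStieltjes a hz)
  have him := ae_tendsto_zero_of_measureReal_le hn hC fun k ε hε =>
    key k ε _ hε (Complex.measurable_im.comp (hmeas k))
      (hasBoundedDifferences_im_kernelStieltjes a hz)
  filter_upwards [hre, him] with ω h1 h2
  rw [tendsto_zero_iff_norm_tendsto_zero]
  refine squeeze_zero (fun _ => norm_nonneg _) (fun k => Complex.norm_le_abs_re_add_abs_im _) ?_
  have h := h1.abs.add h2.abs
  simp only [abs_zero, add_zero] at h
  refine h.congr fun k => ?_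
  have i1 := integral_re (hint k)
  have i2 := integral_im (hint k)
  simp only [RCLike.re_to_complex, RCLike.im_to_complex] at i1 i2
  simp only [Function.comp_apply, Complex.sub_re, Complex.sub_im]
  rw [i1, i2]

theorem tendsto_p_atTop {n p : ℕ → ℕ} {γ : ℝ} (hγ : 0 < γ) (hn : StrictMono n)
    (hpn : Tendsto (fun k => (p k : ℝ) / (n k : ℝ)) atTop (𝓝 γ)) :
    Tendsto (fun k => (p k : ℝ)) atTop atTop := by
  have h1 : Tendsto (fun k => (n k : ℝ)) atTop atTop :=
    tendsto_natCast_atTop_atTop.comp hn.tendsto_atTop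
  refine (hpn.pos_mul_atTop hγ h1).congr' ?_
  filter_upwards [h1.eventually_gt_atTop 0] with k hk
  field_simp

/-- Almost surely, the Stieltjes transforms solve the equation asymptotically. The means converge to
the solution because they are approximate solutions, and the transforms follow their means. -/
theorem ae_tendsto_mpPoly_kernelStieltjes [∀ k, NeZero (n k)] (hn : StrictMono n) {γ : ℝ}
    (hγ : 0 < γ) (hpn : Tendsto (fun k => (p k : ℝ) / (n k : ℝ)) atTop (𝓝 γ))
    (hlaw : ∀ k i j, HasLaw (fun ω => X k i ω j) (gaussianReal 0 ((p k : NNReal)⁻¹)) P)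
    (hindep : ∀ k, iIndepFun (fun (ij : Fin (n k) × Fin (p k)) ω => X k ij.1 ω ij.2) P)
    (a : ℝ) {z : ℂ} (hz : 0 < z.im) :
    ∀ᵐ ω ∂P, Tendsto (fun k => mpPoly a (a / γ) z (kernelStieltjes a z (fun i j => X k i ω j)))
      atTop (𝓝 0) := by
  set G : ℕ → Ω → ℂ := fun k ω => kernelStieltjes a z (fun i j => X k i ω j) with hG
  set E : ℕ → ℂ := fun k => ∫ ω, G k ω ∂P with hE
  have hconc : ∀ᵐ ω ∂P, Tendsto (fun k => G k ω - E k) atTop (𝓝 0) :=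
    ae_tendsto_kernelStieltjes_sub_integral hn hlaw hindep a hz
  have hGb : ∀ k ω, ‖G k ω‖ ≤ 1 / z.im := fun k ω => norm_kernelStieltjes_le a hz _
  have hGm : ∀ k, AEStronglyMeasurable (G k) P := fun k =>
    ((continuous_kernelStieltjes a hz).measurable.comp_aemeasurable
      (aemeasurable_rows (hlaw k))).aestronglyMeasurable
  have hGi : ∀ k, Integrable (G k) P := fun k =>
    Integrable.of_bound (hGm k) _ (ae_of_all _ (hGb k))
  have hEb : ∀ k, ‖E k‖ ≤ 1 / z.im := fun k => by
    refine (norm_integral_le_of_norm_le_const (ae_of_all P (hGb k))).trans (le_of_eq ?_)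
    simp
  have hEim : ∀ k, 0 ≤ (E k).im := fun k => by
    have h := integral_im (hGi k)
    simp only [RCLike.im_to_complex] at h
    rw [hE, ← h]
    refine integral_nonneg fun ω => ?_
    have h1 := im_stieltjesTransform_pos (esd (linearKernelMatrix a fun i j => X k i ω j)
      (linearKernelMatrix_isHermitian a _) : Measure ℝ) hz
    rw [stieltjesTransform_esd _ hz] at h1
    exact h1.le
  -- almost sure concentration gives concentration in the mean, everything being bounded
  have hL1 : Tendsto (fun k => ∫ ω, ‖G k ω - E k‖ ∂P) atTop (𝓝 0) := by
    have h := tendsto_integral_of_dominated_convergence (μ := P)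
      (F := fun k ω => ‖G k ω - E k‖) (f := fun _ => 0) (fun _ => 1 / z.im + 1 / z.im)
      (fun k => ((hGm k).sub aestronglyMeasurable_const).norm) (integrable_const _)
      (fun k => ae_of_all _ fun ω => by
        rw [norm_norm]
        exact (norm_sub_le _ _).trans (add_le_add (hGb k ω) (hEb k)))
      (by
        filter_upwards [hconc] with ω hω
        simpa using hω.norm)
    simpa using h
  have hp := tendsto_p_atTop hγ hn hpn
  have hc : Tendsto (fun k => a * ((n k : ℝ) / p k)) atTop (𝓝 (a / γ)) := by
    have h := (hpn.inv₀ hγ.ne').const_mul a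
    simpa only [inv_div, ← div_eq_mul_inv] using h
  have hcC : Tendsto (fun k => ((a * ((n k : ℝ) / p k) : ℝ) : ℂ)) atTop (𝓝 ((a / γ : ℝ) : ℂ)) :=
    (Complex.continuous_ofReal.tendsto _).comp hc
  have happrox : Tendsto (fun k => mpPoly a (a * ((n k : ℝ) / p k)) z (E k)) atTop (𝓝 0) := by
    have hsqrt : Tendsto (fun k => √((∫ t : ℝ, t ^ 4 ∂gaussianReal 0 1) / p k)) atTop (𝓝 0) := by
      have h := (Real.continuous_sqrt.tendsto 0).comp
        (tendsto_const_nhds (x := ∫ t : ℝ, t ^ 4 ∂gaussianReal 0 1) |>.div_atTop hp)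
      rw [Real.sqrt_zero] at h
      exact h
    have hb := ((((hcC.mul_const (z + a)).norm.mul_const (2 * (1 / z.im))).add
      (hcC.const_add z).norm).mul
        ((hsqrt.const_mul (|a| * (1 / z.im * (1 / z.im)))).add hL1)).add
      ((tendsto_const_nhds (x := |a|) |>.div_atTop hp).mul_const
        (1 / z.im + ‖a + z‖ * (1 / z.im * (1 / z.im))))
    simp only [mul_zero, add_zero, zero_mul] at hb
    rw [tendsto_zero_iff_norm_tendsto_zero]
    refine squeeze_zero' (.of_forall fun _ => norm_nonneg _) ?_ hb
    filter_upwards [hp.eventually_gt_atTop 0] with k hk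
    exact norm_mpPoly_integral_kernelStieltjes_le (by exact_mod_cast hk.ne') (NeZero.ne _)
      (hlaw k) (hindep k) a hz
  have hE0 : Tendsto (fun k => mpPoly a (a / γ) z (E k)) atTop (𝓝 0) := by
    have hd : Tendsto (fun k => (((a / γ : ℝ) : ℂ) - ((a * ((n k : ℝ) / p k) : ℝ) : ℂ)) *
        ((z + a) * E k ^ 2 + E k)) atTop (𝓝 0) := by
      have h0 : Tendsto (fun k => ((a / γ : ℝ) : ℂ) - ((a * ((n k : ℝ) / p k) : ℝ) : ℂ)) atTop
          (𝓝 0) := by simpa using hcC.const_sub ((a / γ : ℝ) : ℂ)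
      refine h0.zero_mul_isBoundedUnder_le
        ⟨‖z + a‖ * (1 / z.im) ^ 2 + 1 / z.im, ?_⟩
      refine Filter.eventually_map.2 (.of_forall fun k => ?_)
      refine (norm_add_le _ _).trans ?_
      rw [norm_mul, norm_pow]
      gcongr <;> exact hEb k
    have h := happrox.add hd
    rw [add_zero] at h
    refine h.congr fun k => ?_
    rw [mpPoly, mpPoly]
    ring
  obtain ⟨l, -, hl0, hl⟩ := tendsto_of_mpPoly_tendsto_zero hγ hz hEb hEim hE0
  filter_upwards [hconc] with ω hω
  have h1 : Tendsto (fun k => G k ω) atTop (𝓝 l) := by simpa using hω.add hl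
  rw [← hl0]
  exact ((continuous_mpPoly a (a / γ) z).tendsto l).comp h1

end Limit

/-! ### The limiting distribution -/

/-- The almost sure weak limit exists and is deterministic, its Stieltjes transform solving the
equation. -/
theorem exists_ae_tendsto_esd {a γ : ℝ} (hγ : 0 < γ) {n p : ℕ → ℕ} [∀ k, NeZero (n k)]
    (hn : StrictMono n) (hpn : Tendsto (fun k => (p k : ℝ) / (n k : ℝ)) atTop (𝓝 γ))
    {Ω : Type*} [MeasurableSpace Ω] {P : Measure Ω} [IsProbabilityMeasure P]
    {X : (k : ℕ) → Fin (n k) → Ω → EuclideanSpace ℝ (Fin (p k))}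
    (hlaw : ∀ k i j, HasLaw (fun ω => X k i ω j) (gaussianReal 0 ((p k : NNReal)⁻¹)) P)
    (hindep : ∀ k, iIndepFun (fun (ij : Fin (n k) × Fin (p k)) ω => X k ij.1 ω ij.2) P) :
    ∃ ρ : ProbabilityMeasure ℝ,
      (∀ z : ℂ, 0 < z.im → MPEquation a γ z (stieltjesTransform ρ z)) ∧
      ∀ᵐ ω ∂P, Tendsto
        (fun k => esd (kernelMatrix (fun ξ => a * ξ) (fun i => X k i ω))
          (kernelMatrix_isHermitian (fun ξ => a * ξ) (fun i => X k i ω)))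
        atTop (𝓝 ρ) := by
  obtain ⟨D, hDc, hD, hcl, hN⟩ := exists_countable_dense_upperHalfPlane
  have hae : ∀ᵐ ω ∂P, ∀ z ∈ D, Tendsto
      (fun k => mpPoly a (a / γ) z (kernelStieltjes a z (fun i j => X k i ω j))) atTop (𝓝 0) :=
    (ae_ball_iff hDc).2 fun z hz =>
      ae_tendsto_mpPoly_kernelStieltjes hn hγ hpn hlaw hindep a (hD z hz)
  have hlim : ∀ᵐ ω ∂P, ∃ μ : ProbabilityMeasure ℝ, Tendsto
        (fun k => esd (kernelMatrix (fun ξ => a * ξ) (fun i => X k i ω))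
          (kernelMatrix_isHermitian (fun ξ => a * ξ) (fun i => X k i ω))) atTop (𝓝 μ) ∧
      ∀ z : ℂ, 0 < z.im → MPEquation a γ z (stieltjesTransform μ z) := by
    filter_upwards [hae] with ω hω
    refine exists_tendsto_of_mpPoly_tendsto_zero hγ hD hcl (fun N h => hN N h) fun z hz => ?_
    refine (hω z hz).congr fun k => ?_
    rw [stieltjesTransform_esd _ (hD z hz)]
    rfl
  -- the limit does not depend on the sample point, because the equation determines it
  obtain ⟨ω₀, ρ, -, hρ⟩ := hlim.exists
  refine ⟨ρ, hρ, ?_⟩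
  filter_upwards [hlim] with ω ⟨μ, hμ, hμeq⟩
  have : μ = ρ := ProbabilityMeasure.toMeasure_injective (eq_of_mpEquation hγ hμeq hρ)
  rwa [this] at hμ

/-- An affine image of the Marchenko–Pastur law is the probability measure `ρ`, so that the law has
total mass one itself. -/
theorem isProbabilityMeasure_mpLaw_of_mpEquation {γ : ℝ} (hγ : 0 < γ) (ρ : ProbabilityMeasure ℝ)
    (h : ∀ z : ℂ, 0 < z.im → MPEquation 1 γ z (stieltjesTransform ρ z)) :
    IsProbabilityMeasure (mpLaw (1 / γ)) := by
  have e := (eq_of_mpEquation_of_ne_zero one_ne_zero hγ ρ h).trans (map_mpLaw one_ne_zero).symm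
  have hu : (ρ : Measure ℝ) Set.univ = 1 := measure_univ
  rw [e, Measure.map_apply (by fun_prop) MeasurableSet.univ] at hu
  exact ⟨by simpa using hu⟩

theorem stieltjesTransform_dirac_zero_mpEquation {γ : ℝ} {z : ℂ} (hz : 0 < z.im) :
    MPEquation 0 γ z (stieltjesTransform (Measure.dirac 0) z) := by
  rw [stieltjesTransform_mpEquation_iff _ hz, stieltjesTransform_eq]
  have h0 : z ≠ 0 := by rintro rfl; simp at hz
  simp [mpPoly, h0]

end

theorem theorem2p1 (a γ : ℝ) (hγ : 0 < γ)
    (n p : ℕ → ℕ) [∀ k, NeZero (n k)] (hn : StrictMono n)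
    (hpn : Tendsto (fun k => (p k : ℝ) / (n k : ℝ)) atTop (𝓝 γ))
    {Ω : Type*} [MeasurableSpace Ω] (P : Measure Ω) [IsProbabilityMeasure P]
    (X : (k : ℕ) → Fin (n k) → Ω → EuclideanSpace ℝ (Fin (p k)))
    (hlaw : ∀ k i j, HasLaw (fun ω => X k i ω j) (gaussianReal 0 ((p k : NNReal)⁻¹)) P)
    (hindep : ∀ k, iIndepFun (fun (ij : Fin (n k) × Fin (p k)) ω => X k ij.1 ω ij.2) P) :
    ∃ ρ : ProbabilityMeasure ℝ,
      -- the limit is the Marchenko–Pastur law with parameter `1/γ`, shifted and rescaled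
      (ρ : Measure ℝ) = (mpLaw (1 / γ)).map (fun x => a * x - a) ∧
      (a ≠ 0 → (ρ : Measure ℝ) =
        ENNReal.ofReal (max (1 - γ) 0) • Measure.dirac (-a)
          + volume.withDensity fun t =>
              ENNReal.ofReal (1 / |a| * mpDensity (1 / γ) ((t + a) / a))) ∧
      -- almost surely, the empirical spectral distribution converges weakly to it
      (∀ᵐ ω ∂P, Tendsto
        (fun k => esd (kernelMatrix (fun ξ => a * ξ) (fun i => X k i ω))
          (kernelMatrix_isHermitian (fun ξ => a * ξ) (fun i => X k i ω)))
        atTop (𝓝 ρ)) ∧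
      -- it is characterized by its Stieltjes transform solving the Marchenko–Pastur equation
      (∀ z : ℂ, 0 < z.im → ∃! m : ℂ, 0 < m.im ∧ MPEquation a γ z m) ∧
      (∀ ν : ProbabilityMeasure ℝ,
        ν = ρ ↔ ∀ z : ℂ, 0 < z.im → MPEquation a γ z (stieltjesTransform ν z)) := by
  obtain ⟨ρ, hρ, hlim⟩ := exists_ae_tendsto_esd (a := a) hγ hn hpn hlaw hindep
  have hden : a ≠ 0 → (ρ : Measure ℝ) = ENNReal.ofReal (max (1 - γ) 0) • Measure.dirac (-a)
      + volume.withDensity fun t =>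
          ENNReal.ofReal (1 / |a| * mpDensity (1 / γ) ((t + a) / a)) :=
    fun ha => eq_of_mpEquation_of_ne_zero ha hγ ρ hρ
  refine ⟨ρ, ?_, hden, hlim, fun z hz => ?_, fun ν => ⟨fun h => h ▸ hρ, fun h =>
    ProbabilityMeasure.toMeasure_injective (eq_of_mpEquation hγ h hρ)⟩⟩
  · rcases eq_or_ne a 0 with rfl | ha
    · -- the total mass of the Marchenko–Pastur law is read off from the case `a = 1`
      obtain ⟨ρ₁, hρ₁, -⟩ := exists_ae_tendsto_esd (a := 1) hγ hn hpn hlaw hindep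
      have := isProbabilityMeasure_mpLaw_of_mpEquation hγ ρ₁ hρ₁
      rw [eq_of_mpEquation hγ hρ fun z hz => stieltjesTransform_dirac_zero_mpEquation hz]
      simp only [zero_mul, sub_zero]
      rw [Measure.map_const, measure_univ, one_smul]
    · exact (hden ha).trans (map_mpLaw ha).symm
  · have hpos := im_stieltjesTransform_pos (ρ : Measure ℝ) hz
    refine ⟨stieltjesTransform ρ z, ⟨hpos, hρ z hz⟩, fun m hm => ?_⟩
    exact mpPoly_unique hγ hz hm.1 hpos ((mpEquation_iff_mpPoly hm.1).1 hm.2)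
      ((mpEquation_iff_mpPoly hpos).1 (hρ z hz))
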